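/- Consider a family of $n$-qubit M-states $|\psi\rangle$: each $|\psi\rangle$ is a unit vector which is, up to a global phase, the unique common $+1$ eigenvector of $m=\mathrm{poly}(n)$ unitary operators $U_1,\dots,U_m$ that are monomial in the computational basis, $U_i|y\rangle=\lambda_i(y)\,|\pi_i(y)\rangle$ with permutations $\pi_i$ of the $n$-bit strings and phases $\lambda_i(y)$, and that generate a finite group $\mathcal G$. Every state is given by a classical description of $\mathrm{poly}(n)$ bits, from which $\pi_i(y)$ and $\pi_i^{-1}(y)$ can be computed in time $\mathrm{poly}(n)$ and $\lambda_i(y)$ can be computed to $t$ bits of precision in time $\mathrm{poly}(n,t)$. Let $\mathcal P$ be the group of the permutation parts of the elements of $\mathcal G$ and $\mathcal O_x$ the orbit of $x$ under $\mathcal P$. For $x$ in the support of the common $+1$ eigenspace, let $|\psi_x\rangle$ be the normalized orthogonal projection of $|x\rangle$ on this space and, for $y\in\mathcal O_x$, let $\xi_x(y)$ be the unique number $\xi$ such that $U|x\rangle=\xi|y\rangle$ for some $U\in\mathcal G$. Suppose that the following tasks have efficient classical algorithms: (a) determine an $n$-bit string $x$ with $|\psi\rangle\propto|\psi_x\rangle$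 (in time $\mathrm{poly}(n)$); and, for this $x$, (b) generate a uniformly random element of $\mathcal O_x$ by means of fair coins, with error at most $\delta(s)$ in total variation distance, in time $\mathrm{poly}(n,s)$, where $\delta$ is a given function with $\delta(s)\le 2^{-s}$ for all $s\in\mathbb N$ (for example $\delta=0$, exact sampling, or $\delta(s)=2^{-s}$); (c) given an $n$-bit string $y$, decide whether $y\in\mathcal O_x$ (in time $\mathrm{poly}(n)$); (d) given $y\in\mathcal O_x$, compute $\xi_x(y)$ to $t$ bits of precision (in time $\mathrm{poly}(n,t)$). Then there is a randomized classical algorithm that, given the description of $|\psi\rangle$ and $s$, samples the distribution $\{|\langle y|\psi\rangle|^2\}_y$ with error at most $\delta(s)$ in total variation distance in time $\mathrm{poly}(n,s)$. Furthermore, consider a family of observables $A$ on these systems, each with $\|A\|\le 1$ and acting nontrivially on at most $k=O(\log n)$ qubits, given by classical descriptions of $\mathrm{poly}(n)$ bits from which the set of these qubits can be computed in time $\mathrm{poly}(n)$ and the matrix elements of $A$ can be computed to $t$ bits of precision in time $\mathrm{poly}(n,t)$. Then there is a randomized classical algorithm that, given the descriptions of $|\psi\rangle$ and $A$ and integers $T\ge1$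 and $s\ge 0$, outputs in time $\mathrm{poly}(n,T,s)$ a rational number which, with probability at least $1-2^{-s}$, differs from $\langle\psi|A|\psi\rangle$ by at most $1/T$. (In particular, accuracy $1/\mathrm{poly}(n)$ with exponentially small failure probability is reached in time $\mathrm{poly}(n)$.) Here an algorithm is a single program, for the whole family, of a randomized register machine with fair coins, integer arithmetic and logarithmic cost, which receives $n$ and the description(s) among its inputs; running times hold for all outcomes of the coins, and the results in (a), (c), (d) and of the computations with $U_i$ and $A$ are correct with certainty. -/

import Mathlib

/-! ### Randomized register machines with logarithmic cost -/

/-- Memory of the machine: integer registers, all but finitely many of them unused. -/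
abbrev Mem := ℕ → ℤ

/-- The arithmetic operations of the machine (`div` is the Euclidean division of integers,
with remainder in `[0, |b|)`, and `a / 0 = 0`). -/
inductive ArithOp
  | add | sub | mul | div

/-- Value of an arithmetic operation. -/
def ArithOp.eval : ArithOp → ℤ → ℤ → ℤ
  | .add, a, b => a + b
  | .sub, a, b => a - b
  | .mul, a, b => a * b
  | .div, a, b => a / b

/-- Number of binary digits of `|a|`. -/
def bitLength (a : ℤ) : ℕ := a.natAbs.size

/-- Programs of a randomized register machine: a structured form of the random access machine with
arithmetic on integers of arbitrary length (charged by their length, see `Runs`) and fair coins.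
Every program uses only finitely many registers. -/
inductive Prog
  | skip : Prog
  | const (r : ℕ) (c : ℤ) : Prog
  | arith (r : ℕ) (op : ArithOp) (a b : ℕ) : Prog
  | flip (r : ℕ) : Prog
  | seq (p q : Prog) : Prog
  | ifPos (r : ℕ) (p q : Prog) : Prog
  | whilePos (r : ℕ) (p : Prog) : Prog

/-- A fair coin. -/
noncomputable def fairCoin : PMF Bool := PMF.uniformOfFintype Bool

/-- `Runs p σ μ T`: started in memory `σ`, the program `p` halts for every outcome of its coins, at
a total cost of at most `T`, and its final memory has the distribution `μ`.
The cost of a step is logarithmic: one plus the bit lengths of all integers that it handles. -/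
inductive Runs : Prog → Mem → PMF Mem → ℕ → Prop
  | skip (σ : Mem) : Runs .skip σ (PMF.pure σ) 1
  | const (σ : Mem) (r : ℕ) (c : ℤ) :
      Runs (.const r c) σ (PMF.pure (Function.update σ r c)) (1 + bitLength c)
  | arith (σ : Mem) (r : ℕ) (op : ArithOp) (a b : ℕ) :
      Runs (.arith r op a b) σ (PMF.pure (Function.update σ r (op.eval (σ a) (σ b))))
        (1 + bitLength (σ a) + bitLength (σ b) + bitLength (op.eval (σ a) (σ b)))
  | flip (σ : Mem) (r : ℕ) :
      Runs (.flip r) σ (fairCoin.map fun b => Function.update σ r (if b then 1 else 0)) 1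
  | seq (σ : Mem) (p q : Prog) (μ : PMF Mem) (ν : Mem → PMF Mem) (S T : ℕ) :
      Runs p σ μ S → (∀ σ' ∈ μ.support, Runs q σ' (ν σ') T) →
      Runs (.seq p q) σ (μ.bind ν) (S + T)
  | ifTrue (σ : Mem) (r : ℕ) (p q : Prog) (μ : PMF Mem) (T : ℕ) :
      0 < σ r → Runs p σ μ T → Runs (.ifPos r p q) σ μ (1 + bitLength (σ r) + T)
  | ifFalse (σ : Mem) (r : ℕ) (p q : Prog) (μ : PMF Mem) (T : ℕ) :
      σ r ≤ 0 → Runs q σ μ T → Runs (.ifPos r p q) σ μ (1 + bitLength (σ r) + T)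
  | whileDone (σ : Mem) (r : ℕ) (p : Prog) :
      σ r ≤ 0 → Runs (.whilePos r p) σ (PMF.pure σ) (1 + bitLength (σ r))
  | whileStep (σ : Mem) (r : ℕ) (p : Prog) (μ : PMF Mem) (ν : Mem → PMF Mem) (S T : ℕ) :
      0 < σ r → Runs p σ μ S → (∀ σ' ∈ μ.support, Runs (.whilePos r p) σ' (ν σ') T) →
      Runs (.whilePos r p) σ (μ.bind ν) (1 + bitLength (σ r) + S + T)
  | weaken (p : Prog) (σ : Mem) (μ : PMF Mem) (S T : ℕ) :
      S ≤ T → Runs p σ μ S → Runs p σ μ T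

/-- Initial memory: the inputs stand in the first registers, all other registers hold `0`. -/
def initMem (input : List ℤ) : Mem := fun i => input.getD i 0

/-- A family of computational tasks, indexed by `α`, with inputs `input a`, has an efficient
(randomized) classical algorithm: one single program runs, on the input of every `a`, in time
polynomial in `size a` (for all outcomes of its coins), and its final memory, as a random variable,
is as `good a` requires. -/
def EfficientlySolvable {α : Type*} (input : α → List ℤ) (size : α → ℕ)
    (good : α → PMF Mem → Prop) : Prop :=
  ∃ (p : Prog) (time : Polynomial ℕ), ∀ a, ∃ μ : PMF Mem,
    Runs p (initMem (input a)) μ (time.eval (size a)) ∧ good a μ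

/-- `f` is bounded by a polynomial in `size`. -/
def PolyBounded {α : Type*} (f size : α → ℕ) : Prop :=
  ∃ q : Polynomial ℕ, ∀ a, f a ≤ q.eval (size a)

/-- The final memory satisfies `R` with certainty. -/
def Surely (R : Mem → Prop) (μ : PMF Mem) : Prop := ∀ σ ∈ μ.support, R σ

/-- The probability of `R` in the final memory. -/
noncomputable def probOf (μ : PMF Mem) (R : Mem → Prop) : ℝ := (μ.toOuterMeasure {σ | R σ}).toReal

/-- Registers `0` and `1` hold the real and imaginary part of `z` to `t` bits of precision:
`|(a + i b) / 2 ^ t - z| ≤ 2 ^ (-t)`. -/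
def HoldsApprox (t : ℕ) (z : ℂ) (σ : Mem) : Prop :=
  ‖((σ 0 : ℂ) + (σ 1 : ℂ) * Complex.I) / 2 ^ t - z‖ ≤ 1 / 2 ^ t

/-! ### Qubits and monomial stabilizer states -/

/-- `n`-bit strings. -/
abbrev Bits (n : ℕ) := Fin n → Bool

/-- A bit string as an integer input or output of the machine (least significant bit first). -/
def code {n : ℕ} (y : Bits n) : ℤ := (Nat.ofBits y : ℤ)

/-- Output register `0` has the distribution `P` on `n`-bit strings, up to the error `δ` in total
variation distance. -/
def SamplesWithin {n : ℕ} (P : Bits n → ℝ) (δ : ℝ) (μ : PMF Mem) : Prop :=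
  ∀ E : Set ℤ, |probOf μ (fun σ => σ 0 ∈ E) - ∑ y, (code ⁻¹' E).indicator P y| ≤ δ

/-- The uniform distribution on a set of bit strings. -/
noncomputable def uniformOn {n : ℕ} (O : Set (Bits n)) : Bits n → ℝ :=
  O.indicator fun _ => (O.ncard : ℝ)⁻¹

/-- The Hilbert space of `n` qubits. -/
abbrev Qubits (n : ℕ) := EuclideanSpace ℂ (Bits n)

/-- The computational basis state `|x⟩`. -/
noncomputable def ket {n : ℕ} (x : Bits n) : Qubits n := EuclideanSpace.single x 1

/-- Unitary operators on `n` qubits. -/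
abbrev UnitaryOp (n : ℕ) := Qubits n ≃ₗᵢ[ℂ] Qubits n

/-- `U = P D` with `P` the permutation matrix of `π` and `D` diagonal with diagonal `d`. As `U` is
unitary, the `d x` have modulus one. -/
def ActsMonomially {n : ℕ} (U : UnitaryOp n) (π : Equiv.Perm (Bits n)) (d : Bits n → ℂ) : Prop :=
  ∀ x, U (ket x) = d x • ket (π x)

/-- The common `+1` eigenspace of a family of operators. -/
noncomputable def commonEigenspace {n m : ℕ} (U : Fin m → UnitaryOp n) :
    Submodule ℂ (Qubits n) where
  carrier := {v | ∀ i, U i v = v}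
  add_mem' := fun {v w} hv hw i => by rw [map_add, hv i, hw i]
  zero_mem' := fun i => map_zero _
  smul_mem' := fun c v hv i => by rw [map_smul, hv i]

/-- An `n`-qubit M-state, specified by generators of a finite monomial stabilizer group: the
generators `U i : |x⟩ ↦ phase i x • |perm i x⟩` are unitary and monomial, generate a finite group,
and have the unit vector `ψ` as their unique common `+1` eigenvector, up to a phase. -/
structure MState (n : ℕ) where
  /-- number of generators -/
  m : ℕ
  /-- the generators -/
  U : Fin m → UnitaryOp n
  /-- the permutations by which the generators act on the basis -/
  perm : Fin m → Equiv.Perm (Bits n)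
  /-- the phases of the generators -/
  phase : Fin m → Bits n → ℂ
  acts : ∀ i, ActsMonomially (U i) (perm i) (phase i)
  finite : Finite (Subgroup.closure (Set.range U))
  /-- the M-state -/
  ψ : Qubits n
  norm_ψ : ‖ψ‖ = 1
  eigenspace_eq : commonEigenspace U = Submodule.span ℂ {ψ}

namespace MState

variable {n : ℕ} (M : MState n)

/-- The stabilizer group `𝒢`. -/
noncomputable def group : Subgroup (UnitaryOp n) := Subgroup.closure (Set.range M.U)

/-- The permutation group `𝒫 = {Ū : U ∈ 𝒢}`, where `Ū` is the permutation part of `U`. -/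
def permGroup : Set (Equiv.Perm (Bits n)) :=
  {P | ∃ U ∈ M.group, ∃ d : Bits n → ℂ, ActsMonomially U P d}

/-- The orbit `𝒪_x` of `x` under `𝒫`. -/
def orbit (x : Bits n) : Set (Bits n) := {y | ∃ P ∈ M.permGroup, P x = y}

/-- The M-space, i.e. the common `+1` eigenspace of the stabilizer group. -/
noncomputable def space : Submodule ℂ (Qubits n) := commonEigenspace M.U

/-- The support of the M-space. -/
def support : Set (Bits n) := {x | ∃ v ∈ M.space, inner ℂ (ket x) v ≠ 0}

/-- The orbit state `|ψ_x⟩ = ρ|x⟩ / ‖ρ|x⟩‖`, where `ρ` is the orthogonal projector on the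
M-space. -/
noncomputable def orbitState (x : Bits n) : Qubits n :=
  ((‖M.space.starProjection (ket x)‖⁻¹ : ℝ) : ℂ) • M.space.starProjection (ket x)

/-- `|ψ⟩ ∝ |ψ_x⟩`; the orbit state is only considered for `x` in the support. -/
def IsOrbitStateOf (x : Bits n) : Prop :=
  x ∈ M.support ∧ ∃ c : ℂ, c ≠ 0 ∧ M.ψ = c • M.orbitState x

/-- The phase `ξ_x(y)`: the (for `x` in the support and `y ∈ 𝒪_x` unique) number `ξ` such that
`U|x⟩ = ξ|y⟩` for some `U ∈ 𝒢`. -/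
noncomputable def xi (x y : Bits n) : ℂ :=
  Classical.epsilon fun ξ : ℂ => ∃ U ∈ M.group, U (ket x) = ξ • ket y

/-- The distribution `y ↦ |⟨y|ψ⟩|²`. -/
noncomputable def basisDistribution : Bits n → ℝ := fun y => ‖inner ℂ (ket y) M.ψ‖ ^ 2

end MState

/-- An observable `A` on `n` qubits with `‖A‖ ≤ 1` (operator norm) that acts nontrivially only on
the qubits in `sites`: it is of the form `B ⊗ 1` with `B` acting on these qubits. -/
structure LocalObservable (n : ℕ) where
  /-- the observable -/
  op : Qubits n →L[ℂ] Qubits n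
  isSelfAdjoint : IsSelfAdjoint op
  norm_le_one : ‖op‖ ≤ 1
  /-- the qubits on which it acts -/
  sites : Finset (Fin n)
  isLocal : ∃ B : Matrix (sites → Bool) (sites → Bool) ℂ, ∀ y z : Bits n,
    ((∀ i, i ∉ sites → y i = z i) →
      inner ℂ (ket y) (op (ket z)) = B (fun i => y i) (fun i => z i)) ∧
    (¬ (∀ i, i ∉ sites → y i = z i) → inner ℂ (ket y) (op (ket z)) = 0)

/-! ### Efficient descriptions

In the following, `n j` is the number of qubits of instance `j` of a family of M-states, and
`desc j` its classical description. -/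

/-- The M-states of the family have polynomially many generators with efficient descriptions, and
`π_i(y)`, `π_i⁻¹(y)` and `λ_i(y)` to `t` bits are computable in time polynomial in `n`, respectively
in `n` and `t`. -/
structure EfficientlyDescribed {ι : Type*} (n desc : ι → ℕ) (M : ∀ j, MState (n j)) : Prop where
  desc_size : PolyBounded (fun j => (desc j).size) n
  generators : PolyBounded (fun j => (M j).m) n
  perm : EfficientlySolvable
    (fun a : (j : ι) × (Fin (M j).m × Bits (n j)) =>
      [(n a.1 : ℤ), (desc a.1 : ℤ), ((a.2.1 : ℕ) : ℤ), code a.2.2])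
    (fun a => n a.1)
    (fun a => Surely fun σ => σ 0 = code ((M a.1).perm a.2.1 a.2.2))
  permInv : EfficientlySolvable
    (fun a : (j : ι) × (Fin (M j).m × Bits (n j)) =>
      [(n a.1 : ℤ), (desc a.1 : ℤ), ((a.2.1 : ℕ) : ℤ), code a.2.2])
    (fun a => n a.1)
    (fun a => Surely fun σ => σ 0 = code (((M a.1).perm a.2.1).symm a.2.2))
  phase : EfficientlySolvable
    (fun a : (j : ι) × (Fin (M j).m × Bits (n j) × ℕ) =>
      [(n a.1 : ℤ), (desc a.1 : ℤ), ((a.2.1 : ℕ) : ℤ), code a.2.2.1, (a.2.2.2 : ℤ)])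
    (fun a => n a.1 + a.2.2.2)
    (fun a => Surely (HoldsApprox a.2.2.2 ((M a.1).phase a.2.1 a.2.2.1)))

/-- A family of observables on the instances of the family, `A k` acting on the qubits of instance
`inst k`, is `O(log n)`-local and given by efficient classical descriptions `adesc k`: the set of
qubits it acts on (as a bit string) is computable in time polynomial in `n`, and its matrix elements
are computable to `t` bits in time polynomial in `n` and `t`. -/
structure EfficientlyDescribedObservables {ι κ : Type*} (n desc : ι → ℕ) (inst : κ → ι)
    (adesc : κ → ℕ) (A : ∀ k, LocalObservable (n (inst k))) : Prop where
  locality : ∃ C : ℕ, ∀ k, (A k).sites.card ≤ C * (Nat.log 2 (n (inst k)) + 1)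
  desc_size : PolyBounded (fun k => (adesc k).size) (fun k => n (inst k))
  sites : EfficientlySolvable
    (fun k => [(n (inst k) : ℤ), (desc (inst k) : ℤ), (adesc k : ℤ)])
    (fun k => n (inst k))
    (fun k => Surely fun σ => σ 0 = code fun i => decide (i ∈ (A k).sites))
  entry : EfficientlySolvable
    (fun a : (k : κ) × (Bits (n (inst k)) × Bits (n (inst k)) × ℕ) =>
      [(n (inst a.1) : ℤ), (desc (inst a.1) : ℤ), (adesc a.1 : ℤ),
        code a.2.1, code a.2.2.1, (a.2.2.2 : ℤ)])
    (fun a => n (inst a.1) + a.2.2.2)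
    (fun a => Surely (HoldsApprox a.2.2.2
      (inner ℂ (ket a.2.1) ((A a.1).op (ket a.2.2.1)))))

/-! ### Running programs: determinism, output sizes, relocation -/

/-! Structure of the state. If an element `U` of the stabilizer group maps `|x⟩` to `ξ|y⟩`, then `Uψ
= ψ` gives `ψ(y) = ξ ψ(x)` with `|ξ| = 1`. So `|ψ|` is constant on the orbit of `x`. The restriction
of `ψ` to this orbit is again fixed by all generators. As the fixed space is one-dimensional and
`ψ(x) ≠ 0`, nothing of `ψ` lies outside the orbit (`MState.amplitude_eq_zero`). Hence `|⟨y|ψ⟩|²` is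
the uniform distribution on the orbit (`MState.basisDistribution_eq`), and sampling it is task (b)
applied to the string found in (a).

Expectation values. In `⟨ψ|A|ψ⟩` only pairs `y, z` of the orbit that agree off the `k` sites of `A`
contribute. If `y` is uniform on the orbit and `z` arises from `y` by fresh random bits on the
sites, the expectation value is the mean of `2^k Re(conj ξ(y) ξ(z) A_yz)`, read as `0` when `z` is
not in the orbit (`LocalObservable.mean_eq_sum`). This variable is bounded by `2^k`, which is
polynomial in `n`, so polynomially many samples suffice by a Chernoff bound. Both imperfections, the
total variation error of the sampler and the rounding of phases and matrix elements, are absorbed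
into a bound for the exponential moment of a single sample (`momentBound`). It holds whatever the
previous samples were, so the bounds multiply along the loop (`efficient_sum`). Markov's inequality
for both signs of the exponent finishes the estimate (`SumState.Good.prob_le`).

Algorithms. Programs are never inspected as a whole. The predicate `Solv` describes a program by the
list of registers that it starts from and is closed under calls, arithmetic, coins and branches;
loops are added for `EfficientlySolvable`. Three facts about `Runs` carry this: the final
distribution is unique (`Runs.unique`), results are no longer than the inputs or the running time
(`Runs.bits`), and a program can be relocated to fresh registers (`Runs.shift`, `exists_call`). -/

theorem eval_nat_mono (q : Polynomial ℕ) {a b : ℕ} (h : a ≤ b) : q.eval a ≤ q.eval b := by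
  simp only [Polynomial.eval_eq_sum_range]
  gcongr

/-- `Runs` constrains the continuation of a program only on memories that can occur, so kernels have
to be compared on the support alone. -/
theorem bind_congr_support {γ δ : Type*} {μ : PMF γ} {ν ν' : γ → PMF δ}
    (h : ∀ s ∈ μ.support, ν s = ν' s) : μ.bind ν = μ.bind ν' := by
  ext d
  simp only [PMF.bind_apply]
  refine tsum_congr fun s => ?_
  by_cases hs : s ∈ μ.support
  · rw [h s hs]
  · rw [(μ.apply_eq_zero_iff s).2 hs, zero_mul, zero_mul]

theorem bind_const_support {γ δ : Type*} {μ : PMF γ} {ν : γ → PMF δ} {κ : PMF δ}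
    (h : ∀ s ∈ μ.support, ν s = κ) : μ.bind ν = κ := by
  rw [bind_congr_support h, PMF.bind_const]

/-- The rule `weaken` applies to every program; inversion is therefore an induction that strips such
rules from the derivation. This and the following inversions serve `Runs.unique`. -/
theorem Runs.inv_skip {σ μ T} (h : Runs .skip σ μ T) : μ = PMF.pure σ := by
  generalize hp : Prog.skip = p at h
  induction h <;> cases hp
  · rfl
  · rename_i ih; exact ih rfl

theorem Runs.inv_const {σ μ T r c} (h : Runs (.const r c) σ μ T) :
    μ = PMF.pure (Function.update σ r c) := by
  generalize hp : Prog.const r c = p at h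
  induction h <;> cases hp
  · rfl
  · rename_i ih; exact ih rfl

theorem Runs.inv_arith {σ μ T r op a b} (h : Runs (.arith r op a b) σ μ T) :
    μ = PMF.pure (Function.update σ r (op.eval (σ a) (σ b))) := by
  generalize hp : Prog.arith r op a b = p at h
  induction h <;> cases hp
  · rfl
  · rename_i ih; exact ih rfl

theorem Runs.inv_flip {σ μ T r} (h : Runs (.flip r) σ μ T) :
    μ = fairCoin.map fun b => Function.update σ r (if b then 1 else 0) := by
  generalize hp : Prog.flip r = p at h
  induction h <;> cases hp
  · rfl
  · rename_i ih; exact ih rfl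

theorem Runs.inv_seq {σ μ T p q} (h : Runs (.seq p q) σ μ T) :
    ∃ μ₁ ν S T', Runs p σ μ₁ S ∧ (∀ σ' ∈ μ₁.support, Runs q σ' (ν σ') T') ∧ μ = μ₁.bind ν := by
  generalize hp : Prog.seq p q = r at h
  induction h <;> cases hp
  · exact ⟨_, _, _, _, by assumption, by assumption, rfl⟩
  · rename_i ih; exact ih rfl

theorem Runs.inv_ifPos {σ μ T r p q} (h : Runs (.ifPos r p q) σ μ T) :
    (0 < σ r ∧ ∃ S, Runs p σ μ S) ∨ (σ r ≤ 0 ∧ ∃ S, Runs q σ μ S) := by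
  generalize hp : Prog.ifPos r p q = r at h
  induction h <;> cases hp
  · rename_i h1 h2 _
    exact .inl ⟨h1, _, h2⟩
  · rename_i h1 h2 _
    exact .inr ⟨h1, _, h2⟩
  · rename_i ih; exact ih rfl

theorem Runs.inv_whilePos {σ μ T r p} (h : Runs (.whilePos r p) σ μ T) :
    (σ r ≤ 0 ∧ μ = PMF.pure σ) ∨ (0 < σ r ∧ ∃ μ₁ ν S T', Runs p σ μ₁ S ∧
      (∀ σ' ∈ μ₁.support, Runs (.whilePos r p) σ' (ν σ') T') ∧ μ = μ₁.bind ν) := by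
  generalize hp : Prog.whilePos r p = q at h
  induction h <;> cases hp
  · rename_i h1
    exact .inl ⟨h1, rfl⟩
  · exact .inr ⟨by assumption, _, _, _, _, by assumption, by assumption, rfl⟩
  · rename_i ih; exact ih rfl

/-- The output distribution is determined by program and initial memory. -/
theorem Runs.unique {p σ μ T} (h : Runs p σ μ T) : ∀ {μ' T'}, Runs p σ μ' T' → μ' = μ := by
  induction h with
  | skip => exact fun h => h.inv_skip
  | const => exact fun h => h.inv_const
  | arith => exact fun h => h.inv_arith
  | flip => exact fun h => h.inv_flip
  | seq σ p q μ ν S T _ _ ih1 ih2 =>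
    intro μ' T' h
    obtain ⟨μ₁, ν', S', T'', h1, h2, rfl⟩ := h.inv_seq
    obtain rfl := ih1 h1
    exact bind_congr_support fun s hs => ih2 s hs (h2 s hs)
  | ifTrue σ r p q μ T h0 _ ih =>
    intro μ' T' h
    obtain ⟨_, S, h⟩ | ⟨h1, _⟩ := h.inv_ifPos
    · exact ih h
    · omega
  | ifFalse σ r p q μ T h0 _ ih =>
    intro μ' T' h
    obtain ⟨h1, _⟩ | ⟨_, S, h⟩ := h.inv_ifPos
    · omega
    · exact ih h
  | whileDone σ r p h0 =>
    intro μ' T' h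
    obtain ⟨_, h⟩ | ⟨h1, _⟩ := h.inv_whilePos
    · exact h
    · omega
  | whileStep σ r p μ ν S T h0 _ _ ih1 ih2 =>
    intro μ' T' h
    obtain ⟨h1, _⟩ | ⟨_, μ₁, ν', S', T'', h1, h2, rfl⟩ := h.inv_whilePos
    · omega
    · obtain rfl := ih1 h1
      exact bind_congr_support fun s hs => ih2 s hs (h2 s hs)
  | weaken _ _ _ _ _ _ _ ih => exact ih

/-! ### Lengths of results and the set of registers written -/

theorem bitLength_zero : bitLength 0 = 0 := by simp [bitLength]

theorem bitLength_one : bitLength 1 = 1 := by simp [bitLength]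

theorem bitLength_le_iff {a : ℤ} {k : ℕ} : bitLength a ≤ k ↔ a.natAbs < 2 ^ k := Nat.size_le

theorem bitLength_natCast_le (a : ℕ) : bitLength (a : ℤ) ≤ a := by
  rw [bitLength_le_iff, Int.natAbs_natCast]
  exact Nat.lt_two_pow_self

theorem update_bits_le {σ : Mem} {r : ℕ} {v : ℤ} {T : ℕ} (hv : bitLength v ≤ T) (i : ℕ) :
    bitLength (Function.update σ r v i) ≤ max (bitLength (σ i)) T := by
  by_cases h : i = r
  · subst h; simp [hv]
  · simp [h]

/-- The bit lengths of the results are bounded by the running time. -/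
theorem Runs.bits {p σ μ T} (h : Runs p σ μ T) :
    ∀ σ' ∈ μ.support, ∀ i, bitLength (σ' i) ≤ max (bitLength (σ i)) T := by
  induction h with
  | skip => simp
  | const σ r c =>
    intro σ' h i
    simp only [PMF.support_pure, Set.mem_singleton_iff] at h
    subst h
    exact update_bits_le (by omega) i
  | arith σ r op a b =>
    intro σ' h i
    simp only [PMF.support_pure, Set.mem_singleton_iff] at h
    subst h
    exact update_bits_le (by omega) i
  | flip σ r =>
    intro σ' h i
    obtain ⟨b, -, rfl⟩ := (PMF.mem_support_map_iff _ _ _).1 h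
    refine update_bits_le ?_ i
    cases b <;> simp [bitLength_zero, bitLength_one]
  | seq σ p q μ ν S T _ _ ih1 ih2 =>
    intro σ' h i
    obtain ⟨s, hs, h⟩ := (PMF.mem_support_bind_iff _ _ _).1 h
    have := ih1 s hs i
    have := ih2 s hs σ' h i
    omega
  | ifTrue σ r p q μ T h0 _ ih =>
    intro σ' h i
    have := ih σ' h i
    omega
  | ifFalse σ r p q μ T h0 _ ih =>
    intro σ' h i
    have := ih σ' h i
    omega
  | whileDone σ r p h0 => simp
  | whileStep σ r p μ ν S T h0 _ _ ih1 ih2 =>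
    intro σ' h i
    obtain ⟨s, hs, h⟩ := (PMF.mem_support_bind_iff _ _ _).1 h
    have := ih1 s hs i
    have := ih2 s hs σ' h i
    omega
  | weaken _ _ _ _ _ _ _ ih =>
    intro σ' h i
    have := ih σ' h i
    omega

/-- A bound for the registers that a program uses. -/
def Prog.width : Prog → ℕ
  | .skip => 0
  | .const r _ => r + 1
  | .arith r _ _ _ => r + 1
  | .flip r => r + 1
  | .seq p q => max p.width q.width
  | .ifPos _ p q => max p.width q.width
  | .whilePos _ p => p.width

/-- The width counts registers that are written, not those that are only read. After a call this
tells which registers may have to be reset. -/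
theorem Runs.untouched {p σ μ T} (h : Runs p σ μ T) :
    ∀ σ' ∈ μ.support, ∀ i, p.width ≤ i → σ' i = σ i := by
  induction h with
  | skip => simp
  | const σ r c =>
    intro σ' h i hi
    simp only [PMF.support_pure, Set.mem_singleton_iff] at h
    subst h
    rw [Function.update_of_ne]; simp only [Prog.width] at hi; omega
  | arith σ r op a b =>
    intro σ' h i hi
    simp only [PMF.support_pure, Set.mem_singleton_iff] at h
    subst h
    rw [Function.update_of_ne]; simp only [Prog.width] at hi; omega
  | flip σ r =>
    intro σ' h i hi
    obtain ⟨b, -, rfl⟩ := (PMF.mem_support_map_iff _ _ _).1 h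
    rw [Function.update_of_ne]; simp only [Prog.width] at hi; omega
  | seq σ p q μ ν S T _ _ ih1 ih2 =>
    intro σ' h i hi
    simp only [Prog.width] at hi
    obtain ⟨s, hs, h⟩ := (PMF.mem_support_bind_iff _ _ _).1 h
    rw [ih2 s hs σ' h i (by omega), ih1 s hs i (by omega)]
  | ifTrue σ r p q μ T h0 _ ih =>
    intro σ' h i hi
    simp only [Prog.width] at hi
    exact ih σ' h i (by omega)
  | ifFalse σ r p q μ T h0 _ ih =>
    intro σ' h i hi
    simp only [Prog.width] at hi
    exact ih σ' h i (by omega)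
  | whileDone σ r p h0 => simp
  | whileStep σ r p μ ν S T h0 _ _ ih1 ih2 =>
    intro σ' h i hi
    obtain ⟨s, hs, h⟩ := (PMF.mem_support_bind_iff _ _ _).1 h
    rw [ih2 s hs σ' h i hi, ih1 s hs i hi]
  | weaken _ _ _ _ _ _ _ ih => exact ih

/-- The program with all registers shifted by `L`. -/
def Prog.shift (L : ℕ) : Prog → Prog
  | .skip => .skip
  | .const r c => .const (L + r) c
  | .arith r op a b => .arith (L + r) op (L + a) (L + b)
  | .flip r => .flip (L + r)
  | .seq p q => .seq (p.shift L) (q.shift L)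
  | .ifPos r p q => .ifPos (L + r) (p.shift L) (q.shift L)
  | .whilePos r p => .whilePos (L + r) (p.shift L)

/-- The memory whose registers below `L` are those of `ρ`, followed by those of `τ`. -/
def glue (L : ℕ) (ρ τ : Mem) : Mem := fun i => if i < L then ρ i else τ (i - L)

theorem glue_high (L : ℕ) (ρ τ : Mem) (i : ℕ) : glue L ρ τ (L + i) = τ i := by
  simp [glue]

theorem glue_low {L i : ℕ} (ρ τ : Mem) (h : i < L) : glue L ρ τ i = ρ i := by
  simp [glue, h]

theorem glue_update_high (L : ℕ) (ρ τ : Mem) (r : ℕ) (v : ℤ) :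
    glue L ρ (Function.update τ r v) = Function.update (glue L ρ τ) (L + r) v := by
  funext i
  by_cases h : i = L + r
  · subst h; simp [glue]
  · rw [Function.update_of_ne h]
    unfold glue
    split_ifs with h1
    · rfl
    · rw [Function.update_of_ne (by omega)]

theorem glue_update_low {L r : ℕ} (ρ τ : Mem) (v : ℤ) (hr : r < L) :
    glue L (Function.update ρ r v) τ = Function.update (glue L ρ τ) r v := by
  funext i
  by_cases h : i = r
  · subst h; simp [glue, hr]
  · rw [Function.update_of_ne h]
    unfold glue
    split_ifs with h1
    · rw [Function.update_of_ne h]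
    · rfl

/-- A shifted program neither reads nor writes below `L`, so it repeats the original run, at the
same cost, next to an arbitrary frozen memory `ρ`. -/
theorem Runs.shift {p τ μ T} (h : Runs p τ μ T) (L : ℕ) (ρ : Mem) :
    Runs (p.shift L) (glue L ρ τ) (μ.map (glue L ρ)) T := by
  have key : ∀ τ, (fun i => glue L ρ τ (L + i)) = τ := fun τ => funext fun i => glue_high L ρ τ i
  induction h with
  | skip σ => rw [PMF.pure_map]; exact .skip _
  | const σ r c => rw [PMF.pure_map, glue_update_high]; exact .const _ _ _
  | arith σ r op a b =>
    rw [PMF.pure_map, glue_update_high]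
    have := Runs.arith (glue L ρ σ) (L + r) op (L + a) (L + b)
    simp only [glue_high] at this
    exact this
  | flip σ r =>
    rw [PMF.map_comp]
    have := Runs.flip (glue L ρ σ) (L + r)
    have e : (glue L ρ ∘ fun b : Bool => Function.update σ r (if b then 1 else 0)) =
        fun b : Bool => Function.update (glue L ρ σ) (L + r) (if b then 1 else 0) :=
      funext fun b => glue_update_high _ _ _ _ _
    rwa [e]
  | seq σ p q μ ν S T _ _ ih1 ih2 =>
    rw [PMF.map_bind]
    -- The continuation is a kernel on the original memories; reading off the registers from `L` on
    -- makes it one on the glued memories.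
    have e : (μ.bind fun a => (ν a).map (glue L ρ)) =
        (μ.map (glue L ρ)).bind fun m => (ν fun i => m (L + i)).map (glue L ρ) := by
      rw [PMF.bind_map]; congr 1; funext a; simp only [Function.comp, key]
    rw [e]
    refine .seq _ _ _ _ _ _ _ ih1 fun σ' hσ' => ?_
    obtain ⟨s, hs, rfl⟩ := (PMF.mem_support_map_iff _ _ _).1 hσ'
    simpa only [key] using ih2 s hs
  | ifTrue σ r p q μ T h0 _ ih =>
    have := Runs.ifTrue (glue L ρ σ) (L + r) (p.shift L) (q.shift L) _ T
      (by rwa [glue_high]) ih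
    simp only [glue_high] at this
    exact this
  | ifFalse σ r p q μ T h0 _ ih =>
    have := Runs.ifFalse (glue L ρ σ) (L + r) (p.shift L) (q.shift L) _ T
      (by rwa [glue_high]) ih
    simp only [glue_high] at this
    exact this
  | whileDone σ r p h0 =>
    have := Runs.whileDone (glue L ρ σ) (L + r) (p.shift L) (by rwa [glue_high])
    rw [PMF.pure_map]
    simp only [glue_high] at this
    exact this
  | whileStep σ r p μ ν S T h0 _ _ ih1 ih2 =>
    rw [PMF.map_bind]
    have e : (μ.bind fun a => (ν a).map (glue L ρ)) =
        (μ.map (glue L ρ)).bind fun m => (ν fun i => m (L + i)).map (glue L ρ) := by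
      rw [PMF.bind_map]; congr 1; funext a; simp only [Function.comp, key]
    rw [e]
    have := Runs.whileStep (glue L ρ σ) (L + r) (p.shift L) (μ.map (glue L ρ))
      (fun m => (ν fun i => m (L + i)).map (glue L ρ)) S T (by rwa [glue_high]) ih1
      fun σ' hσ' => by
        obtain ⟨s, hs, rfl⟩ := (PMF.mem_support_map_iff _ _ _).1 hσ'
        simp only [key]
        exact ih2 s hs
    simp only [glue_high] at this
    exact this
  | weaken p σ μ S T hST _ ih => exact .weaken _ _ _ _ _ hST ih

theorem Runs.seqPure {p q σ σ' μ S T} (h1 : Runs p σ (PMF.pure σ') S) (h2 : Runs q σ' μ T) :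
    Runs (.seq p q) σ μ (S + T) := by
  have := Runs.seq σ p q (PMF.pure σ') (fun _ => μ) S T h1 fun s hs => by
    simp only [PMF.support_pure, Set.mem_singleton_iff] at hs
    rwa [hs]
  simpa using this

theorem Runs.mono {p σ μ S T} (h : Runs p σ μ S) (hST : S ≤ T) : Runs p σ μ T :=
  .weaken _ _ _ _ _ hST h

/-! ### Calling a program as a subroutine -/

/-- Copy register `src` to register `dst`. -/
def copyReg (dst src : ℕ) : Prog := .seq (.const dst 0) (.arith dst .add src dst)

theorem copyReg_runs {dst src : ℕ} (h : src ≠ dst) (σ : Mem) :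
    Runs (copyReg dst src) σ (PMF.pure (Function.update σ dst (σ src)))
      (2 + 2 * bitLength (σ src)) := by
  have := Runs.seqPure (Runs.const σ dst 0) (Runs.arith _ dst .add src dst)
  simp only [ArithOp.eval, Function.update_self, Function.update_of_ne h, add_zero,
    Function.update_idem, bitLength_zero] at this
  exact this.mono (by omega)

/-- Copy the registers `src` to the registers `L', L' + 1, …`. -/
def copyIn (L' : ℕ) : List ℕ → Prog
  | [] => .skip
  | a :: l => .seq (copyReg L' a) (copyIn (L' + 1) l)

theorem initMem_append (l : List ℤ) (v : ℤ) :
    initMem (l ++ [v]) = Function.update (initMem l) l.length v := by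
  funext i
  unfold initMem
  by_cases h : i = l.length
  · subst h; simp
  · rw [Function.update_of_ne h]
    rcases lt_or_gt_of_ne h with h | h
    · simp [List.getD_eq_getElem?_getD, List.getElem?_append_left h]
    · simp only [List.getD_eq_getElem?_getD]
      rw [List.getElem?_eq_none (by simp; omega), List.getElem?_eq_none (by omega)]

theorem copyIn_runs (L' B : ℕ) (ρ : Mem) (hB : ∀ i < L', bitLength (ρ i) ≤ B) (src : List ℕ)
    (hs : ∀ a ∈ src, a < L') : ∀ vs : List ℤ,
    Runs (copyIn (L' + vs.length) src) (glue L' ρ (initMem vs))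
      (PMF.pure (glue L' ρ (initMem (vs ++ src.map ρ)))) (src.length * (2 + 2 * B) + 1) := by
  induction src with
  | nil => intro vs; simpa [copyIn] using Runs.skip _
  | cons a src ih =>
    intro vs
    have ha : a < L' := hs a (by simp)
    have h1 := copyReg_runs (dst := L' + vs.length) (src := a) (by omega) (glue L' ρ (initMem vs))
    rw [← glue_update_high, glue_low _ _ ha, ← initMem_append] at h1
    have h2 := ih (fun b hb => hs b (by simp [hb])) (vs ++ [ρ a])
    simp only [List.length_append, List.length_singleton, ← add_assoc, List.append_assoc,
      List.singleton_append] at h2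
    refine (Runs.seqPure h1 h2).mono ?_
    have := hB a ha
    simp only [List.length_cons]
    nlinarith

/-- Copy the registers `L', …, L' + m - 1` to `base, …, base + m - 1`. -/
def copyOut (L' base : ℕ) : ℕ → Prog
  | 0 => .skip
  | m + 1 => .seq (copyOut L' base m) (copyReg (base + m) (L' + m))

/-- Overwrite the registers `base, …, base + m - 1` of `ρ` by the first registers of `τ`. -/
def writeAt (base m : ℕ) (ρ τ : Mem) : Mem :=
  fun i => if base ≤ i ∧ i < base + m then τ (i - base) else ρ i

theorem writeAt_succ (base m : ℕ) (ρ τ : Mem) :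
    writeAt base (m + 1) ρ τ = Function.update (writeAt base m ρ τ) (base + m) (τ m) := by
  funext i
  by_cases h : i = base + m
  · subst h; simp [writeAt]
  · rw [Function.update_of_ne h]
    unfold writeAt
    congr 1
    apply propext
    omega

theorem copyOut_runs (L' base B : ℕ) (ρ τ : Mem) (hB : ∀ i, bitLength (τ i) ≤ B) :
    ∀ m, base + m ≤ L' → Runs (copyOut L' base m) (glue L' ρ τ)
      (PMF.pure (glue L' (writeAt base m ρ τ) τ)) (m * (2 + 2 * B) + 1) := by
  intro m
  induction m with
  | zero =>
    intro _
    have : writeAt base 0 ρ τ = ρ := by funext i; simp [writeAt]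
    rw [this]
    simpa [copyOut] using Runs.skip _
  | succ m ih =>
    intro h
    have h1 := ih (by omega)
    have h2 := copyReg_runs (dst := base + m) (src := L' + m) (by omega)
      (glue L' (writeAt base m ρ τ) τ)
    rw [glue_high, ← glue_update_low _ _ _ (by omega), ← writeAt_succ] at h2
    refine (Runs.seqPure h1 h2).mono ?_
    have := hB m
    nlinarith

/-- Set the registers `L', …, L' + w - 1` to zero. -/
def clearRegs (L' : ℕ) : ℕ → Prog
  | 0 => .skip
  | w + 1 => .seq (clearRegs L' w) (.const (L' + w) 0)

theorem clearRegs_runs (L' : ℕ) (ρ τ : Mem) (w : ℕ) :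
    Runs (clearRegs L' w) (glue L' ρ τ)
      (PMF.pure (glue L' ρ fun i => if i < w then 0 else τ i)) (w + 1) := by
  induction w with
  | zero => simpa [clearRegs] using Runs.skip _
  | succ w ih =>
    have h2 := Runs.const (glue L' ρ fun i => if i < w then 0 else τ i) (L' + w) 0
    rw [← glue_update_high, bitLength_zero] at h2
    have e : Function.update (fun i => if i < w then 0 else τ i) w 0 =
        fun i => if i < w + 1 then 0 else τ i := by
      funext i
      by_cases h : i = w
      · subst h; simp
      · rw [Function.update_of_ne h]
        congr 1
        apply propext
        omega
    rw [e] at h2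
    exact (Runs.seqPure ih h2).mono (by omega)

theorem initMem_length_le {l : List ℤ} {i : ℕ} (h : l.length ≤ i) : initMem l i = 0 := by
  unfold initMem
  rw [List.getD_eq_getElem?_getD, List.getElem?_eq_none h]
  rfl

theorem initMem_bits {l : List ℤ} {B : ℕ} (h : ∀ v ∈ l, bitLength v ≤ B) (i : ℕ) :
    bitLength (initMem l i) ≤ B := by
  unfold initMem
  rw [List.getD_eq_getElem?_getD]
  rcases hi : l[i]? with _ | v
  · simp [bitLength_zero]
  · simpa using h v (List.mem_of_getElem? hi)

/-- A subroutine call reads its inputs from the registers `src`, writes its outputs to the registers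
`base, …, base + m - 1`, and leaves all other registers as they were. -/
theorem exists_call (p : Prog) (L base m : ℕ) (src : List ℕ) (hsrc : ∀ a ∈ src, a < L) :
    ∃ (c : Prog) (K : ℕ), ∀ l : List ℤ, l.length = L → ∀ μ T B,
      Runs p (initMem (src.map (initMem l))) μ T → (∀ v ∈ l, bitLength v ≤ B) →
      Runs c (initMem l) (μ.map (writeAt base m (initMem l))) (T + K * (B + T + 1)) := by
  set L' := max L (base + m) with hL'
  -- The subroutine works above `L'`, beyond the caller's registers and the output block. Its
  -- registers from `p.width` on still hold the initial values, which vanish from `src.length` on.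
  -- Zeroing `p.width + src.length` registers therefore removes all traces, and nothing but the
  -- output block has changed.
  refine ⟨.seq (copyIn L' src) (.seq (p.shift L') (.seq (copyOut L' base m)
    (clearRegs L' (p.width + src.length)))), 2 * src.length + 2 * m + p.width + src.length + 3,
    fun l hl μ T B hp hB => ?_⟩
  have hb := initMem_bits hB
  have e0 : ∀ ρ : Mem, (∀ i, L' ≤ i → ρ i = 0) → glue L' ρ (initMem []) = ρ := by
    intro ρ hρ
    funext i
    unfold glue
    split_ifs with h
    · rfl
    · rw [initMem_length_le (by simp), hρ i (by omega)]
  have h1 := copyIn_runs L' B (initMem l) (fun i _ => hb i) src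
    (fun a ha => by have := hsrc a ha; omega) []
  rw [e0 _ fun i hi => initMem_length_le (by omega)] at h1
  simp only [List.length_nil, add_zero, List.nil_append] at h1
  have h2 := hp.shift L' (initMem l)
  have hin : ∀ i, bitLength (initMem (src.map (initMem l)) i) ≤ B :=
    initMem_bits fun v hv => by
      obtain ⟨i, -, rfl⟩ := List.mem_map.1 hv
      exact hb i
  have h3 : ∀ σ' ∈ (μ.map (glue L' (initMem l))).support,
      Runs (.seq (copyOut L' base m) (clearRegs L' (p.width + src.length))) σ'
        (PMF.pure (writeAt base m (initMem l) fun i => σ' (L' + i)))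
        (m * (2 + 2 * (B + T)) + 1 + (p.width + src.length + 1)) := by
    intro σ' hσ'
    obtain ⟨τ, hτ, rfl⟩ := (PMF.mem_support_map_iff _ _ _).1 hσ'
    simp only [glue_high]
    have h4 := copyOut_runs L' base (B + T) (initMem l) τ (fun i => by
      have := hp.bits τ hτ i
      have := hin i
      omega) m (by omega)
    have h5 := clearRegs_runs L' (writeAt base m (initMem l) τ) τ (p.width + src.length)
    have e : (fun i => if i < p.width + src.length then 0 else τ i) = initMem [] := by
      funext i
      rw [initMem_length_le (by simp)]
      split_ifs with h
      · rfl
      · rw [hp.untouched τ hτ i (by omega), initMem_length_le (by simp; omega)]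
    rw [e, e0 _ fun i hi => ?_] at h5
    · exact h4.seqPure h5
    · unfold writeAt
      rw [if_neg (by omega), initMem_length_le (by omega)]
  have h6 := h1.seqPure (Runs.seq _ _ _ _ _ _ _ h2 h3)
  rw [PMF.bind_map] at h6
  have e : (μ.bind ((fun σ' : Mem => PMF.pure (writeAt base m (initMem l) fun i => σ' (L' + i))) ∘
      glue L' (initMem l))) = μ.map (writeAt base m (initMem l)) := by
    rw [PMF.map]
    congr 1
    funext τ
    simp only [Function.comp, glue_high]
  rw [e] at h6
  refine h6.mono ?_
  nlinarith [Nat.zero_le (src.length * T), Nat.zero_le (p.width * (B + T)),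
    Nat.zero_le (src.length * (B + T)), Nat.zero_le (B + T)]

/-- With the output block right behind the inputs, a call appends its results to the list of
registers. With the block at `0`, as in `writeAt_zero_initMem`, it overwrites them, which is the
form needed for loop bodies. -/
theorem writeAt_initMem_append (l : List ℤ) (τ : Mem) (m : ℕ) :
    writeAt l.length m (initMem l) τ = initMem (l ++ (List.range m).map τ) := by
  induction m with
  | zero => funext i; simp [writeAt]
  | succ m ih =>
    rw [writeAt_succ, ih, List.range_succ, List.map_append, ← List.append_assoc]
    simp only [List.map_cons, List.map_nil]
    rw [initMem_append]
    simp

theorem writeAt_zero_initMem (l : List ℤ) (τ : Mem) :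
    writeAt 0 l.length (initMem l) τ = initMem ((List.range l.length).map τ) := by
  funext i
  unfold writeAt
  split_ifs with h
  · simp only [initMem, List.getD_eq_getElem?_getD]
    rw [List.getElem?_eq_getElem (by simp; omega)]
    simp
  · rw [initMem_length_le (by omega), initMem_length_le (by simp; omega)]

/-! ### Composing efficient algorithms -/

theorem Runs.bits_pure {p σ σ' T} (h : Runs p σ (PMF.pure σ') T) (i : ℕ) :
    bitLength (σ' i) ≤ max (bitLength (σ i)) T :=
  h.bits σ' (by simp) i

theorem initMem_eq_getElem {l : List ℤ} {i : ℕ} (hi : i < l.length) : initMem l i = l[i] := by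
  simp [initMem, List.getD_eq_getElem?_getD, List.getElem?_eq_getElem hi]

/-- Variant of `EfficientlySolvable` in which the running time may also depend polynomially on a
bound `q` for the bit lengths of the inputs. -/
def Solv {α : Type*} (size : α → ℕ) (env : α → List ℤ) (good : α → PMF Mem → Prop) : Prop :=
  ∃ p : Prog, ∀ q : Polynomial ℕ, ∃ t : Polynomial ℕ, ∀ a,
    (∀ v ∈ env a, bitLength v ≤ q.eval (size a)) →
      ∃ μ, Runs p (initMem (env a)) μ (t.eval (size a)) ∧ good a μ

section rules

variable {α β γ : Type*} {size : α → ℕ} {env : α → List ℤ} {good : α → PMF Mem → Prop}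

/-- In `Solv` the program is fixed before the bound `q`. Composition can thus enlarge `q` by the
running time of each call, and a concrete bound is needed only for the original inputs. -/
theorem Solv.efficient (h : Solv size env good) (q : Polynomial ℕ)
    (hq : ∀ a, ∀ v ∈ env a, bitLength v ≤ q.eval (size a)) :
    EfficientlySolvable env size good := by
  obtain ⟨p, hp⟩ := h
  obtain ⟨t, ht⟩ := hp q
  exact ⟨p, t, fun a => ht a (hq a)⟩

theorem EfficientlySolvable.reindex {in₁ : β → List ℤ} {size₁ : β → ℕ}
    {good₁ : β → PMF Mem → Prop} (h : EfficientlySolvable in₁ size₁ good₁) (w : Polynomial ℕ)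
    (H : ∀ a, ∃ b, in₁ b = env a ∧ size₁ b ≤ w.eval (size a) ∧ ∀ μ, good₁ b μ → good a μ) :
    EfficientlySolvable env size good := by
  obtain ⟨p, t, hp⟩ := h
  refine ⟨p, t.comp w, fun a => ?_⟩
  obtain ⟨b, h1, h2, h3⟩ := H a
  obtain ⟨μ, h4, h5⟩ := hp b
  rw [h1] at h4
  refine ⟨μ, h4.mono ?_, h3 μ h5⟩
  rw [Polynomial.eval_comp]
  exact eval_nat_mono _ h2

/-- First call `h₁` on the registers `src`, then continue with `h₂`. -/
theorem Solv.call_core {in₁ : β → List ℤ} {size₁ : β → ℕ} {good₁ : β → PMF Mem → Prop}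
    {size' : γ → ℕ} {env' : γ → List ℤ} {good' : γ → PMF Mem → Prop}
    (h₁ : EfficientlySolvable in₁ size₁ good₁) (h₂ : Solv size' env' good')
    (L m : ℕ) (src : List ℕ) (hsrc : ∀ i ∈ src, i < L) (w : Polynomial ℕ)
    (H : ∀ a, (env a).length = L ∧ ∃ b, in₁ b = src.map (initMem (env a)) ∧
      size₁ b ≤ w.eval (size a) ∧ ∀ μ, good₁ b μ → ∃ f : ∀ σ ∈ μ.support, γ,
        (∀ σ hσ, env' (f σ hσ) = env a ++ (List.range m).map σ ∧ size' (f σ hσ) = size a) ∧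
        ∀ ν : Mem → PMF Mem, (∀ σ hσ, good' (f σ hσ) (ν σ)) →
          (∀ σ σ' : Mem, (List.range m).map σ = (List.range m).map σ' → ν σ = ν σ') →
          good a (μ.bind ν)) :
    Solv size env good := by
  obtain ⟨p₁, t₁, hp₁⟩ := h₁
  obtain ⟨p₂, hp₂⟩ := h₂
  obtain ⟨c, K, hc⟩ := exists_call p₁ L L m src hsrc
  refine ⟨.seq c p₂, fun q => ?_⟩
  -- By `Runs.bits`, the values that the call returns are no longer than its arguments or its
  -- running time.
  obtain ⟨t₂, ht₂⟩ := hp₂ (q + t₁.comp w)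
  refine ⟨(t₁.comp w + .C K * (q + t₁.comp w + 1)) + t₂, fun a ha => ?_⟩
  obtain ⟨hL, b, hb, hw, hgood⟩ := H a
  obtain ⟨μ, hμ, hgμ⟩ := hp₁ b
  obtain ⟨f, hf, hν⟩ := hgood μ hgμ
  rw [hb] at hμ
  have hT : t₁.eval (size₁ b) ≤ (t₁.comp w).eval (size a) := by
    rw [Polynomial.eval_comp]; exact eval_nat_mono _ hw
  replace hμ := hμ.mono hT
  have h1 := hc (env a) hL μ _ _ hμ ha
  have hw : ∀ τ, writeAt L m (initMem (env a)) τ = initMem (env a ++ (List.range m).map τ) := by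
    intro τ; rw [← hL, writeAt_initMem_append]
  have h2 : ∀ τ (hτ : τ ∈ μ.support), ∃ ν,
      Runs p₂ (initMem (env a ++ (List.range m).map τ)) ν (t₂.eval (size a)) ∧
        good' (f τ hτ) ν := by
    intro τ hτ
    obtain ⟨e1, e2⟩ := hf τ hτ
    have := ht₂ (f τ hτ) ?_
    · rwa [e1, e2] at this
    · rw [e1, e2]
      intro v hv
      rw [Polynomial.eval_add]
      obtain hv | hv := List.mem_append.1 hv
      · exact (ha v hv).trans (by omega)
      · obtain ⟨i, -, rfl⟩ := List.mem_map.1 hv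
        have h3 := hμ.bits τ hτ i
        have h4 := initMem_bits (l := src.map (initMem (env a))) (B := q.eval (size a))
          (fun v hv => by
            obtain ⟨j, -, rfl⟩ := List.mem_map.1 hv
            exact initMem_bits ha j) i
        omega
  classical
  -- The continuation is known for each outcome separately. A single kernel arises by choosing a
  -- final distribution for every memory; by `Runs.unique` the choice agrees with the distribution
  -- already known to be good. It depends on the outcome only through the appended registers.
  set νm : Mem → PMF Mem := fun s =>
    if h : ∃ ν, Runs p₂ s ν (t₂.eval (size a)) then h.choose else PMF.pure s with hνm
  have h3 : ∀ τ (hτ : τ ∈ μ.support),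
      Runs p₂ (initMem (env a ++ (List.range m).map τ))
        (νm (initMem (env a ++ (List.range m).map τ))) (t₂.eval (size a)) ∧
      good' (f τ hτ) (νm (initMem (env a ++ (List.range m).map τ))) := by
    intro τ hτ
    obtain ⟨ν, hr, hg⟩ := h2 τ hτ
    have hex : ∃ ν, Runs p₂ (initMem (env a ++ (List.range m).map τ)) ν (t₂.eval (size a)) :=
      ⟨ν, hr⟩
    have e : νm (initMem (env a ++ (List.range m).map τ)) = ν := by
      simp only [hνm, dif_pos hex]
      exact hr.unique hex.choose_spec
    rw [e]
    exact ⟨hr, hg⟩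
  refine ⟨(μ.map (writeAt L m (initMem (env a)))).bind νm, ?_, ?_⟩
  · simp only [Polynomial.eval_add, Polynomial.eval_mul, Polynomial.eval_C, Polynomial.eval_one]
    refine Runs.seq _ _ _ _ _ _ _ h1 fun s hs => ?_
    obtain ⟨τ, hτ, rfl⟩ := (PMF.mem_support_map_iff _ _ _).1 hs
    rw [hw]
    exact (h3 τ hτ).1
  · rw [PMF.bind_map]
    refine hν _ (fun τ hτ => ?_) fun τ τ' h => ?_
    · simp only [Function.comp, hw]
      exact (h3 τ hτ).2
    · simp only [Function.comp, hw, h]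

/-- Meant for subroutines whose results are random or only approximately prescribed. An element of
`γ` is an instance together with the returned values and what is known about them; `good'` says what
the remaining program must achieve given these. -/
theorem Solv.call {in₁ : β → List ℤ} {size₁ : β → ℕ} {good₁ : β → PMF Mem → Prop}
    {size' : γ → ℕ} {env' : γ → List ℤ} {good' : γ → PMF Mem → Prop}
    (h₁ : EfficientlySolvable in₁ size₁ good₁) (L m : ℕ) (src : List ℕ) (hsrc : ∀ i ∈ src, i < L)
    (w : Polynomial ℕ) (h₂ : Solv size' env' good')
    (H : ∀ a, (env a).length = L ∧ ∃ b, in₁ b = src.map (initMem (env a)) ∧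
      size₁ b ≤ w.eval (size a) ∧ ∀ μ, good₁ b μ → ∃ f : ∀ σ ∈ μ.support, γ,
        (∀ σ hσ, env' (f σ hσ) = env a ++ (List.range m).map σ ∧ size' (f σ hσ) = size a) ∧
        ∀ ν : Mem → PMF Mem, (∀ σ hσ, good' (f σ hσ) (ν σ)) → good a (μ.bind ν)) :
    Solv size env good := by
  refine Solv.call_core h₁ h₂ L m src hsrc w fun a => ?_
  obtain ⟨h1, b, h2, h3, h4⟩ := H a
  refine ⟨h1, b, h2, h3, fun μ hμ => ?_⟩
  obtain ⟨f, h5, h6⟩ := h4 μ hμ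
  exact ⟨f, h5, fun ν hν _ => h6 ν hν⟩

/-- Call a subroutine whose outputs are known with certainty. -/
theorem Solv.callDet {in₁ : β → List ℤ} {size₁ : β → ℕ} {good₁ : β → PMF Mem → Prop}
    {env' : α → List ℤ}
    (h₁ : EfficientlySolvable in₁ size₁ good₁) (L m : ℕ) (src : List ℕ) (hsrc : ∀ i ∈ src, i < L)
    (w : Polynomial ℕ) (h₂ : Solv size env' good)
    (H : ∀ a, (env a).length = L ∧ ∃ b, in₁ b = src.map (initMem (env a)) ∧
      size₁ b ≤ w.eval (size a) ∧ ∀ μ, good₁ b μ → ∀ σ ∈ μ.support,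
        env' a = env a ++ (List.range m).map σ) :
    Solv size env good := by
  refine Solv.call_core h₁ h₂ L m src hsrc w fun a => ?_
  obtain ⟨h1, b, h2, h3, h4⟩ := H a
  refine ⟨h1, b, h2, h3, fun μ hμ => ⟨fun _ _ => a, fun σ hσ => ⟨h4 μ hμ σ hσ, rfl⟩,
    fun ν hν hc => ?_⟩⟩
  -- All outcomes return the same `m` values, and the continuation depends on nothing else, so it is
  -- constant on the support.
  obtain ⟨σ₀, hσ₀⟩ := μ.support_nonempty
  rw [bind_const_support (κ := ν σ₀) fun σ hσ => hc σ σ₀ (List.append_cancel_left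
    ((h4 μ hμ σ hσ).symm.trans (h4 μ hμ σ₀ hσ₀)))]
  exact hν σ₀ hσ₀

/-- Return the values of the registers `idx` in the registers `0, 1, …`. -/
theorem Solv.ret (L : ℕ) (idx : List ℕ) (hidx : ∀ i ∈ idx, i < L)
    (H : ∀ a, (env a).length = L ∧ ∀ σ : Mem,
      (List.range idx.length).map σ = idx.map (initMem (env a)) → good a (PMF.pure σ)) :
    Solv size env good := by
  obtain ⟨c, K, hc⟩ := exists_call .skip L 0 idx.length idx hidx
  refine ⟨c, fun q => ⟨1 + .C K * (q + 1 + 1), fun a ha => ?_⟩⟩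
  obtain ⟨hL, hg⟩ := H a
  have h1 := hc (env a) hL _ _ _ (Runs.skip _) ha
  rw [PMF.pure_map] at h1
  refine ⟨_, by simpa using h1, hg _ ?_⟩
  refine List.ext_getElem (by simp) fun i h2 h3 => ?_
  simp only [List.length_map, List.length_range] at h2
  simp [writeAt, h2, initMem]

/-! Arithmetic expressions in the registers. -/

/-- Arithmetic expressions. -/
inductive Exp
  | var (i : ℕ)
  | const (c : ℤ)
  | op (o : ArithOp) (e f : Exp)

instance : Add Exp := ⟨.op .add⟩
instance : Sub Exp := ⟨.op .sub⟩
instance : Mul Exp := ⟨.op .mul⟩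
instance : Div Exp := ⟨.op .div⟩

def Exp.eval (σ : Mem) : Exp → ℤ
  | .var i => σ i
  | .const c => c
  | .op o e f => o.eval (e.eval σ) (f.eval σ)

/-- All registers in the expression are below `L`. -/
def Exp.Below (L : ℕ) : Exp → Prop
  | .var i => i < L
  | .const _ => True
  | .op _ e f => e.Below L ∧ f.Below L

theorem Exp.below_mono {L L' : ℕ} (h : L ≤ L') : ∀ {e : Exp}, e.Below L → e.Below L'
  | .var _, he => lt_of_lt_of_le he h
  | .const _, _ => trivial
  | .op _ _ _, he => ⟨Exp.below_mono h he.1, Exp.below_mono h he.2⟩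

@[simp] theorem Exp.eval_var (σ : Mem) (i : ℕ) : (Exp.var i).eval σ = σ i := rfl
@[simp] theorem Exp.eval_const (σ : Mem) (c : ℤ) : (Exp.const c).eval σ = c := rfl
@[simp] theorem Exp.eval_add (σ : Mem) (e f : Exp) : (e + f).eval σ = e.eval σ + f.eval σ := rfl
@[simp] theorem Exp.eval_sub (σ : Mem) (e f : Exp) : (e - f).eval σ = e.eval σ - f.eval σ := rfl
@[simp] theorem Exp.eval_mul (σ : Mem) (e f : Exp) : (e * f).eval σ = e.eval σ * f.eval σ := rfl
@[simp] theorem Exp.eval_div (σ : Mem) (e f : Exp) : (e / f).eval σ = e.eval σ / f.eval σ := rfl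
@[simp] theorem Exp.below_var (L i : ℕ) : (Exp.var i).Below L ↔ i < L := Iff.rfl
@[simp] theorem Exp.below_const (L : ℕ) (c : ℤ) : (Exp.const c).Below L ↔ True := Iff.rfl
@[simp] theorem Exp.below_add (L : ℕ) (e f : Exp) :
    (e + f).Below L ↔ e.Below L ∧ f.Below L := Iff.rfl
@[simp] theorem Exp.below_sub (L : ℕ) (e f : Exp) :
    (e - f).Below L ↔ e.Below L ∧ f.Below L := Iff.rfl
@[simp] theorem Exp.below_mul (L : ℕ) (e f : Exp) :
    (e * f).Below L ↔ e.Below L ∧ f.Below L := Iff.rfl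
@[simp] theorem Exp.below_div (L : ℕ) (e f : Exp) :
    (e / f).Below L ↔ e.Below L ∧ f.Below L := Iff.rfl

theorem initMem_append_lt {l l' : List ℤ} {i : ℕ} (h : i < l.length) :
    initMem (l ++ l') i = initMem l i := by
  simp [initMem, List.getD_eq_getElem?_getD, List.getElem?_append_left h]

theorem Exp.eval_append {l : List ℤ} (l' : List ℤ) :
    ∀ {e : Exp}, e.Below l.length → e.eval (initMem (l ++ l')) = e.eval (initMem l)
  | .var _, he => initMem_append_lt he
  | .const _, _ => rfl
  | .op _ _ _, he => by
    simp only [Exp.eval, Exp.eval_append l' he.1, Exp.eval_append l' he.2]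

theorem arithOp_bits (o : ArithOp) (a b : ℤ) :
    bitLength (o.eval a b) ≤ bitLength a + bitLength b + 1 := by
  rw [bitLength_le_iff]
  have ha := bitLength_le_iff.1 (le_refl (bitLength a))
  have hb := bitLength_le_iff.1 (le_refl (bitLength b))
  have hA := Nat.one_le_two_pow (n := bitLength a)
  have hB := Nat.one_le_two_pow (n := bitLength b)
  rw [pow_succ, pow_add]
  cases o with
  | add =>
    have := Int.natAbs_add_le a b
    simp only [ArithOp.eval]
    nlinarith
  | sub =>
    have := Int.natAbs_sub_le a b
    simp only [ArithOp.eval]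
    nlinarith
  | mul =>
    simp only [ArithOp.eval, Int.natAbs_mul]
    have := Nat.mul_le_mul ha.le hb.le
    have : 0 < 2 ^ bitLength a * 2 ^ bitLength b := by positivity
    omega
  | div =>
    simp only [ArithOp.eval]
    have := Int.natAbs_ediv_le_natAbs a b
    nlinarith

/-- Stack discipline: the operands are evaluated into the registers `L` and `L + 1`, the result
replaces the first and the second is reset to zero. The memory is then again a list of registers
with one value appended. -/
theorem Exp.exists_runs (e : Exp) : ∀ L, e.Below L → ∃ p : Prog, ∀ q : Polynomial ℕ,
    ∃ t : Polynomial ℕ, ∀ (l : List ℤ) (s : ℕ), l.length = L →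
      (∀ v ∈ l, bitLength v ≤ q.eval s) →
      Runs p (initMem l) (PMF.pure (initMem (l ++ [e.eval (initMem l)]))) (t.eval s) := by
  induction e with
  | var i =>
    intro L hL
    refine ⟨copyReg L i, fun q => ⟨2 + 2 * q, fun l s hl hb => ?_⟩⟩
    have h := copyReg_runs (dst := L) (src := i) (ne_of_lt hL) (initMem l)
    rw [← hl, ← initMem_append] at h
    rw [← hl]
    refine h.mono ?_
    have := initMem_bits hb i
    simp only [Polynomial.eval_add, Polynomial.eval_mul, Polynomial.eval_ofNat]
    omega
  | const c =>
    intro L hL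
    refine ⟨.const L c, fun q => ⟨.C (1 + bitLength c), fun l s hl hb => ?_⟩⟩
    have h := Runs.const (initMem l) L c
    rw [← hl, ← initMem_append] at h
    rw [← hl, Polynomial.eval_C]
    exact h
  | op o e f ih1 ih2 =>
    intro L hL
    obtain ⟨p₁, h1⟩ := ih1 L hL.1
    obtain ⟨p₂, h2⟩ := ih2 (L + 1) (Exp.below_mono (by omega) hL.2)
    refine ⟨.seq p₁ (.seq p₂ (.seq (.arith L o L (L + 1)) (.const (L + 1) 0))), fun q => ?_⟩
    obtain ⟨t₁, h1⟩ := h1 q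
    obtain ⟨t₂, h2⟩ := h2 (q + t₁)
    refine ⟨t₁ + (t₂ + (2 + 2 * (q + t₁) + 2 * (q + t₁ + t₂) + 1)), fun l s hl hb => ?_⟩
    subst hl
    replace h1 := h1 l s rfl hb
    set v₁ := e.eval (initMem l) with hv₁
    have hb1 : ∀ v ∈ l ++ [v₁], bitLength v ≤ (q + t₁).eval s := by
      intro v hv
      obtain ⟨i, hi, rfl⟩ := List.mem_iff_getElem.1 hv
      have := h1.bits_pure i
      have hh := initMem_bits hb i
      rw [Polynomial.eval_add]
      rw [initMem_eq_getElem hi] at this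
      omega
    replace h2 := h2 (l ++ [v₁]) s (by simp) hb1
    rw [Exp.eval_append _ hL.2] at h2
    set v₂ := f.eval (initMem l) with hv₂
    have hm : initMem (l ++ [v₁] ++ [v₂]) =
        Function.update (Function.update (initMem l) l.length v₁) (l.length + 1) v₂ := by
      rw [initMem_append, initMem_append]; simp
    rw [hm] at h2
    have h3 := Runs.arith (Function.update (Function.update (initMem l) l.length v₁)
      (l.length + 1) v₂) l.length o l.length (l.length + 1)
    rw [Function.update_self, Function.update_of_ne (by omega), Function.update_self] at h3
    have h4 := Runs.const (Function.update (Function.update (Function.update (initMem l)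
      l.length v₁) (l.length + 1) v₂) l.length (o.eval v₁ v₂)) (l.length + 1) 0
    have e : Function.update (Function.update (Function.update (Function.update (initMem l)
        l.length v₁) (l.length + 1) v₂) l.length (o.eval v₁ v₂)) (l.length + 1) 0 =
        initMem (l ++ [(Exp.op o e f).eval (initMem l)]) := by
      rw [initMem_append]
      funext i
      simp only [Function.update_apply]
      by_cases h : i = l.length + 1
      · subst h
        simp [initMem_length_le (l := l) (i := l.length + 1) (by omega)]
      · by_cases h' : i = l.length
        · subst h'; simp [Exp.eval, hv₁, hv₂]
        · simp [h, h']
    rw [e, bitLength_zero] at h4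
    refine (h1.seqPure (h2.seqPure (h3.seqPure h4))).mono ?_
    have hv1 := hb1 v₁ (by simp)
    have hv2 := h2.bits_pure (l.length + 1)
    rw [Function.update_self] at hv2
    have := initMem_bits hb1 (l.length + 1)
    have := arithOp_bits o v₁ v₂
    simp only [Polynomial.eval_add, Polynomial.eval_mul, Polynomial.eval_ofNat,
      Polynomial.eval_one] at *
    omega

/-- Evaluate an expression and append its value. -/
theorem Solv.exp {env' : α → List ℤ} (h : Solv size env' good) (L : ℕ) (e : Exp)
    (he : e.Below L)
    (H : ∀ a, (env a).length = L ∧ env' a = env a ++ [e.eval (initMem (env a))]) :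
    Solv size env good := by
  obtain ⟨p₁, hp₁⟩ := e.exists_runs L he
  obtain ⟨p₂, hp₂⟩ := h
  refine ⟨.seq p₁ p₂, fun q => ?_⟩
  obtain ⟨t₁, ht₁⟩ := hp₁ q
  obtain ⟨t₂, ht₂⟩ := hp₂ (q + t₁)
  refine ⟨t₁ + t₂, fun a ha => ?_⟩
  obtain ⟨hL, henv⟩ := H a
  have h1 := ht₁ (env a) (size a) hL ha
  rw [← henv] at h1
  obtain ⟨μ, h2, hg⟩ := ht₂ a fun v hv => by
    obtain ⟨i, hi, rfl⟩ := List.mem_iff_getElem.1 hv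
    have := h1.bits_pure i
    have hh := initMem_bits ha i
    rw [Polynomial.eval_add]
    rw [initMem_eq_getElem hi] at this
    omega
  exact ⟨μ, by rw [Polynomial.eval_add]; exact h1.seqPure h2, hg⟩

theorem Solv.eval (L : ℕ) (e : Exp) (he : e.Below L) (hL : ∀ a, (env a).length = L)
    (h : Solv size (fun a => env a ++ [e.eval (initMem (env a))]) good) : Solv size env good :=
  h.exp L e he fun a => ⟨hL a, rfl⟩

/-- Flip a coin and append the result. -/
theorem Solv.flip {size' : γ → ℕ} {env' : γ → List ℤ} {good' : γ → PMF Mem → Prop} (L : ℕ)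
    (h : Solv size' env' good')
    (H : ∀ a, (env a).length = L ∧ ∃ f : Bool → γ,
      (∀ b, env' (f b) = env a ++ [if b then 1 else 0] ∧ size' (f b) = size a) ∧
      ∀ ν : Bool → PMF Mem, (∀ b, good' (f b) (ν b)) → good a (fairCoin.bind ν)) :
    Solv size env good := by
  obtain ⟨p, hp⟩ := h
  refine ⟨.seq (.flip L) p, fun q => ?_⟩
  obtain ⟨t, ht⟩ := hp (q + 1)
  refine ⟨1 + t, fun a ha => ?_⟩
  obtain ⟨hL, f, hf, hν⟩ := H a
  subst hL
  have h1 := Runs.flip (initMem (env a)) (env a).length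
  have h2 : ∀ b, ∃ ν, Runs p (initMem (env a ++ [if b then 1 else 0])) ν (t.eval (size a)) ∧
      good' (f b) ν := by
    intro b
    have := ht (f b) ?_
    · rwa [(hf b).1, (hf b).2] at this
    · rw [(hf b).1, (hf b).2, Polynomial.eval_add, Polynomial.eval_one]
      intro v hv
      obtain hv | hv := List.mem_append.1 hv
      · exact (ha v hv).trans (by omega)
      · simp only [List.mem_singleton] at hv
        subst hv
        cases b <;> simp [bitLength_zero, bitLength_one]
  choose ν hr hg using h2
  have e : (fairCoin.map fun b => Function.update (initMem (env a)) (env a).length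
      (if b then 1 else 0)).bind (fun s => ν (decide (0 < s (env a).length))) =
      fairCoin.bind ν := by
    rw [PMF.bind_map]
    congr 1
    funext b
    cases b <;> simp
  refine ⟨fairCoin.bind ν, ?_, hν ν hg⟩
  rw [← e, Polynomial.eval_add, Polynomial.eval_one]
  refine Runs.seq _ _ _ _ _ _ _ h1 fun s hs => ?_
  obtain ⟨b, -, rfl⟩ := (PMF.mem_support_map_iff _ _ _).1 hs
  have := hr b
  rw [initMem_append] at this
  cases b <;> simpa using this

/-- The branches have index types of their own, so each can carry the outcome of the test as a
hypothesis. This matters when a task, such as computing a phase, makes sense in one branch only. -/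
theorem Solv.ifPos {size₁ : β → ℕ} {env₁ : β → List ℤ} {good₁ : β → PMF Mem → Prop}
    {size₂ : γ → ℕ} {env₂ : γ → List ℤ} {good₂ : γ → PMF Mem → Prop} (i : ℕ)
    (h₁ : Solv size₁ env₁ good₁) (h₂ : Solv size₂ env₂ good₂)
    (H₁ : ∀ a, 0 < initMem (env a) i → ∃ b, env₁ b = env a ∧ size₁ b = size a ∧
      ∀ μ, good₁ b μ → good a μ)
    (H₂ : ∀ a, initMem (env a) i ≤ 0 → ∃ b, env₂ b = env a ∧ size₂ b = size a ∧
      ∀ μ, good₂ b μ → good a μ) :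
    Solv size env good := by
  obtain ⟨p₁, h₁⟩ := h₁
  obtain ⟨p₂, h₂⟩ := h₂
  refine ⟨.ifPos i p₁ p₂, fun q => ?_⟩
  obtain ⟨t₁, h₁⟩ := h₁ q
  obtain ⟨t₂, h₂⟩ := h₂ q
  refine ⟨1 + q + (t₁ + t₂), fun a ha => ?_⟩
  have hb := initMem_bits ha i
  rcases lt_or_ge 0 (initMem (env a) i) with h | h
  · obtain ⟨b, e1, e2, hg⟩ := H₁ a h
    obtain ⟨μ, hr, hgμ⟩ := h₁ b (by rwa [e1, e2])
    rw [e1, e2] at hr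
    refine ⟨μ, (Runs.ifTrue _ _ _ _ _ _ h hr).mono ?_, hg μ hgμ⟩
    simp only [Polynomial.eval_add, Polynomial.eval_one]
    omega
  · obtain ⟨b, e1, e2, hg⟩ := H₂ a h
    obtain ⟨μ, hr, hgμ⟩ := h₂ b (by rwa [e1, e2])
    rw [e1, e2] at hr
    refine ⟨μ, (Runs.ifFalse _ _ _ _ _ _ h hr).mono ?_, hg μ hgμ⟩
    simp only [Polynomial.eval_add, Polynomial.eval_one]
    omega

/-- Iterate a program on the registers below `L` while register `i` is positive. -/
theorem EfficientlySolvable.loop {goodb : {a // 0 < initMem (env a) i} → PMF Mem → Prop}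
    (body : EfficientlySolvable (fun a : {a // 0 < initMem (env a) i} => env a)
      (fun a => size a) goodb)
    (L : ℕ) (hL : ∀ a, (env a).length = L) (q r : Polynomial ℕ)
    (hq : ∀ a, ∀ v ∈ env a, bitLength v ≤ q.eval (size a))
    (rank : α → ℕ) (hr : ∀ a, rank a ≤ r.eval (size a))
    (hdone : ∀ a, initMem (env a) i ≤ 0 → good a (PMF.pure (initMem (env a))))
    (hstep : ∀ a : {a // 0 < initMem (env a) i}, ∀ μ, goodb a μ → ∃ f : ∀ σ ∈ μ.support, α,
      (∀ σ hσ, env (f σ hσ) = (List.range L).map σ ∧ size (f σ hσ) = size a ∧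
        rank (f σ hσ) < rank a) ∧
      ∀ ν : Mem → PMF Mem, (∀ σ hσ, good (f σ hσ) (ν σ)) → good a (μ.bind ν)) :
    EfficientlySolvable env size good := by
  obtain ⟨p, t, hp⟩ := body
  -- Output block at `0`: the body overwrites the state registers and leaves no scratch values for
  -- the next pass.
  obtain ⟨c, K, hc⟩ := exists_call p L 0 L (List.range L) (by simp)
  set D : Polynomial ℕ := 1 + q + (t + .C K * (q + t + 1)) with hD
  refine ⟨.whilePos i c, (r + 1) * D, ?_⟩
  -- Every loop state obeys the same length bound `q`, so each pass costs at most `D` and lengths do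
  -- not compound. The rank bounds the number of passes; one more unit pays for the final test.
  have key : ∀ (k : ℕ) (a : α), rank a < k →
      ∃ μ, Runs (.whilePos i c) (initMem (env a)) μ (k * D.eval (size a)) ∧ good a μ := by
    intro k
    induction k with
    | zero => intro a ha; omega
    | succ k ih =>
      intro a ha
      have hDe : D.eval (size a) = 1 + q.eval (size a) + (t.eval (size a) +
        K * (q.eval (size a) + t.eval (size a) + 1)) := by
        simp only [hD, Polynomial.eval_add, Polynomial.eval_mul, Polynomial.eval_C,
          Polynomial.eval_one]
      have hb := initMem_bits (hq a) i
      rcases le_or_gt (initMem (env a) i) 0 with h | h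
      · refine ⟨_, (Runs.whileDone _ _ _ h).mono ?_, hdone a h⟩
        nlinarith [Nat.zero_le (k * D.eval (size a)),
          Nat.zero_le (K * (q.eval (size a) + t.eval (size a) + 1))]
      · obtain ⟨μ, hμ, hg⟩ := hp ⟨a, h⟩
        obtain ⟨f, hf, hν⟩ := hstep ⟨a, h⟩ μ hg
        have e0 : (List.range L).map (initMem (env a)) = env a := by
          refine List.ext_getElem (by simp [hL]) fun j h2 h3 => ?_
          simp [initMem, List.getD_eq_getElem?_getD, List.getElem?_eq_getElem h3]
        have h1 := hc (env a) (hL a) μ _ _ (by rw [e0]; exact hμ) (hq a)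
        have hw : ∀ τ, writeAt 0 L (initMem (env a)) τ = initMem ((List.range L).map τ) := by
          intro τ; rw [← hL a, writeAt_zero_initMem]
        have h2 : ∀ τ (hτ : τ ∈ μ.support), ∃ ν,
            Runs (.whilePos i c) (initMem ((List.range L).map τ)) ν (k * D.eval (size a)) ∧
              good (f τ hτ) ν := by
          intro τ hτ
          obtain ⟨e1, e2, e3⟩ := hf τ hτ
          have := ih (f τ hτ) (by dsimp only at e3; omega)
          rwa [e1, e2] at this
        classical
        set νm : Mem → PMF Mem := fun s =>
          if h : ∃ ν, Runs (.whilePos i c) s ν (k * D.eval (size a)) then h.choose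
          else PMF.pure s with hνm
        have h3 : ∀ τ (hτ : τ ∈ μ.support),
            Runs (.whilePos i c) (initMem ((List.range L).map τ))
              (νm (initMem ((List.range L).map τ))) (k * D.eval (size a)) ∧
            good (f τ hτ) (νm (initMem ((List.range L).map τ))) := by
          intro τ hτ
          obtain ⟨ν, hr, hg⟩ := h2 τ hτ
          have hex : ∃ ν, Runs (.whilePos i c) (initMem ((List.range L).map τ)) ν
              (k * D.eval (size a)) := ⟨ν, hr⟩
          have e : νm (initMem ((List.range L).map τ)) = ν := by
            simp only [hνm, dif_pos hex]
            exact hr.unique hex.choose_spec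
          rw [e]
          exact ⟨hr, hg⟩
        refine ⟨(μ.map (writeAt 0 L (initMem (env a)))).bind νm, ?_, ?_⟩
        · refine (Runs.whileStep _ _ _ _ νm _ _ h h1 fun s hs => ?_).mono
            (S := _ + _ + k * D.eval (size a)) ?_
          · obtain ⟨τ, hτ, rfl⟩ := (PMF.mem_support_map_iff _ _ _).1 hs
            rw [hw]
            exact (h3 τ hτ).1
          · dsimp only
            rw [add_mul, one_mul]
            omega
        · rw [PMF.bind_map]
          refine hν _ fun τ hτ => ?_
          simp only [Function.comp, hw]
          exact (h3 τ hτ).2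
  intro a
  obtain ⟨μ, h1, h2⟩ := key (rank a + 1) a (by omega)
  refine ⟨μ, h1.mono ?_, h2⟩
  rw [Polynomial.eval_mul, Polynomial.eval_add (p := r), Polynomial.eval_one]
  exact Nat.mul_le_mul_right _ (by have := hr a; omega)

end rules

/-! ### Basic tasks -/

theorem Surely.pure {R : Mem → Prop} {σ : Mem} (h : R σ) : Surely R (PMF.pure σ) := by
  intro σ' hσ'
  simp only [PMF.support_pure, Set.mem_singleton_iff] at hσ'
  rwa [hσ']

theorem Surely.bind {γ : Type*} {R : Mem → Prop} {μ : PMF γ} {ν : γ → PMF Mem}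
    (h : ∀ s ∈ μ.support, Surely R (ν s)) : Surely R (μ.bind ν) := by
  intro σ hσ
  obtain ⟨s, hs, h'⟩ := (PMF.mem_support_bind_iff _ _ _).1 hσ
  exact h s hs σ h'

theorem bitLength_pow_le (b k : ℕ) : bitLength ((b ^ k : ℕ) : ℤ) ≤ b * k + 1 := by
  rw [bitLength_le_iff, Int.natAbs_natCast, pow_succ, pow_mul]
  have : b ^ k ≤ (2 ^ b) ^ k := Nat.pow_le_pow_left Nat.lt_two_pow_self.le k
  have : 0 < (2 ^ b) ^ k := by positivity
  omega

/-- States of the loop that computes `b ^ e`. -/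
structure PowState where
  b : ℕ
  e : ℕ
  i : ℕ
  le : i ≤ e

namespace PowState

def env (a : PowState) : List ℤ := [((a.b ^ (a.e - a.i) : ℕ) : ℤ), (a.i : ℤ), (a.b : ℤ)]

theorem env_bits (a : PowState) :
    ∀ v ∈ a.env, bitLength v ≤ (Polynomial.X ^ 2 + Polynomial.X + 1 : Polynomial ℕ).eval
      (a.b + a.e) := by
  have := a.le
  have h1 := bitLength_pow_le a.b (a.e - a.i)
  have h2 : a.b * (a.e - a.i) ≤ (a.b + a.e) ^ 2 := by
    rw [sq]; exact Nat.mul_le_mul (by omega) (by omega)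
  have h3 := bitLength_natCast_le a.i
  have h4 := bitLength_natCast_le a.b
  simp only [env, List.mem_cons, List.not_mem_nil, or_false, Polynomial.eval_add,
    Polynomial.eval_pow, Polynomial.eval_X, Polynomial.eval_one]
  rintro v (rfl | rfl | rfl) <;> omega

end PowState

theorem efficient_pow_loop : EfficientlySolvable PowState.env (fun a => a.b + a.e)
    (fun a => Surely fun σ => σ 0 = ((a.b ^ a.e : ℕ) : ℤ)) := by
  refine EfficientlySolvable.loop (i := 1) (goodb := fun a => Surely fun σ =>
      (List.range 3).map σ = [((a.1.b ^ (a.1.e - a.1.i) : ℕ) : ℤ) * a.1.b, (a.1.i : ℤ) - 1, a.1.b])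
    ?_ 3 (fun _ => rfl) _ Polynomial.X PowState.env_bits PowState.i ?_ ?_ ?_
  · refine Solv.efficient (Solv.eval 3 (.var 0 * .var 2) (by simp) (fun _ => rfl)
      (Solv.eval 4 (.var 1 - .const 1) (by simp) (fun _ => rfl)
      (Solv.ret 5 [3, 4, 2] (by simp) fun a => ⟨rfl, fun σ hσ => Surely.pure (hσ.trans ?_)⟩))) _
      fun a => PowState.env_bits a.1
    simp [PowState.env, initMem]
  · intro a
    rw [Polynomial.eval_X]
    exact a.le.trans (by omega)
  · intro a h
    refine Surely.pure ?_
    change (a.i : ℤ) ≤ 0 at h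
    have : a.i = 0 := by omega
    simp [PowState.env, initMem, this]
  · rintro ⟨⟨b, e, i, hi⟩, h⟩ μ hμ
    change 0 < (i : ℤ) at h
    refine ⟨fun _ _ => ⟨b, e, i - 1, by omega⟩, fun σ hσ => ⟨?_, rfl, by dsimp only; omega⟩,
      fun ν hν => Surely.bind hν⟩
    rw [hμ σ hσ]
    have : e - (i - 1) = e - i + 1 := by omega
    simp only [PowState.env, this, pow_succ]
    push_cast [show 1 ≤ i by omega]
    rfl

/-- The size counts base and exponent themselves, not their digits. This is enough, as only powers
with polynomially bounded base and exponent are computed. -/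
theorem efficient_pow : EfficientlySolvable (fun a : ℕ × ℕ => [(a.1 : ℤ), (a.2 : ℤ)])
    (fun a => a.1 + a.2) (fun a => Surely fun σ => σ 0 = ((a.1 ^ a.2 : ℕ) : ℤ)) := by
  refine Solv.efficient (Solv.eval 2 (.const 1)
    (by simp) (fun _ => rfl) (Solv.callDet (env' := fun a => [(a.1 : ℤ), (a.2 : ℤ), 1, ((a.1 ^ a.2 : ℕ) : ℤ)])
      efficient_pow_loop 3 1 [2, 1, 0] (by simp) Polynomial.X
      (Solv.ret 4 [3] (by simp) fun a => ⟨rfl, fun σ hσ => Surely.pure ?_⟩) fun a => ?_))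
      Polynomial.X fun a => ?_
  · simpa [initMem] using hσ
  · refine ⟨rfl, ⟨a.1, a.2, a.2, le_rfl⟩, ?_, by simp, fun μ hμ σ hσ => ?_⟩
    · simp [PowState.env, initMem]
    · simp [hμ σ hσ]
  · have h1 := bitLength_natCast_le a.1
    have h2 := bitLength_natCast_le a.2
    simp only [List.mem_cons, List.not_mem_nil, or_false, Polynomial.eval_X]
    rintro v (rfl | rfl) <;> omega

/-! ### Bit strings -/

theorem code_nonneg {n : ℕ} (y : Bits n) : 0 ≤ code y := Int.natCast_nonneg _

theorem code_lt {n : ℕ} (y : Bits n) : code y < 2 ^ n := by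
  unfold code
  exact_mod_cast Nat.ofBits_lt_two_pow y

theorem code_injective {n : ℕ} : Function.Injective (code (n := n)) := by
  intro y z h
  have h' : Nat.ofBits y = Nat.ofBits z := by unfold code at h; exact_mod_cast h
  funext i
  have := congrArg (fun k => Nat.testBit k i) h'
  simpa [Nat.testBit_ofBits_lt] using this

theorem code_bits {n : ℕ} (y : Bits n) : bitLength (code y) ≤ n := by
  rw [bitLength_le_iff, code, Int.natAbs_natCast]
  exact Nat.ofBits_lt_two_pow y

theorem code_succ {n : ℕ} (y : Bits (n + 1)) :
    code y = (if y 0 then 1 else 0) + 2 * code (Fin.tail y) := by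
  unfold code
  rw [Nat.ofBits_succ]
  have : (Nat.ofBits (y ∘ Fin.succ)) = Nat.ofBits (Fin.tail y) := rfl
  rw [this]
  cases y 0 <;> simp [add_comm]

/-- The bit string whose code agrees with `v` modulo `2 ^ n`. -/
def ofCode (n : ℕ) (v : ℤ) : Bits n := fun i => (v % 2 ^ n).toNat.testBit i

theorem code_ofCode (n : ℕ) (v : ℤ) : code (ofCode n v) = v % 2 ^ n := by
  have h0 : 0 ≤ v % 2 ^ n := Int.emod_nonneg _ (by positivity)
  have h1 : v % 2 ^ n < 2 ^ n := Int.emod_lt_of_pos _ (by positivity)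
  have : Nat.ofBits (ofCode n v) = (v % 2 ^ n).toNat := by
    refine Nat.eq_of_testBit_eq fun i => ?_
    by_cases h : i < n
    · rw [Nat.testBit_ofBits_lt _ _ h]; rfl
    · rw [Nat.testBit_ofBits_ge _ _ (by omega), Nat.testBit_lt_two_pow]
      have : (v % 2 ^ n).toNat < 2 ^ n := by zify; rwa [Int.toNat_of_nonneg h0]
      exact this.trans_le (Nat.pow_le_pow_right (by omega) (by omega))
  rw [code, this, Int.toNat_of_nonneg h0]

theorem ofCode_code {n : ℕ} (y : Bits n) : ofCode n (code y) = y := by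
  apply code_injective
  rw [code_ofCode, Int.emod_eq_of_lt (code_nonneg y) (code_lt y)]

/-- Replace the bits of `y` at the positions marked by `S` by those of `w`. -/
def mixBits {n : ℕ} (S y w : Bits n) : Bits n := fun j => if S j then w j else y j

/-- `2` to the number of positions marked by `S`. -/
def twoPow {n : ℕ} (S : Bits n) : ℕ := ∏ j, if S j then 2 else 1

theorem twoPow_succ {n : ℕ} (S : Bits (n + 1)) :
    twoPow S = (if S 0 then 2 else 1) * twoPow (Fin.tail S) := by
  unfold twoPow
  rw [Fin.prod_univ_succ]; rfl

theorem twoPow_eq {n : ℕ} (S : Bits n) : twoPow S = 2 ^ (Finset.univ.filter fun j => S j).card := by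
  unfold twoPow
  rw [Finset.prod_ite]; simp

/-- Put the bit `b` in front of `w`. -/
def consBit {n : ℕ} (b : Bool) (w : Bits n) : Bits (n + 1) :=
  Fin.cons (α := fun _ => Bool) b w

theorem uniform_succ (n : ℕ) : PMF.uniformOfFintype (Bits (n + 1)) =
    fairCoin.bind fun b =>
      (PMF.uniformOfFintype (Bits n)).map (consBit b) := by
  ext w
  rw [PMF.bind_apply, tsum_fintype, Fintype.sum_bool]
  have key : ∀ b, ((PMF.uniformOfFintype (Bits n)).map (consBit b)) w = if w 0 = b then (2 ^ n : ENNReal)⁻¹ else 0 := by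
    intro b
    rw [PMF.map_apply, tsum_fintype]
    have : ∀ u : Bits n, (w = consBit b u) ↔ w 0 = b ∧ Fin.tail w = u := by
      intro u
      constructor
      · rintro rfl; exact ⟨rfl, rfl⟩
      · rintro ⟨rfl, rfl⟩; exact (Fin.cons_self_tail w).symm
    simp only [this, PMF.uniformOfFintype_apply]
    split_ifs with h
    · simp [h]
    · simp [h]
  rw [key, key]
  simp only [fairCoin, PMF.uniformOfFintype_apply]
  have h2 : ((2 : ENNReal) ^ (n + 1))⁻¹ = 2⁻¹ * (2 ^ n)⁻¹ := by
    rw [pow_succ, mul_comm, ENNReal.mul_inv (by simp) (by simp)]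
  cases h : w 0 <;> simp [h2]

/-- States of the loop that samples `mixBits S y w` for random `w`. -/
structure MixState where
  n : ℕ
  i : ℕ
  le : i ≤ n
  S : Bits i
  y : Bits i
  z : ℕ
  K : ℕ
  hz : z < 2 ^ (n - i)
  hK : K ≤ 2 ^ (n - i)
  coin : Bool

namespace MixState

def env (a : MixState) : List ℤ :=
  [a.z, a.K, a.i, code a.S, code a.y, 2 ^ (a.n - a.i), if a.coin then 1 else 0]

theorem env_bits (a : MixState) :
    ∀ v ∈ a.env, bitLength v ≤ (Polynomial.X + 1 : Polynomial ℕ).eval a.n := by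
  have := a.le
  have h0 : ∀ k : ℕ, k ≤ 2 ^ (a.n - a.i) → bitLength (k : ℤ) ≤ a.n + 1 := by
    intro k hk
    rw [bitLength_le_iff, Int.natAbs_natCast]
    have : 2 ^ (a.n - a.i) < 2 ^ (a.n + 1) := Nat.pow_lt_pow_right (by omega) (by omega)
    omega
  have h1 := h0 _ a.hz.le
  have h2 := h0 _ a.hK
  have h3 := bitLength_natCast_le a.i
  have h4 := code_bits a.S
  have h5 := code_bits a.y
  have h6 := h0 _ le_rfl
  have h7 : bitLength (if a.coin then 1 else 0) ≤ 1 := by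
    split_ifs <;> simp [bitLength_zero, bitLength_one]
  push_cast at h6
  simp only [env, List.mem_cons, List.not_mem_nil, or_false, Polynomial.eval_add,
    Polynomial.eval_X, Polynomial.eval_one]
  rintro v (rfl | rfl | rfl | rfl | rfl | rfl | rfl) <;> omega

/-- The final values of the first two registers. -/
noncomputable def result (a : MixState) : PMF (ℤ × ℤ) :=
  (PMF.uniformOfFintype (Bits a.i)).map fun w =>
    (a.z + 2 ^ (a.n - a.i) * code (mixBits a.S a.y w), (a.K : ℤ) * twoPow a.S)

/-- The state after one more bit. -/
def next (n i : ℕ) (hi : i + 1 ≤ n) (S y : Bits (i + 1)) (z K : ℕ) (hz : z < 2 ^ (n - (i + 1)))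
    (hK : K ≤ 2 ^ (n - (i + 1))) (b : Bool) : MixState where
  n := n
  i := i
  le := by omega
  S := Fin.tail S
  y := Fin.tail y
  z := z + 2 ^ (n - (i + 1)) * (if (if S 0 then b else y 0) then 1 else 0)
  K := K * (if S 0 then 2 else 1)
  hz := by
    have : n - i = n - (i + 1) + 1 := by omega
    rw [this, pow_succ]
    split_ifs <;> omega
  hK := by
    have : n - i = n - (i + 1) + 1 := by omega
    rw [this, pow_succ]
    split_ifs <;> omega
  coin := b

/-- The update `next` in the arithmetic of codes: division by `2` splits off the first bit, and `y +
S (b - y)` selects between the old bit and the coin. -/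
def nextList (a : MixState) (b : Bool) : List ℤ :=
  [a.z + 2 ^ (a.n - a.i) * (code a.y % 2 + code a.S % 2 * ((if b then 1 else 0) - code a.y % 2)),
    a.K * (1 + code a.S % 2), a.i - 1, code a.S / 2, code a.y / 2, 2 * 2 ^ (a.n - a.i),
    if b then 1 else 0]

theorem env_next (n i : ℕ) (hi : i + 1 ≤ n) (S y : Bits (i + 1)) (z K : ℕ)
    (hz : z < 2 ^ (n - (i + 1))) (hK : K ≤ 2 ^ (n - (i + 1))) (b c : Bool) :
    (next n i hi S y z K hz hK b).env = nextList ⟨n, i + 1, hi, S, y, z, K, hz, hK, c⟩ b := by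
  have e : n - i = n - (i + 1) + 1 := by omega
  have hS := code_succ S
  have hy := code_succ y
  simp only [env, next, nextList, e, pow_succ, hS, hy]
  cases S 0 <;> cases y 0 <;> cases b <;> simp <;> omega

/-- The loop invariant as an identity of distributions, obtained from `uniform_succ`. A coin is used
up also at unmarked positions, where it is discarded, so that the coins correspond to the bits of a
uniform `w`. -/
theorem result_succ (n i : ℕ) (hi : i + 1 ≤ n) (S y : Bits (i + 1)) (z K : ℕ)
    (hz : z < 2 ^ (n - (i + 1))) (hK : K ≤ 2 ^ (n - (i + 1))) (c : Bool) :
    result ⟨n, i + 1, hi, S, y, z, K, hz, hK, c⟩ =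
      fairCoin.bind fun b => result (next n i hi S y z K hz hK b) := by
  have e : n - i = n - (i + 1) + 1 := by omega
  unfold result
  simp only [uniform_succ, PMF.map_bind, PMF.map_comp]
  congr 1
  funext b
  congr 1
  funext w
  simp only [next, Function.comp]
  ext
  · have ht : Fin.tail (mixBits S y (consBit b w)) = mixBits (Fin.tail S) (Fin.tail y) w := by
      funext j; simp only [mixBits, Fin.tail, consBit, Fin.cons_succ]; rfl
    have h0 : mixBits S y (consBit b w) 0 = if S 0 then b else y 0 := by
      simp [mixBits, consBit]
    simp only
    rw [code_succ, ht, h0, e, pow_succ]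
    push_cast
    ring
  · simp only
    rw [twoPow_succ]
    push_cast
    ring

end MixState

theorem efficient_mix_loop : EfficientlySolvable MixState.env (fun a => a.n)
    (fun a μ => μ.map (fun σ : Mem => (σ 0, σ 1)) = a.result) := by
  refine EfficientlySolvable.loop (i := 2) (goodb := fun a μ => ∃ ν : Bool → PMF Mem,
      μ = fairCoin.bind ν ∧ ∀ b, Surely (fun σ => (List.range 7).map σ =
        a.1.nextList b) (ν b))
    ?_ 7 (fun _ => rfl) _ Polynomial.X MixState.env_bits MixState.i ?_ ?_ ?_
  · refine Solv.efficient (Solv.flip (γ := {a // 0 < initMem (MixState.env a) 2} × Bool)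
      (size' := fun a => a.1.1.n) (env' := fun a => a.1.1.env ++ [if a.2 then 1 else 0])
      (good' := fun a μ => Surely (fun σ => (List.range 7).map σ =
        a.1.1.nextList a.2) μ) 7 ?_ ?_)
      _ fun a => MixState.env_bits a.1
    · refine Solv.eval 8 (.var 3 - .const 2 * (.var 3 / .const 2)) (by simp) (fun _ => rfl)
        (Solv.eval 9 (.var 4 - .const 2 * (.var 4 / .const 2)) (by simp) (fun _ => rfl)
        (Solv.eval 10 (.var 0 + .var 5 * (.var 9 + .var 8 * (.var 7 - .var 9))) (by simp)
          (fun _ => rfl)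
        (Solv.eval 11 (.var 1 * (.const 1 + .var 8)) (by simp) (fun _ => rfl)
        (Solv.eval 12 (.var 2 - .const 1) (by simp) (fun _ => rfl)
        (Solv.eval 13 (.var 3 / .const 2) (by simp) (fun _ => rfl)
        (Solv.eval 14 (.var 4 / .const 2) (by simp) (fun _ => rfl)
        (Solv.eval 15 (.const 2 * .var 5) (by simp) (fun _ => rfl)
        (Solv.ret 16 [10, 11, 12, 13, 14, 15, 7] (by simp) fun a =>
          ⟨rfl, fun σ hσ => Surely.pure (hσ.trans ?_)⟩))))))))
      simp [MixState.env, MixState.nextList, initMem, Int.emod_def]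
    · exact fun a => ⟨rfl, fun b => (a, b), fun b => ⟨rfl, rfl⟩, fun ν hν => ⟨ν, rfl, hν⟩⟩
  · intro a
    rw [Polynomial.eval_X]
    exact a.le
  · rintro ⟨n, i, hi, S, y, z, K, hz, hK, c⟩ h
    change (i : ℤ) ≤ 0 at h
    obtain rfl : i = 0 := by omega
    rw [PMF.pure_map, MixState.result]
    have e : ∀ w : Bits 0, (((z : ℤ) + 2 ^ (n - 0) * code (mixBits S y w), (K : ℤ) * twoPow S)) =
        ((z : ℤ), (K : ℤ)) := by
      intro w
      simp [code, twoPow, Nat.ofBits_zero]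
    simp only [e]
    exact (PMF.map_const _ _).symm
  · rintro ⟨⟨n, i, hi, S, y, z, K, hz, hK, c⟩, h⟩ μ ⟨ν₀, rfl, hν₀⟩
    change 0 < (i : ℤ) at h
    obtain ⟨i, rfl⟩ : ∃ k, i = k + 1 := ⟨i - 1, by omega⟩
    -- The coin of the pass is kept in register `6`, so that the successor state can be recovered
    -- from the memory.
    refine ⟨fun σ _ => MixState.next n i hi S y z K hz hK (decide (0 < σ 6)), fun σ hσ => ?_,
      fun ν hν => ?_⟩
    · obtain ⟨b, -, hb⟩ := (PMF.mem_support_bind_iff _ _ _).1 hσ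
      have hl := hν₀ b σ hb
      have h6 : σ 6 = if b then 1 else 0 := by
        have := congrArg (fun l : List ℤ => l.getD 6 0) hl
        simpa [MixState.nextList] using this
      have hd : decide (0 < σ 6) = b := by rw [h6]; cases b <;> simp
      refine ⟨?_, rfl, by simp [MixState.next]⟩
      rw [hl]
      simp only [hd]
      exact MixState.env_next ..
    · rw [PMF.bind_bind, PMF.map_bind, MixState.result_succ]
      congr 1
      funext b
      rw [PMF.map_bind]
      refine bind_const_support fun σ hσ => ?_
      have hl := hν₀ b σ hσ
      have h6 : σ 6 = if b then 1 else 0 := by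
        have := congrArg (fun l : List ℤ => l.getD 6 0) hl
        simpa [MixState.nextList] using this
      have hd : decide (0 < σ 6) = b := by rw [h6]; cases b <;> simp
      have := hν σ ((PMF.mem_support_bind_iff _ _ _).2 ⟨b, by simp [fairCoin], hσ⟩)
      simp only [hd] at this
      exact this

/-- Replacing the bits marked by `S` by random ones. -/
theorem efficient_mix : EfficientlySolvable
    (fun a : (n : ℕ) × (Bits n × Bits n) => [0, 1, (a.1 : ℤ), code a.2.1, code a.2.2, 1, 0])
    (fun a => a.1)
    (fun a μ => μ.map (fun σ : Mem => (σ 0, σ 1)) = (PMF.uniformOfFintype (Bits a.1)).map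
      fun w => (code (mixBits a.2.1 a.2.2 w), (twoPow a.2.1 : ℤ))) := by
  refine efficient_mix_loop.reindex Polynomial.X fun a => ⟨⟨a.1, a.1, le_rfl, a.2.1, a.2.2, 0, 1,
    by simp, by simp, false⟩, ?_, by simp, fun μ hμ => ?_⟩
  · simp [MixState.env]
  · rw [hμ]
    simp [MixState.result]

/-! ### Amplitudes of monomial stabilizer states -/

theorem inner_ket {n : ℕ} (y : Bits n) (v : Qubits n) : inner ℂ (ket y) v = v y := by
  simp [ket, EuclideanSpace.inner_single_left]

theorem norm_ket {n : ℕ} (y : Bits n) : ‖ket y‖ = 1 := by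
  simp [ket]

theorem norm_of_map_ket {n : ℕ} {U : UnitaryOp n} {x y : Bits n} {c : ℂ}
    (h : U (ket x) = c • ket y) : ‖c‖ = 1 := by
  have := congrArg norm h
  rwa [U.norm_map, norm_smul, norm_ket, norm_ket, mul_one, eq_comm] at this

/-- Compare `⟨Ux|Uv⟩ = ⟨x|v⟩` with the value of `U|x⟩`; as `|c| = 1`, the conjugate of `c` can be
moved to the other side. -/
theorem apply_of_map_ket {n : ℕ} {U : UnitaryOp n} {x y : Bits n} {c : ℂ}
    (h : U (ket x) = c • ket y) (v : Qubits n) : U v y = c * v x := by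
  have h1 := U.inner_map_map (ket x) v
  rw [h, inner_smul_left, inner_ket, inner_ket] at h1
  have h2 : c * (starRingEnd ℂ) c = 1 := by
    rw [Complex.mul_conj, Complex.normSq_eq_norm_sq, norm_of_map_ket h]; simp
  rw [← h1, ← mul_assoc, h2, one_mul]

namespace MState

variable {n : ℕ} (M : MState n)

theorem ψ_mem_space : M.ψ ∈ M.space := by
  rw [space, M.eigenspace_eq]
  exact Submodule.mem_span_singleton_self _

theorem group_fixes {U : UnitaryOp n} (hU : U ∈ M.group) : U M.ψ = M.ψ := by
  unfold group at hU
  induction hU using Subgroup.closure_induction with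
  | mem U h =>
    obtain ⟨i, rfl⟩ := h
    exact M.ψ_mem_space i
  | one => rfl
  | mul U V _ _ h1 h2 => exact (congrArg U h2).trans h1
  | inv U _ h => exact (U.symm_apply_eq).2 h.symm

theorem amplitude_of_map {U : UnitaryOp n} (hU : U ∈ M.group) {x y : Bits n} {c : ℂ}
    (h : U (ket x) = c • ket y) : M.ψ y = c * M.ψ x := by
  rw [← apply_of_map_ket h, M.group_fixes hU]

theorem U_mem_group (i : Fin M.m) : M.U i ∈ M.group :=
  Subgroup.subset_closure ⟨i, rfl⟩

theorem self_mem_orbit (x : Bits n) : x ∈ M.orbit x :=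
  ⟨1, ⟨1, M.group.one_mem, fun _ => 1, fun y => by simp⟩, rfl⟩

theorem perm_mem_orbit (i : Fin M.m) {x y : Bits n} (h : y ∈ M.orbit x) :
    M.perm i y ∈ M.orbit x := by
  obtain ⟨P, ⟨U, hU, d, hd⟩, rfl⟩ := h
  refine ⟨M.perm i * P, ⟨M.U i * U, M.group.mul_mem (M.U_mem_group i) hU,
    fun z => d z * M.phase i (P z), fun z => ?_⟩, rfl⟩
  change M.U i (U (ket z)) = _
  rw [hd, map_smul, M.acts, smul_smul]
  rfl

theorem perm_mem_orbit_iff (i : Fin M.m) {x y : Bits n} :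
    M.perm i y ∈ M.orbit x ↔ y ∈ M.orbit x := by
  refine ⟨fun h => ?_, M.perm_mem_orbit i⟩
  obtain ⟨P, ⟨U, hU, d, hd⟩, h⟩ := h
  refine ⟨(M.perm i)⁻¹ * P, ⟨(M.U i)⁻¹ * U,
    M.group.mul_mem (M.group.inv_mem (M.U_mem_group i)) hU,
    fun z => d z * (M.phase i ((M.perm i)⁻¹ (P z)))⁻¹, fun z => ?_⟩, ?_⟩
  · have hne : M.phase i ((M.perm i)⁻¹ (P z)) ≠ 0 := by
      intro h0
      have := norm_of_map_ket (M.acts i ((M.perm i)⁻¹ (P z)))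
      rw [h0, norm_zero] at this
      exact zero_ne_one this
    change (M.U i).symm (U (ket z)) = _
    rw [hd]
    refine ((M.U i).symm_apply_eq).2 ?_
    rw [map_smul, Equiv.Perm.mul_apply, M.acts, smul_smul, mul_assoc, inv_mul_cancel₀ hne, mul_one]
    simp
  · rw [Equiv.Perm.mul_apply, h]; simp

theorem amplitude_ne_zero {x : Bits n} (hx : x ∈ M.support) : M.ψ x ≠ 0 := by
  obtain ⟨v, hv, h⟩ := hx
  rw [space, M.eigenspace_eq, Submodule.mem_span_singleton] at hv
  obtain ⟨c, rfl⟩ := hv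
  rw [inner_ket] at h
  intro h0
  exact h (by simp [h0])

/-- The generators map the orbit and its complement to themselves, so the restriction `φ` of `ψ` to
the orbit is again a common fixed vector. By uniqueness `φ` is a multiple of `ψ`, and the factor is
`1` because both agree at `x`, where `ψ` does not vanish. -/
theorem amplitude_eq_zero {x y : Bits n} (hx : x ∈ M.support) (hy : y ∉ M.orbit x) :
    M.ψ y = 0 := by
  classical
  set φ : Qubits n := WithLp.toLp 2 fun y => if y ∈ M.orbit x then M.ψ y else 0 with hφ
  have hval : ∀ y, φ y = if y ∈ M.orbit x then M.ψ y else 0 := fun y => rfl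
  have hmem : φ ∈ commonEigenspace M.U := by
    intro i
    ext z
    obtain ⟨y, rfl⟩ := (M.perm i).surjective z
    rw [apply_of_map_ket (M.acts i y), hval, hval, M.perm_mem_orbit_iff,
      M.amplitude_of_map (M.U_mem_group i) (M.acts i y)]
    split_ifs <;> simp
  rw [M.eigenspace_eq, Submodule.mem_span_singleton] at hmem
  obtain ⟨c, hc⟩ := hmem
  have h1 : c * M.ψ x = M.ψ x := by
    have := congrArg (fun v : Qubits n => v x) hc
    simpa [hval, M.self_mem_orbit] using this
  have h2 : c = 1 := mul_right_cancel₀ (M.amplitude_ne_zero hx) (by rw [h1, one_mul])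
  have := congrArg (fun v : Qubits n => v y) hc
  simpa [hval, hy, h2] using this

/-- All that is used of the phase: it is realized by some group element. Its uniqueness plays no
role. -/
theorem xi_spec {x y : Bits n} (hy : y ∈ M.orbit x) :
    ∃ U ∈ M.group, U (ket x) = M.xi x y • ket y := by
  obtain ⟨P, ⟨U, hU, d, hd⟩, rfl⟩ := hy
  exact Classical.epsilon_spec (p := fun ξ : ℂ => ∃ U ∈ M.group, U (ket x) = ξ • ket (P x))
    ⟨d x, U, hU, hd x⟩

theorem norm_xi {x y : Bits n} (hy : y ∈ M.orbit x) : ‖M.xi x y‖ = 1 := by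
  obtain ⟨U, _, h⟩ := M.xi_spec hy
  exact norm_of_map_ket h

theorem amplitude_eq {x y : Bits n} (hy : y ∈ M.orbit x) : M.ψ y = M.xi x y * M.ψ x := by
  obtain ⟨U, hU, h⟩ := M.xi_spec hy
  exact M.amplitude_of_map hU h

/-- Normalization of `ψ`, whose amplitudes have equal modulus on the orbit and vanish elsewhere. -/
theorem norm_sq_amplitude {x : Bits n} (hx : x ∈ M.support) :
    ‖M.ψ x‖ ^ 2 = ((M.orbit x).ncard : ℝ)⁻¹ := by
  classical
  have h1 := EuclideanSpace.norm_sq_eq M.ψ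
  rw [M.norm_ψ] at h1
  have h2 : ∀ y, ‖M.ψ y‖ ^ 2 = if y ∈ M.orbit x then ‖M.ψ x‖ ^ 2 else 0 := by
    intro y
    split_ifs with h
    · rw [M.amplitude_eq h, norm_mul, M.norm_xi h, one_mul]
    · rw [M.amplitude_eq_zero hx h]; simp
  rw [Finset.sum_congr rfl fun y _ => h2 y] at h1
  rw [← Finset.sum_filter, Finset.sum_const, nsmul_eq_mul] at h1
  have h3 : (M.orbit x).ncard = (Finset.univ.filter (· ∈ M.orbit x)).card := by
    rw [← Set.ncard_coe_finset]; congr 1; ext; simp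
  rw [h3]
  exact eq_inv_of_mul_eq_one_right (by rw [one_pow] at h1; exact h1.symm)

theorem basisDistribution_eq {x : Bits n} (hx : x ∈ M.support) :
    M.basisDistribution = uniformOn (M.orbit x) := by
  funext y
  rw [basisDistribution, inner_ket, uniformOn]
  by_cases h : y ∈ M.orbit x
  · rw [Set.indicator_of_mem h, M.amplitude_eq h, norm_mul, M.norm_xi h, one_mul,
      M.norm_sq_amplitude hx]
  · rw [Set.indicator_of_notMem h, M.amplitude_eq_zero hx h]; simp

theorem uniformOn_nonneg (O : Set (Bits n)) (y : Bits n) : 0 ≤ uniformOn O y :=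
  Set.indicator_nonneg (fun _ _ => by positivity) y

theorem sum_uniformOn_orbit {x : Bits n} (hx : x ∈ M.support) :
    ∑ y, uniformOn (M.orbit x) y = 1 := by
  rw [← M.basisDistribution_eq hx]
  have h1 := EuclideanSpace.norm_sq_eq M.ψ
  rw [M.norm_ψ] at h1
  simp only [basisDistribution, inner_ket]
  rw [one_pow] at h1
  exact h1.symm

end MState

/-! ### Local observables as averages -/

theorem sum_consBit {n : ℕ} {R : Type*} [AddCommMonoid R] (f : Bits (n + 1) → R) :
    ∑ w, f w = ∑ b, ∑ w, f (consBit b w) := by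
  rw [← (Fin.consEquiv fun _ : Fin (n + 1) => Bool).sum_comp, Fintype.sum_prod_type]
  rfl

/-- Each `z` that agrees with `y` off `S` arises from `2 ^ (n - |S|)` strings `w`. The factor
`twoPow S` on the left avoids the difference in the exponent, and the induction removes one bit at a
time. -/
theorem sum_mixBits {n : ℕ} (S y : Bits n) (h : Bits n → ℝ) :
    (twoPow S : ℝ) * ∑ w, h (mixBits S y w) =
      2 ^ n * ∑ z, if ∀ i, S i = false → y i = z i then h z else 0 := by
  induction n with
  | zero =>
    have : ∀ w, mixBits S y w = w := fun w => Subsingleton.elim _ _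
    simp [twoPow, this]
  | succ n ih =>
    rw [sum_consBit, sum_consBit, twoPow_succ]
    have hag : ∀ b (z : Bits n), (∀ i, S i = false → y i = consBit b z i) ↔
        (S 0 = false → y 0 = b) ∧ ∀ i, Fin.tail S i = false → Fin.tail y i = z i := by
      intro b z
      rw [Fin.forall_fin_succ]
      rfl
    have hmix : ∀ b w, mixBits S y (consBit b w) =
        consBit (if S 0 then b else y 0) (mixBits (Fin.tail S) (Fin.tail y) w) := by
      intro b w
      funext i
      refine Fin.cases ?_ (fun j => ?_) i <;> rfl
    simp only [hag, hmix, Fintype.sum_bool]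
    have := fun b => ih (Fin.tail S) (Fin.tail y) fun z => h (consBit b z)
    rw [pow_succ]
    cases hS : S 0
    · simp only [Bool.false_eq_true, if_false, forall_const]
      have h1 := this (y 0)
      cases hy : y 0
      · rw [hy] at h1
        simp
        linear_combination 2 * h1
      · rw [hy] at h1
        simp
        linear_combination 2 * h1
    · simp only [if_true, Bool.true_eq_false, false_imp_iff, true_and]
      push_cast
      linear_combination 2 * this true + 2 * this false

namespace LocalObservable

variable {n : ℕ} (A : LocalObservable n) (M : MState n)

/-- The qubits on which the observable acts, as a bit string. -/
def mask : Bits n := fun i => decide (i ∈ A.sites)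

theorem twoPow_mask : twoPow A.mask = 2 ^ A.sites.card := by
  rw [twoPow_eq]; simp [mask]

theorem norm_entry_le (y z : Bits n) : ‖inner ℂ (ket y) (A.op (ket z))‖ ≤ 1 := by
  refine (norm_inner_le_norm _ _).trans ?_
  rw [norm_ket, one_mul]
  refine (A.op.le_opNorm _).trans ?_
  rw [norm_ket, mul_one]
  exact A.norm_le_one

open Classical in
/-- The random variable whose mean value is the expectation value of the observable. -/
noncomputable def sampleValue (x y z : Bits n) : ℝ :=
  if y ∈ M.orbit x ∧ z ∈ M.orbit x then
    twoPow A.mask * ((starRingEnd ℂ) (M.xi x y) * M.xi x z *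
      inner ℂ (ket y) (A.op (ket z))).re else 0

/-- The expectation value of the observable. -/
noncomputable def mean : ℝ := (inner ℂ M.ψ (A.op M.ψ)).re

theorem inner_eq_mean : inner ℂ M.ψ (A.op M.ψ) = (A.mean M : ℂ) := by
  have h := A.isSelfAdjoint.isSymmetric
  have := h.coe_re_inner_self_apply M.ψ
  have h2 := h M.ψ M.ψ
  have h3 : (starRingEnd ℂ) (inner ℂ M.ψ (A.op M.ψ)) = inner ℂ M.ψ (A.op M.ψ) := by
    rw [inner_conj_symm]; exact h2
  exact (Complex.conj_eq_iff_re.1 h3).symm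

theorem abs_mean_le : |A.mean M| ≤ 1 := by
  refine (Complex.abs_re_le_norm _).trans ((norm_inner_le_norm _ _).trans ?_)
  rw [M.norm_ψ, one_mul]
  refine (A.op.le_opNorm _).trans ?_
  rw [M.norm_ψ, mul_one]
  exact A.norm_le_one

theorem one_le_twoPow_mask : (1 : ℝ) ≤ twoPow A.mask := by
  rw [twoPow_mask]; push_cast; exact one_le_pow₀ (by norm_num)

theorem abs_sampleValue_le (x y z : Bits n) : |A.sampleValue M x y z| ≤ twoPow A.mask := by
  unfold sampleValue
  split_ifs with h
  · rw [abs_mul, Nat.abs_cast]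
    refine mul_le_of_le_one_right (by positivity) ((Complex.abs_re_le_norm _).trans ?_)
    rw [norm_mul, norm_mul, RCLike.norm_conj, M.norm_xi h.1, M.norm_xi h.2, one_mul, one_mul]
    exact A.norm_entry_le y z
  · simp

/-- In the expansion of `⟨ψ|A|ψ⟩`, writing `ψ(y) = ξ(y) ψ(x)` leaves the common weight `|ψ(x)|²`,
the reciprocal of the size of the orbit. The remaining sum over `z` is `2^k` times a uniform average
over the strings `mixBits A.mask y w`. -/
theorem mean_eq_sum {x : Bits n} (hx : x ∈ M.support) :
    A.mean M = ∑ y, uniformOn (M.orbit x) y *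
      ((2 ^ n)⁻¹ * ∑ w, A.sampleValue M x y (mixBits A.mask y w)) := by
  classical
  have hψ : M.ψ = ∑ z, M.ψ z • ket z := by
    ext y
    simp [ket, Finset.sum_apply, Pi.single_apply]
  have h1 : inner ℂ M.ψ (A.op M.ψ) =
      ∑ y, ∑ z, (starRingEnd ℂ) (M.ψ y) * M.ψ z * inner ℂ (ket y) (A.op (ket z)) := by
    conv_lhs => rw [hψ]
    simp only [map_sum, map_smul, sum_inner, inner_sum, inner_smul_left, inner_smul_right,
      Finset.mul_sum]
    rw [Finset.sum_comm]
    refine Finset.sum_congr rfl fun y _ => Finset.sum_congr rfl fun z _ => by ring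
  rw [mean, h1, Complex.re_sum]
  refine Finset.sum_congr rfl fun y _ => ?_
  by_cases hy : y ∈ M.orbit x
  swap
  · rw [uniformOn, Set.indicator_of_notMem hy, zero_mul]
    simp [M.amplitude_eq_zero hx hy]
  rw [uniformOn, Set.indicator_of_mem hy]
  have h2 := sum_mixBits A.mask y fun z => (if z ∈ M.orbit x then
    ((starRingEnd ℂ) (M.xi x y) * M.xi x z * inner ℂ (ket y) (A.op (ket z))).re else 0)
  have h3 : ∑ w, A.sampleValue M x y (mixBits A.mask y w) =
      2 ^ n * ∑ z, if z ∈ M.orbit x then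
        ((starRingEnd ℂ) (M.xi x y) * M.xi x z * inner ℂ (ket y) (A.op (ket z))).re else 0 := by
    -- Locality: matrix elements between strings that differ off the sites vanish, so the
    -- restriction on `z` can be dropped.
    have e : ∀ z, (if ∀ i, A.mask i = false → y i = z i then (if z ∈ M.orbit x then
        ((starRingEnd ℂ) (M.xi x y) * M.xi x z * inner ℂ (ket y) (A.op (ket z))).re else 0)
        else 0) = if z ∈ M.orbit x then
        ((starRingEnd ℂ) (M.xi x y) * M.xi x z * inner ℂ (ket y) (A.op (ket z))).re else 0 := by
      intro z
      obtain ⟨B, hB⟩ := A.isLocal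
      split_ifs with h1 h2
      · rfl
      · rfl
      · rw [(hB y z).2 (by simpa [mask] using h1)]; simp
      · rfl
    simp only [e] at h2
    rw [← h2, Finset.mul_sum]
    refine Finset.sum_congr rfl fun w _ => ?_
    simp only [sampleValue, hy, true_and, mul_ite, mul_zero]
  rw [h3, inv_mul_cancel_left₀ (by positivity), ← M.norm_sq_amplitude hx, Complex.re_sum,
    Finset.mul_sum]
  refine Finset.sum_congr rfl fun z _ => ?_
  split_ifs with hz
  · rw [M.amplitude_eq hy, M.amplitude_eq hz]
    have : (starRingEnd ℂ) (M.xi x y * M.ψ x) * (M.xi x z * M.ψ x) *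
        inner ℂ (ket y) (A.op (ket z)) = ((‖M.ψ x‖ ^ 2 : ℝ) : ℂ) *
        ((starRingEnd ℂ) (M.xi x y) * M.xi x z * inner ℂ (ket y) (A.op (ket z))) := by
      have : ((‖M.ψ x‖ ^ 2 : ℝ) : ℂ) = (starRingEnd ℂ) (M.ψ x) * M.ψ x := by
        rw [← Complex.normSq_eq_norm_sq, Complex.normSq_eq_conj_mul_self]
      rw [this, map_mul]; ring
    rw [this, Complex.re_ofReal_mul]
  · rw [M.amplitude_eq_zero hx hz]; simp

end LocalObservable

/-! ### Exponential moments -/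

/-- Average `exp u ≤ 1 + u + u²`, valid for `|u| ≤ 1`; the linear term has mean zero. -/
theorem sum_exp_le {I : Type*} (s : Finset I) (p X : I → ℝ) (m l c : ℝ) (hp : ∀ i ∈ s, 0 ≤ p i)
    (h1 : ∑ i ∈ s, p i = 1) (hm : ∑ i ∈ s, p i * X i = m) (hc : c ≤ 1)
    (hX : ∀ i ∈ s, |l * (X i - m)| ≤ c) :
    ∑ i ∈ s, p i * Real.exp (l * (X i - m)) ≤ 1 + c ^ 2 := by
  have h : ∀ i ∈ s, p i * Real.exp (l * (X i - m)) ≤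
      p i * (1 + c ^ 2) + l * (p i * X i - m * p i) := by
    intro i hi
    have h2 := Real.abs_exp_sub_one_sub_id_le ((hX i hi).trans hc)
    have h3 := (abs_le.1 h2).2
    have h4 : (l * (X i - m)) ^ 2 ≤ c ^ 2 := sq_le_sq' (by linarith [(abs_le.1 (hX i hi)).1])
      (abs_le.1 (hX i hi)).2
    have h5 := mul_le_mul_of_nonneg_left (show Real.exp (l * (X i - m)) ≤
      1 + l * (X i - m) + c ^ 2 by linarith) (hp i hi)
    linarith
  refine (Finset.sum_le_sum h).trans (le_of_eq ?_)
  rw [Finset.sum_add_distrib, ← Finset.sum_mul, ← Finset.mul_sum, Finset.sum_sub_distrib,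
    ← Finset.mul_sum, h1, hm]
  ring

/-- `sum_exp_le` on the pairs `(y, w)`: the deviation from the mean is at most `2^k + 1 ≤ 2 * 2^k`.
-/
theorem LocalObservable.sum_exp_sampleValue_le {n : ℕ} (A : LocalObservable n) (M : MState n)
    {x : Bits n} (hx : x ∈ M.support) (l : ℝ) (hl : |l| * (2 * twoPow A.mask) ≤ 1) :
    ∑ y, uniformOn (M.orbit x) y * ((2 ^ n)⁻¹ * ∑ w,
      Real.exp (l * (A.sampleValue M x y (mixBits A.mask y w) - A.mean M))) ≤
      1 + (|l| * (2 * twoPow A.mask)) ^ 2 := by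
  have e : ∀ f : Bits n → Bits n → ℝ, ∑ y, uniformOn (M.orbit x) y * ((2 ^ n)⁻¹ * ∑ w, f y w) =
      ∑ p : Bits n × Bits n, (uniformOn (M.orbit x) p.1 * (2 ^ n)⁻¹) * f p.1 p.2 := by
    intro f
    rw [Fintype.sum_prod_type]
    simp only [Finset.mul_sum, mul_assoc]
  have h1 : ∑ p : Bits n × Bits n, uniformOn (M.orbit x) p.1 * (2 ^ n : ℝ)⁻¹ = 1 := by
    have := e fun _ _ => 1
    simp only [mul_one] at this
    rw [← this]
    simp [M.sum_uniformOn_orbit hx]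
  rw [e]
  refine sum_exp_le Finset.univ (fun p : Bits n × Bits n => uniformOn (M.orbit x) p.1 * (2 ^ n)⁻¹)
    (fun p => A.sampleValue M x p.1 (mixBits A.mask p.1 p.2)) (A.mean M) l _
    (fun p _ => mul_nonneg (MState.uniformOn_nonneg _ _) (by positivity)) h1 ?_ hl fun p _ => ?_
  · rw [A.mean_eq_sum M hx, e]
  · rw [abs_mul]
    have h2 := A.abs_sampleValue_le M x p.1 (mixBits A.mask p.1 p.2)
    have h3 := A.abs_mean_le M
    have h4 := A.one_le_twoPow_mask
    have h5 := abs_sub (A.sampleValue M x p.1 (mixBits A.mask p.1 p.2)) (A.mean M)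
    exact mul_le_mul_of_nonneg_left (by linarith) (abs_nonneg l)

open scoped ENNReal

/-! ### Expectation values -/

/-- Expectation value of a nonnegative function. -/
noncomputable def Ex {γ : Type*} (μ : PMF γ) (g : γ → ℝ≥0∞) : ℝ≥0∞ := ∑' s, μ s * g s

section expectation

variable {γ δ : Type*}

theorem Ex_bind (μ : PMF γ) (ν : γ → PMF δ) (g : δ → ℝ≥0∞) :
    Ex (μ.bind ν) g = Ex μ fun s => Ex (ν s) g := by
  simp only [Ex, PMF.bind_apply, ← ENNReal.tsum_mul_right, ← ENNReal.tsum_mul_left]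
  rw [ENNReal.tsum_comm]
  simp only [mul_assoc]

theorem Ex_pure (s : γ) (g : γ → ℝ≥0∞) : Ex (PMF.pure s) g = g s := by
  unfold Ex
  rw [tsum_eq_single s fun t ht => by simp [PMF.pure_apply, ht]]
  simp

theorem Ex_map (μ : PMF γ) (f : γ → δ) (g : δ → ℝ≥0∞) : Ex (μ.map f) g = Ex μ (g ∘ f) := by
  rw [PMF.map, Ex_bind]
  simp only [Function.comp_def, Ex_pure]

theorem Ex_mono {μ : PMF γ} {g h : γ → ℝ≥0∞} (H : ∀ s ∈ μ.support, g s ≤ h s) :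
    Ex μ g ≤ Ex μ h := by
  refine ENNReal.tsum_le_tsum fun s => ?_
  by_cases hs : s ∈ μ.support
  · gcongr
    exact H s hs
  · rw [(μ.apply_eq_zero_iff s).2 hs, zero_mul, zero_mul]

theorem Ex_const (μ : PMF γ) (c : ℝ≥0∞) : Ex μ (fun _ => c) = c := by
  rw [Ex, ENNReal.tsum_mul_right, μ.tsum_coe, one_mul]

theorem Ex_congr {μ : PMF γ} {g h : γ → ℝ≥0∞} (H : ∀ s ∈ μ.support, g s = h s) :
    Ex μ g = Ex μ h :=
  le_antisymm (Ex_mono fun s hs => (H s hs).le) (Ex_mono fun s hs => (H s hs).ge)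

theorem Ex_const_mul (μ : PMF γ) (c : ℝ≥0∞) (g : γ → ℝ≥0∞) :
    Ex μ (fun s => c * g s) = c * Ex μ g := by
  simp only [Ex, ← ENNReal.tsum_mul_left]
  exact tsum_congr fun s => by ring

theorem Ex_add (μ : PMF γ) (g h : γ → ℝ≥0∞) :
    Ex μ (fun s => g s + h s) = Ex μ g + Ex μ h := by
  simp only [Ex, ← ENNReal.tsum_add, mul_add]

theorem Ex_fintype [Fintype γ] (μ : PMF γ) (G : γ → ℝ) (hG : ∀ s, 0 ≤ G s) :
    Ex μ (fun s => ENNReal.ofReal (G s)) = ENNReal.ofReal (∑ s, (μ s).toReal * G s) := by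
  rw [Ex, tsum_fintype, ENNReal.ofReal_sum_of_nonneg fun s _ =>
    mul_nonneg ENNReal.toReal_nonneg (hG s)]
  refine Finset.sum_congr rfl fun s _ => ?_
  rw [ENNReal.ofReal_mul ENNReal.toReal_nonneg, ENNReal.ofReal_toReal (μ.apply_ne_top s)]

theorem Ex_bits {n : ℕ} (G : Bits n → ℝ) (hG : ∀ s, 0 ≤ G s) :
    Ex (PMF.uniformOfFintype (Bits n)) (fun s => ENNReal.ofReal (G s)) =
      ENNReal.ofReal ((2 ^ n)⁻¹ * ∑ s, G s) := by
  rw [Ex_fintype _ _ hG, Finset.mul_sum]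
  simp

open Classical in
theorem probOf_eq_Ex (μ : PMF Mem) (R : Mem → Prop) :
    probOf μ R = (Ex μ fun σ => if R σ then 1 else 0).toReal := by
  rw [probOf, PMF.toOuterMeasure_apply, Ex]
  congr 1
  refine tsum_congr fun σ => ?_
  simp [Set.indicator]

theorem probOf_bind {μ : PMF Mem} {ν : Mem → PMF Mem} {R R' : Mem → Prop}
    (h : ∀ σ ∈ μ.support, Surely (fun σ' => R' σ' ↔ R σ) (ν σ)) :
    probOf (μ.bind ν) R' = probOf μ R := by
  classical
  rw [probOf_eq_Ex, probOf_eq_Ex, Ex_bind]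
  congr 1
  refine Ex_congr fun σ hσ => ?_
  rw [Ex_congr (h := fun _ => if R σ then 1 else 0) fun σ' hσ' => by simp only [h σ hσ σ' hσ'],
    Ex_const]

/-- Markov's inequality at level one. -/
theorem probOf_le {μ : PMF Mem} {R : Mem → Prop} {g : Mem → ℝ≥0∞} {c : ℝ} (hc : 0 ≤ c)
    (hR : ∀ σ ∈ μ.support, R σ → 1 ≤ g σ) (h : Ex μ g ≤ ENNReal.ofReal c) : probOf μ R ≤ c := by
  classical
  rw [probOf_eq_Ex]
  refine ENNReal.toReal_le_of_le_ofReal hc (le_trans (Ex_mono fun σ hσ => ?_) h)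
  split_ifs with h'
  · exact hR σ hσ h'
  · exact zero_le

end expectation

/-- Let `Q` be the actual distribution. Only the strings with `P < Q` increase the expectation;
testing the total variation bound on this set shows that their excess mass is at most `δ`, and there
`G ≤ C`. As `ofCode` reduces modulo `2 ^ n`, outputs of a faulty sampler that encode no string are
treated as strings too. -/
theorem SamplesWithin.Ex_le {n : ℕ} {P : Bits n → ℝ} {δ : ℝ} {μ : PMF Mem}
    (h : SamplesWithin P δ μ) (G : Bits n → ℝ) (C : ℝ) (h0 : ∀ y, 0 ≤ G y) (hC : ∀ y, G y ≤ C) :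
    Ex μ (fun σ => ENNReal.ofReal (G (ofCode n (σ 0)))) ≤
      ENNReal.ofReal (∑ y, P y * G y + δ * C) := by
  classical
  set f : Mem → Bits n := fun σ => ofCode n (σ 0) with hf
  have e1 : Ex μ (fun σ => ENNReal.ofReal (G (ofCode n (σ 0)))) =
      Ex (μ.map f) (fun y => ENNReal.ofReal (G y)) := by rw [Ex_map]; rfl
  rw [e1, Ex_fintype _ _ h0]
  refine ENNReal.ofReal_le_ofReal ?_
  set Q : Bits n → ℝ := fun y => ((μ.map f) y).toReal with hQ
  set E := Finset.univ.filter fun y => P y < Q y with hE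
  have h1 : ∑ y ∈ E, Q y = probOf μ fun σ => σ 0 ∈ {v | ofCode n v ∈ E} := by
    rw [probOf]
    have : {σ : Mem | σ 0 ∈ {v | ofCode n v ∈ E}} = f ⁻¹' (E : Set (Bits n)) := by
      ext σ; simp [hf]
    rw [this, ← PMF.toOuterMeasure_map_apply, PMF.toOuterMeasure_apply_finset,
      ENNReal.toReal_sum fun y _ => PMF.apply_ne_top _ _]
  have h2 : ∑ y ∈ E, P y = ∑ y, (code ⁻¹' {v | ofCode n v ∈ E}).indicator P y := by
    have : (code ⁻¹' {v | ofCode n v ∈ E}) = (E : Set (Bits n)) := by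
      ext y; simp [ofCode_code]
    rw [this, Finset.sum_indicator_eq_sum_filter]
    congr 1
    ext; simp
  have h3 : ∑ y ∈ E, (Q y - P y) ≤ δ := by
    rw [Finset.sum_sub_distrib, h1, h2]
    exact (le_abs_self _).trans (h _)
  have hC0 : 0 ≤ C := (h0 (fun _ => false)).trans (hC _)
  have h4 : ∑ y, (Q y - P y) * G y ≤ ∑ y ∈ E, (Q y - P y) * C := by
    rw [hE, Finset.sum_filter]
    refine Finset.sum_le_sum fun y _ => ?_
    split_ifs with hy
    · exact mul_le_mul_of_nonneg_left (hC y) (by linarith)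
    · exact mul_nonpos_of_nonpos_of_nonneg (by linarith) (h0 y)
  rw [← Finset.sum_mul] at h4
  have h5 := mul_le_mul_of_nonneg_right h3 hC0
  have h6 : ∑ y, (Q y - P y) * G y = ∑ y, Q y * G y - ∑ y, P y * G y := by
    rw [← Finset.sum_sub_distrib]
    exact Finset.sum_congr rfl fun y _ => by ring
  linarith

/-! ### Sampling -/

theorem efficient_sampling {ι : Type*} (n desc : ι → ℕ)
    (hdesc : PolyBounded (fun j => (desc j).size) n) (x : ∀ j, Bits (n j))
    (ha : EfficientlySolvable (fun j => [(n j : ℤ), (desc j : ℤ)]) (fun j => n j)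
      (fun j => Surely fun σ => σ 0 = code (x j)))
    (err : ℕ → ℝ) (P : ∀ j, Bits (n j) → ℝ)
    (hb : EfficientlySolvable
      (fun a : ι × ℕ => [(n a.1 : ℤ), (desc a.1 : ℤ), code (x a.1), (a.2 : ℤ)])
      (fun a => n a.1 + a.2)
      (fun a => SamplesWithin (P a.1) (err a.2))) :
    EfficientlySolvable
      (fun a : ι × ℕ => [(n a.1 : ℤ), (desc a.1 : ℤ), (a.2 : ℤ)])
      (fun a => n a.1 + a.2)
      (fun a => SamplesWithin (P a.1) (err a.2)) := by
  obtain ⟨q, hq⟩ := hdesc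
  refine Solv.efficient (Solv.callDet
    (env' := fun a => [(n a.1 : ℤ), (desc a.1 : ℤ), (a.2 : ℤ), code (x a.1)]) ha 3 1 [0, 1]
    (by simp) Polynomial.X ?_ fun a => ?_) (q + Polynomial.X) fun a => ?_
  · refine Solv.call (γ := (ι × ℕ) × ℤ) (size' := fun a => n a.1.1 + a.1.2)
      (env' := fun a => [(n a.1.1 : ℤ), (desc a.1.1 : ℤ), (a.1.2 : ℤ), code (x a.1.1), a.2])
      (good' := fun a => Surely fun σ => σ 0 = a.2) hb 4 1 [0, 1, 3, 2] (by simp) Polynomial.X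
      ?_ fun a => ?_
    · refine Solv.ret 5 [4] (by simp) fun a => ⟨rfl, fun σ hσ => Surely.pure ?_⟩
      simpa [initMem] using hσ
    · refine ⟨rfl, a, rfl, by simp, fun μ hμ => ⟨fun σ _ => (a, σ 0), fun σ _ => ⟨rfl, rfl⟩,
        fun ν hν E => ?_⟩⟩
      rw [probOf_bind (R := fun σ => σ 0 ∈ E) fun σ hσ σ' hσ' => by
        have := hν σ hσ σ' hσ'
        simp only [this]]
      exact hμ E
  · refine ⟨rfl, a.1, rfl, by simp, fun μ hμ σ hσ => ?_⟩
    simp [hμ σ hσ]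
  · have h1 := bitLength_natCast_le (n a.1)
    have h2 := (hq a.1).trans (eval_nat_mono q (Nat.le_add_right (n a.1) a.2))
    have h3 := bitLength_natCast_le a.2
    change bitLength (desc a.1 : ℤ) ≤ _ at h2
    simp only [List.mem_cons, List.not_mem_nil, or_false, Polynomial.eval_X, Polynomial.eval_add]
    rintro v (rfl | rfl | rfl) <;> omega

/-! ### Estimating expectation values of local observables -/

/-- Telescoping: the exact factors have norm at most `1` and the approximate ones at most `1 + ε ≤
2`, so the three terms contribute `4 + 2 + 1 = 7`. -/
theorem norm_mul_three_sub_le {a b c a' b' c' : ℂ} {ε : ℝ} (h1 : ε ≤ 1)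
    (ha' : ‖a'‖ ≤ 1) (hb' : ‖b'‖ ≤ 1) (hc' : ‖c'‖ ≤ 1) (ha : ‖a - a'‖ ≤ ε) (hb : ‖b - b'‖ ≤ ε)
    (hc : ‖c - c'‖ ≤ ε) : ‖a * b * c - a' * b' * c'‖ ≤ 7 * ε := by
  have h0 : 0 ≤ ε := (norm_nonneg _).trans ha
  have e : a * b * c - a' * b' * c' = (a - a') * b * c + a' * (b - b') * c + a' * b' * (c - c') := by
    ring
  have hb2 : ‖b‖ ≤ 2 := by
    have := norm_add_le b' (b - b')
    rw [add_sub_cancel] at this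
    linarith
  have hc2 : ‖c‖ ≤ 2 := by
    have := norm_add_le c' (c - c')
    rw [add_sub_cancel] at this
    linarith
  have e1 : ‖(a - a') * b * c‖ ≤ ε * 2 * 2 := by
    rw [norm_mul, norm_mul]; gcongr
  have e2 : ‖a' * (b - b') * c‖ ≤ 1 * ε * 2 := by
    rw [norm_mul, norm_mul]; gcongr
  have e3 : ‖a' * b' * (c - c')‖ ≤ 1 * 1 * ε := by
    rw [norm_mul, norm_mul]; gcongr
  rw [e]
  refine (norm_add₃_le).trans ?_
  linarith

/-- Gaussian integers that approximate `z` to `t` bits of precision. -/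
def Approx (t : ℕ) (z : ℂ) : Type :=
  {p : ℤ × ℤ // ‖((p.1 : ℂ) + (p.2 : ℂ) * Complex.I) / 2 ^ t - z‖ ≤ 1 / 2 ^ t}

/-- The integer computed from approximations of two phases and of a matrix element. -/
def combine (K : ℤ) (u v w : ℤ × ℤ) : ℤ :=
  K * ((u.1 * v.1 + u.2 * v.2) * w.1 - (u.1 * v.2 - u.2 * v.1) * w.2)

/-- `combine` is `K` times the real part of `conj u * v * w` for Gaussian integers; each factor has
denominator `2 ^ t`, whence `2 ^ (3 * t)`. -/
theorem combine_approx {t K : ℕ} {ξ ζ α : ℂ} (hξ : ‖ξ‖ ≤ 1) (hζ : ‖ζ‖ ≤ 1) (hα : ‖α‖ ≤ 1)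
    (u : Approx t ξ) (v : Approx t ζ) (w : Approx t α) :
    |(combine K u.1 v.1 w.1 : ℝ) / 2 ^ (3 * t) - K * ((starRingEnd ℂ) ξ * ζ * α).re| ≤
      7 * K / 2 ^ t := by
  obtain ⟨⟨u1, u2⟩, hu⟩ := u
  obtain ⟨⟨v1, v2⟩, hv⟩ := v
  obtain ⟨⟨w1, w2⟩, hw⟩ := w
  simp only at hu hv hw
  have h1 : (1 : ℝ) / 2 ^ t ≤ 1 := by
    rw [div_le_one (by positivity)]; exact one_le_pow₀ (by norm_num)
  have hu' : ‖(starRingEnd ℂ) (((u1 : ℂ) + (u2 : ℂ) * Complex.I) / 2 ^ t) - (starRingEnd ℂ) ξ‖ ≤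
      1 / 2 ^ t := by
    rw [← map_sub, RCLike.norm_conj]; exact hu
  have key := norm_mul_three_sub_le h1 (by rwa [RCLike.norm_conj]) hζ hα hu' hv hw
  have e : (starRingEnd ℂ) (((u1 : ℂ) + (u2 : ℂ) * Complex.I) / 2 ^ t) *
      (((v1 : ℂ) + (v2 : ℂ) * Complex.I) / 2 ^ t) * (((w1 : ℂ) + (w2 : ℂ) * Complex.I) / 2 ^ t) =
      (((1 / 2 ^ (3 * t) : ℝ) : ℝ) : ℂ) * ((((u1 : ℂ) - (u2 : ℂ) * Complex.I) *
        ((v1 : ℂ) + (v2 : ℂ) * Complex.I)) * ((w1 : ℂ) + (w2 : ℂ) * Complex.I)) := by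
    rw [map_div₀, map_add, map_mul, Complex.conj_I, map_pow, Complex.conj_ofNat]
    simp only [map_intCast]
    have : (2 : ℂ) ^ (3 * t) = 2 ^ t * 2 ^ t * 2 ^ t := by ring
    push_cast
    rw [this]
    ring
  rw [e] at key
  have h2 := (Complex.abs_re_le_norm _).trans key
  rw [Complex.sub_re, Complex.re_ofReal_mul] at h2
  have h3 := mul_le_mul_of_nonneg_left h2 (Nat.cast_nonneg (α := ℝ) K)
  rw [← Nat.abs_cast, ← abs_mul, Nat.abs_cast] at h3
  refine le_of_eq_of_le ?_ (h3.trans (le_of_eq ?_))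
  · congr 1
    simp [combine]
    ring
  · ring

/-! ### The contribution of two basis strings -/

section observables

variable {ι κ : Type*} {n desc : ι → ℕ} {M : ∀ j, MState (n j)} {x : ∀ j, Bits (n j)}
  {inst : κ → ι} {adesc : κ → ℕ} {A : ∀ k, LocalObservable (n (inst k))}

/-- Input for the computation of the contribution of two basis states. -/
structure PairInput (n : ι → ℕ) (inst : κ → ι) where
  k : κ
  t : ℕ
  y : Bits (n (inst k))
  z : Bits (n (inst k))

/-- The registers that hold a `PairInput`. -/
def PairInput.env (desc : ι → ℕ) (x : ∀ j, Bits (n j)) (adesc : κ → ℕ)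
    (A : ∀ k, LocalObservable (n (inst k))) (a : PairInput n inst) : List ℤ :=
  [(n (inst a.k) : ℤ), (desc (inst a.k) : ℤ), (adesc a.k : ℤ), code (x (inst a.k)), (a.t : ℤ),
    code a.y, code a.z, (twoPow (A a.k).mask : ℤ)]

/-- `v` approximates the contribution of two basis states. -/
def PairInput.IsValue (M : ∀ j, MState (n j)) (x : ∀ j, Bits (n j))
    (A : ∀ k, LocalObservable (n (inst k))) (a : PairInput n inst) (v : ℤ) : Prop :=
  |(v : ℝ) / 2 ^ (3 * a.t) - (A a.k).sampleValue (M (inst a.k)) (x (inst a.k)) a.y a.z| ≤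
    7 * twoPow (A a.k).mask / 2 ^ a.t

theorem twoPow_le {n : ℕ} (S : Bits n) : twoPow S ≤ 2 ^ n := by
  rw [twoPow_eq]
  refine Nat.pow_le_pow_right (by norm_num) ?_
  simpa using Finset.card_filter_le Finset.univ fun j => S j = true

/-- Keeps the registers of the summation loop short. The factor `8 = 1 + 7` adds the rounding error
to the bound for the exact value, with `2^k ≤ 2 ^ n`. -/
theorem PairInput.IsValue.abs_le {a : PairInput n inst} {v : ℤ} (h : a.IsValue M x A v) :
    |v| ≤ 8 * 2 ^ n (inst a.k) * 2 ^ (3 * a.t) := by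
  have h1 := (A a.k).abs_sampleValue_le (M (inst a.k)) (x (inst a.k)) a.y a.z
  have h2 : (7 : ℝ) * twoPow (A a.k).mask / 2 ^ a.t ≤ 7 * twoPow (A a.k).mask :=
    div_le_self (by positivity) (one_le_pow₀ (by norm_num))
  have h3 : (twoPow (A a.k).mask : ℝ) ≤ 2 ^ n (inst a.k) := by
    exact_mod_cast twoPow_le (A a.k).mask
  have h4 := abs_sub_abs_le_abs_sub ((v : ℝ) / 2 ^ (3 * a.t))
    ((A a.k).sampleValue (M (inst a.k)) (x (inst a.k)) a.y a.z)
  have h5 : |(v : ℝ) / 2 ^ (3 * a.t)| ≤ 8 * 2 ^ n (inst a.k) := by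
    unfold PairInput.IsValue at h
    linarith
  rw [abs_div, abs_of_pos (show (0 : ℝ) < 2 ^ (3 * a.t) by positivity),
    div_le_iff₀ (by positivity)] at h5
  exact_mod_cast h5

theorem PairInput.isValue_combine (a : PairInput n inst)
    (h : a.y ∈ (M (inst a.k)).orbit (x (inst a.k)) ∧ a.z ∈ (M (inst a.k)).orbit (x (inst a.k)))
    (u : Approx a.t ((M (inst a.k)).xi (x (inst a.k)) a.y))
    (v : Approx a.t ((M (inst a.k)).xi (x (inst a.k)) a.z))
    (w : Approx a.t (inner ℂ (ket a.y) ((A a.k).op (ket a.z)))) :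
    a.IsValue M x A (combine (twoPow (A a.k).mask) u.1 v.1 w.1) := by
  rw [PairInput.IsValue, LocalObservable.sampleValue, if_pos h]
  exact combine_approx ((M (inst a.k)).norm_xi h.1).le ((M (inst a.k)).norm_xi h.2).le
    ((A a.k).norm_entry_le a.y a.z) u v w

theorem PairInput.isValue_zero (a : PairInput n inst) (h : ¬ (a.y ∈ (M (inst a.k)).orbit
    (x (inst a.k)) ∧ a.z ∈ (M (inst a.k)).orbit (x (inst a.k)))) : a.IsValue M x A 0 := by
  rw [PairInput.IsValue, LocalObservable.sampleValue, if_neg h]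
  simp only [Int.cast_zero, zero_div, sub_zero, abs_zero]
  positivity

-- Phases can be requested only for strings in the orbit, so membership of both strings is tested
-- first; the product of the two flags decides, and the value is `0` if a test fails.
open Classical in
theorem efficient_pair
    (hdesc : PolyBounded (fun j => (desc j).size) n)
    (hadesc : PolyBounded (fun k => (adesc k).size) (fun k => n (inst k)))
    (hc : EfficientlySolvable
      (fun a : (j : ι) × Bits (n j) => [(n a.1 : ℤ), (desc a.1 : ℤ), code (x a.1), code a.2])
      (fun a => n a.1)
      (fun a => Surely fun σ => σ 0 = if a.2 ∈ (M a.1).orbit (x a.1) then 1 else 0))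
    (hd : EfficientlySolvable
      (fun a : (j : ι) × ((M j).orbit (x j) × ℕ) =>
        [(n a.1 : ℤ), (desc a.1 : ℤ), code (x a.1), code (a.2.1 : Bits (n a.1)), (a.2.2 : ℤ)])
      (fun a => n a.1 + a.2.2)
      (fun a => Surely (HoldsApprox a.2.2 ((M a.1).xi (x a.1) a.2.1))))
    (hentry : EfficientlySolvable
      (fun a : (k : κ) × (Bits (n (inst k)) × Bits (n (inst k)) × ℕ) =>
        [(n (inst a.1) : ℤ), (desc (inst a.1) : ℤ), (adesc a.1 : ℤ),
          code a.2.1, code a.2.2.1, (a.2.2.2 : ℤ)])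
      (fun a => n (inst a.1) + a.2.2.2)
      (fun a => Surely (HoldsApprox a.2.2.2
        (inner ℂ (ket a.2.1) ((A a.1).op (ket a.2.2.1)))))) :
    EfficientlySolvable (PairInput.env desc x adesc A) (fun a => n (inst a.k) + a.t)
      (fun a => Surely fun σ => a.IsValue M x A (σ 0)) := by
  obtain ⟨q₁, hq₁⟩ := hdesc
  obtain ⟨q₂, hq₂⟩ := hadesc
  refine Solv.efficient ?_ (q₁ + q₂ + Polynomial.X + 1) fun a => ?_
  · refine Solv.callDet (env' := fun a => a.env desc x adesc A ++
        [if a.y ∈ (M (inst a.k)).orbit (x (inst a.k)) then 1 else 0])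
      hc 8 1 [0, 1, 3, 5] (by simp) Polynomial.X ?_ fun a =>
      ⟨rfl, ⟨inst a.k, a.y⟩, rfl, by simp, fun μ hμ σ hσ => by simp [hμ σ hσ]⟩
    refine Solv.callDet (env' := fun a => a.env desc x adesc A ++
        [if a.y ∈ (M (inst a.k)).orbit (x (inst a.k)) then 1 else 0,
          if a.z ∈ (M (inst a.k)).orbit (x (inst a.k)) then 1 else 0])
      hc 9 1 [0, 1, 3, 6] (by simp) Polynomial.X ?_ fun a =>
      ⟨rfl, ⟨inst a.k, a.z⟩, rfl, by simp, fun μ hμ σ hσ => by simp [hμ σ hσ]⟩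
    let base (a : PairInput n inst) : List ℤ := a.env desc x adesc A ++
        [if a.y ∈ (M (inst a.k)).orbit (x (inst a.k)) then 1 else 0,
          if a.z ∈ (M (inst a.k)).orbit (x (inst a.k)) then 1 else 0,
          if a.y ∈ (M (inst a.k)).orbit (x (inst a.k)) ∧
            a.z ∈ (M (inst a.k)).orbit (x (inst a.k)) then 1 else 0]
    refine Solv.exp (env' := base) ?_ 10 (.var 8 * .var 9) (by simp) fun a => ⟨rfl, ?_⟩
    swap
    · have e : (Exp.var 8 * Exp.var 9).eval (initMem (a.env desc x adesc A ++
          [if a.y ∈ (M (inst a.k)).orbit (x (inst a.k)) then 1 else 0,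
            if a.z ∈ (M (inst a.k)).orbit (x (inst a.k)) then 1 else 0])) =
          (if a.y ∈ (M (inst a.k)).orbit (x (inst a.k)) then 1 else 0) *
            (if a.z ∈ (M (inst a.k)).orbit (x (inst a.k)) then 1 else 0) := rfl
      rw [e]
      by_cases h1 : a.y ∈ (M (inst a.k)).orbit (x (inst a.k)) <;>
        by_cases h2 : a.z ∈ (M (inst a.k)).orbit (x (inst a.k)) <;> simp [base, h1, h2]
    have h10 : ∀ a : PairInput n inst, initMem (base a) 10 =
        if a.y ∈ (M (inst a.k)).orbit (x (inst a.k)) ∧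
            a.z ∈ (M (inst a.k)).orbit (x (inst a.k)) then 1 else 0 := fun a => rfl
    let P := {a : PairInput n inst // a.y ∈ (M (inst a.k)).orbit (x (inst a.k)) ∧
      a.z ∈ (M (inst a.k)).orbit (x (inst a.k))}
    let N := {a : PairInput n inst // ¬ (a.y ∈ (M (inst a.k)).orbit (x (inst a.k)) ∧
      a.z ∈ (M (inst a.k)).orbit (x (inst a.k)))}
    refine Solv.ifPos (β := P) (γ := N) (size₁ := fun a => n (inst a.1.k) + a.1.t)
      (size₂ := fun a => n (inst a.1.k) + a.1.t) (env₁ := fun a => base a.1)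
      (env₂ := fun a => base a.1) (good₁ := fun a => Surely fun σ => a.1.IsValue M x A (σ 0))
      (good₂ := fun a => Surely fun σ => a.1.IsValue M x A (σ 0)) 10 ?_ ?_ ?_ ?_
    -- The approximations are not determined by the inputs and may depend on coins. Each is carried
    -- along in the index of the remaining task.
    · let γ₁ := (a : P) × Approx a.1.t ((M (inst a.1.k)).xi (x (inst a.1.k)) a.1.y)
      let γ₂ := (a : γ₁) × Approx a.1.1.t ((M (inst a.1.1.k)).xi (x (inst a.1.1.k)) a.1.1.z)
      let γ₃ := (a : γ₂) × Approx a.1.1.1.t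
        (inner ℂ (ket a.1.1.1.y) ((A a.1.1.1.k).op (ket a.1.1.1.z)))
      refine Solv.call (γ := γ₁) (size' := fun a => n (inst a.1.1.k) + a.1.1.t)
        (env' := fun a => base a.1.1 ++ [a.2.1.1, a.2.1.2])
        (good' := fun a => Surely fun σ => a.1.1.IsValue M x A (σ 0))
        hd 11 2 [0, 1, 3, 5, 4] (by simp) Polynomial.X ?_ fun a =>
        ⟨rfl, ⟨inst a.1.k, ⟨a.1.y, a.2.1⟩, a.1.t⟩, rfl, by simp, fun μ hμ =>
          ⟨fun σ hσ => ⟨a, ⟨(σ 0, σ 1), hμ σ hσ⟩⟩, fun σ hσ => ⟨rfl, rfl⟩,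
            fun ν hν => Surely.bind hν⟩⟩
      refine Solv.call (γ := γ₂) (size' := fun a => n (inst a.1.1.1.k) + a.1.1.1.t)
        (env' := fun a => base a.1.1.1 ++ [a.1.2.1.1, a.1.2.1.2] ++ [a.2.1.1, a.2.1.2])
        (good' := fun a => Surely fun σ => a.1.1.1.IsValue M x A (σ 0))
        hd 13 2 [0, 1, 3, 6, 4] (by simp) Polynomial.X ?_ fun a =>
        ⟨rfl, ⟨inst a.1.1.k, ⟨a.1.1.z, a.1.2.2⟩, a.1.1.t⟩, rfl, by simp, fun μ hμ =>
          ⟨fun σ hσ => ⟨a, ⟨(σ 0, σ 1), hμ σ hσ⟩⟩, fun σ hσ => ⟨rfl, rfl⟩,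
            fun ν hν => Surely.bind hν⟩⟩
      refine Solv.call (γ := γ₃) (size' := fun a => n (inst a.1.1.1.1.k) + a.1.1.1.1.t)
        (env' := fun a => base a.1.1.1.1 ++ [a.1.1.2.1.1, a.1.1.2.1.2] ++
          [a.1.2.1.1, a.1.2.1.2] ++ [a.2.1.1, a.2.1.2])
        (good' := fun a => Surely fun σ => a.1.1.1.1.IsValue M x A (σ 0))
        hentry 15 2 [0, 1, 2, 5, 6, 4] (by simp) Polynomial.X ?_ fun a =>
        ⟨rfl, ⟨a.1.1.1.k, a.1.1.1.y, a.1.1.1.z, a.1.1.1.t⟩, rfl, by simp, fun μ hμ =>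
          ⟨fun σ hσ => ⟨a, ⟨(σ 0, σ 1), hμ σ hσ⟩⟩, fun σ hσ => ⟨rfl, rfl⟩,
            fun ν hν => Surely.bind hν⟩⟩
      refine Solv.eval 17 (.var 7 * ((.var 11 * .var 13 + .var 12 * .var 14) * .var 15 -
        (.var 11 * .var 14 - .var 12 * .var 13) * .var 16)) (by simp) (fun _ => rfl)
        (Solv.ret 18 [17] (by simp) fun a => ⟨rfl, fun σ hσ => Surely.pure ?_⟩)
      have h0 : σ 0 = combine (twoPow (A a.1.1.1.1.k).mask) a.1.1.2.1 a.1.2.1 a.2.1 := by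
        have := congrArg (fun l : List ℤ => l.getD 0 0) hσ
        exact this
      rw [h0]
      exact PairInput.isValue_combine a.1.1.1.1 a.1.1.1.2 a.1.1.2 a.1.2 a.2
    · refine Solv.eval 11 (.const 0) trivial (fun _ => rfl)
        (Solv.ret 12 [11] (by simp) fun a => ⟨rfl, fun σ hσ => Surely.pure ?_⟩)
      have h0 : σ 0 = 0 := by
        have := congrArg (fun l : List ℤ => l.getD 0 0) hσ
        exact this
      rw [h0]
      exact PairInput.isValue_zero a.1 a.2
    · intro a ha
      rw [h10] at ha
      exact ⟨⟨a, by by_contra h; simp [h] at ha⟩, rfl, rfl, fun μ hμ => hμ⟩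
    · intro a ha
      rw [h10] at ha
      exact ⟨⟨a, fun h => by simp [h] at ha⟩, rfl, rfl, fun μ hμ => hμ⟩
  · have h1 := bitLength_natCast_le (n (inst a.k))
    have h2 := (hq₁ (inst a.k)).trans (eval_nat_mono q₁ (Nat.le_add_right (n (inst a.k)) a.t))
    change bitLength (desc (inst a.k) : ℤ) ≤ _ at h2
    have h3 := (hq₂ a.k).trans (eval_nat_mono q₂ (Nat.le_add_right (n (inst a.k)) a.t))
    change bitLength (adesc a.k : ℤ) ≤ _ at h3
    have h4 := code_bits (x (inst a.k))
    have h5 := bitLength_natCast_le a.t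
    have h6 := code_bits a.y
    have h7 := code_bits a.z
    have h8 : bitLength (twoPow (A a.k).mask : ℤ) ≤ n (inst a.k) + 1 := by
      rw [bitLength_le_iff, Int.natAbs_natCast, pow_succ]
      have := twoPow_le (A a.k).mask
      have := Nat.two_pow_pos (n (inst a.k))
      omega
    simp only [PairInput.env, List.mem_cons, List.not_mem_nil, or_false, Polynomial.eval_X,
      Polynomial.eval_add, Polynomial.eval_one]
    rintro v (rfl | rfl | rfl | rfl | rfl | rfl | rfl | rfl) <;> omega

end observables

/-! ### Exponential moments of one sample -/

section observables

variable {ι κ : Type*} {n desc : ι → ℕ} {M : ∀ j, MState (n j)} {x : ∀ j, Bits (n j)}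
  {inst : κ → ι} {adesc : κ → ℕ} {A : ∀ k, LocalObservable (n (inst k))}

/-- Exponential of the deviation of `v / 2 ^ (3 * t)` from `m`. -/
noncomputable def expDev (l m : ℝ) (t : ℕ) (v : ℤ) : ℝ≥0∞ :=
  ENNReal.ofReal (Real.exp (l * ((v : ℝ) / 2 ^ (3 * t) - m)))

/-- Bound for the exponential moment of one sample; `B` bounds the size of the random variable. -/
noncomputable def momentBound (l B : ℝ) (t s : ℕ) : ℝ :=
  Real.exp (|l| * (7 * B / 2 ^ t)) * (1 + (|l| * (2 * B)) ^ 2 + 3 * (1 / 2) ^ s)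

theorem expDev_le_of_isValue {a : PairInput n inst} {v : ℤ} (h : a.IsValue M x A v) (l m : ℝ) :
    expDev l m a.t v ≤ ENNReal.ofReal (Real.exp (|l| * (7 * twoPow (A a.k).mask / 2 ^ a.t)) *
      Real.exp (l * ((A a.k).sampleValue (M (inst a.k)) (x (inst a.k)) a.y a.z - m))) := by
  unfold expDev
  refine ENNReal.ofReal_le_ofReal ?_
  rw [← Real.exp_add]
  refine Real.exp_le_exp.2 ?_
  have h1 := mul_le_mul_of_nonneg_left h (abs_nonneg l)
  rw [← abs_mul] at h1
  have h2 := (le_abs_self _).trans h1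
  linarith

/-- The registers from which a sample is computed: an instance, a precision `t` and a sampling error
parameter `s`. -/
def sampleEnv (n desc : ι → ℕ) (x : ∀ j, Bits (n j)) (adesc : κ → ℕ)
    (A : ∀ k, LocalObservable (n (inst k))) (a : κ × ℕ × ℕ) : List ℤ :=
  [(n (inst a.1) : ℤ), (desc (inst a.1) : ℤ), (adesc a.1 : ℤ), code (x (inst a.1)),
    code (A a.1).mask, (a.2.1 : ℤ), (a.2.2 : ℤ)]

/-- A random variable whose exponential moments are those required of a sample. -/
def IsSample (M : ∀ j, MState (n j)) (A : ∀ k, LocalObservable (n (inst k))) (a : κ × ℕ × ℕ)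
    (μ : PMF Mem) : Prop :=
  Surely (fun σ => |σ 0| ≤ 8 * 2 ^ n (inst a.1) * 2 ^ (3 * a.2.1)) μ ∧
    ∀ l : ℝ, |l| * (2 * twoPow (A a.1).mask) ≤ 1 →
      Ex μ (fun σ => expDev l ((A a.1).mean (M (inst a.1))) a.2.1 (σ 0)) ≤
        ENNReal.ofReal (momentBound l (twoPow (A a.1).mask) a.2.1 a.2.2)

/-- Allowing every larger `s` makes the bound reusable in the summation loop, whose size also counts
the samples. -/
theorem sampleEnv_bits (hdesc : PolyBounded (fun j => (desc j).size) n)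
    (hadesc : PolyBounded (fun k => (adesc k).size) (fun k => n (inst k))) :
    ∃ q : Polynomial ℕ, ∀ a, ∀ v ∈ sampleEnv n desc x adesc A a,
      ∀ s, n (inst a.1) + a.2.1 + a.2.2 ≤ s → bitLength v ≤ q.eval s := by
  obtain ⟨q₁, hq₁⟩ := hdesc
  obtain ⟨q₂, hq₂⟩ := hadesc
  refine ⟨q₁ + q₂ + Polynomial.X, fun a v hv s hs => ?_⟩
  have h1 := bitLength_natCast_le (n (inst a.1))
  have h2 := (hq₁ (inst a.1)).trans (eval_nat_mono q₁ (show n (inst a.1) ≤ s by omega))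
  change bitLength (desc (inst a.1) : ℤ) ≤ _ at h2
  have h3 := (hq₂ a.1).trans (eval_nat_mono q₂ (show n (inst a.1) ≤ s by omega))
  change bitLength (adesc a.1 : ℤ) ≤ _ at h3
  have h4 := code_bits (x (inst a.1))
  have h5 := code_bits (A a.1).mask
  have h6 := bitLength_natCast_le a.2.1
  have h7 := bitLength_natCast_le a.2.2
  simp only [sampleEnv, List.mem_cons, List.not_mem_nil, or_false] at hv
  simp only [Polynomial.eval_X, Polynomial.eval_add]
  rcases hv with rfl | rfl | rfl | rfl | rfl | rfl | rfl <;> omega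

/-- The moment is bounded backwards along the calls: given both strings there is only the rounding
error, averaging over the fresh bits gives `G`, and averaging `G` over the sampled string costs the
total variation error times a bound for `G`. Only the last step needs `l` to be small. -/
theorem efficient_sample
    (hdesc : PolyBounded (fun j => (desc j).size) n)
    (hadesc : PolyBounded (fun k => (adesc k).size) (fun k => n (inst k)))
    (hx : ∀ j, x j ∈ (M j).support)
    (err : ℕ → ℝ) (herr : ∀ s, err s ≤ (1 / 2) ^ s)
    (hb : EfficientlySolvable
      (fun a : ι × ℕ => [(n a.1 : ℤ), (desc a.1 : ℤ), code (x a.1), (a.2 : ℤ)])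
      (fun a => n a.1 + a.2)
      (fun a => SamplesWithin (uniformOn ((M a.1).orbit (x a.1))) (err a.2)))
    (hpair : EfficientlySolvable (PairInput.env desc x adesc A) (fun a => n (inst a.k) + a.t)
      (fun a => Surely fun σ => a.IsValue M x A (σ 0))) :
    EfficientlySolvable (sampleEnv n desc x adesc A) (fun a => n (inst a.1) + a.2.1 + a.2.2)
      (IsSample M A) := by
  obtain ⟨q, hq⟩ := sampleEnv_bits (x := x) (A := A) hdesc hadesc
  refine Solv.efficient ?_ q fun a v hv => hq a v hv _ le_rfl
  -- registers 7 and 8: `2` and `2 ^ n`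
  refine Solv.eval 7 (.const 2) trivial (fun _ => rfl) ?_
  refine Solv.callDet (env' := fun a => sampleEnv n desc x adesc A a ++ [2, 2 ^ n (inst a.1)])
    efficient_pow 8 1 [7, 0] (by simp) (Polynomial.X + 2) ?_ fun a =>
    ⟨rfl, ⟨2, n (inst a.1)⟩, rfl, ?_, fun μ hμ σ hσ => ?_⟩
  rotate_left
  · simp only [Polynomial.eval_add, Polynomial.eval_X, Polynomial.eval_ofNat]
    omega
  · simp [hμ σ hσ]
  -- register 9: a sample from the orbit
  let G (a : κ × ℕ × ℕ) (l : ℝ) (y : Bits (n (inst a.1))) : ℝ :=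
    Real.exp (|l| * (7 * twoPow (A a.1).mask / 2 ^ a.2.1)) * ((2 ^ n (inst a.1))⁻¹ *
      ∑ w, Real.exp (l * ((A a.1).sampleValue (M (inst a.1)) (x (inst a.1)) y
        (mixBits (A a.1).mask y w) - (A a.1).mean (M (inst a.1)))))
  refine Solv.call (γ := (κ × ℕ × ℕ) × ℤ) (size' := fun a => n (inst a.1.1) + a.1.2.1 + a.1.2.2)
    (env' := fun a => sampleEnv n desc x adesc A a.1 ++ [2, 2 ^ n (inst a.1.1), a.2])
    (good' := fun a μ =>
      Surely (fun σ => |σ 0| ≤ 8 * 2 ^ n (inst a.1.1) * 2 ^ (3 * a.1.2.1)) μ ∧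
      ∀ l : ℝ, Ex μ (fun σ => expDev l ((A a.1.1).mean (M (inst a.1.1))) a.1.2.1 (σ 0)) ≤
        ENNReal.ofReal (G a.1 l (ofCode _ a.2)))
    hb 9 1 [0, 1, 3, 6] (by simp) Polynomial.X ?_ fun a =>
    ⟨rfl, ⟨inst a.1, a.2.2⟩, rfl, ?_, fun μ hμ => ⟨fun σ hσ => ⟨a, σ 0⟩, fun σ hσ => ⟨rfl, rfl⟩,
      fun ν hν => ⟨Surely.bind fun σ hσ => (hν σ hσ).1, fun l hl => ?_⟩⟩⟩
  rotate_left
  · simp only [Polynomial.eval_X]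
    omega
  · rw [Ex_bind]
    refine (Ex_mono fun σ hσ => (hν σ hσ).2 l).trans ?_
    set c := Real.exp (|l| * (7 * twoPow (A a.1).mask / 2 ^ a.2.1)) with hc
    have h0 : ∀ y, 0 ≤ G a l y := fun y => mul_nonneg (Real.exp_pos _).le
      (mul_nonneg (by positivity) (Finset.sum_nonneg fun _ _ => (Real.exp_pos _).le))
    -- The exponents are at most `1` and `e < 3`; this is the `3` in `momentBound`.
    have hC : ∀ y, G a l y ≤ c * 3 := by
      intro y
      refine mul_le_mul_of_nonneg_left ?_ (Real.exp_pos _).le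
      rw [inv_mul_le_iff₀ (by positivity)]
      refine (Finset.sum_le_card_nsmul _ _ 3 fun w _ => ?_).trans (le_of_eq ?_)
      · have h2 := (A a.1).abs_sampleValue_le (M (inst a.1)) (x (inst a.1)) y
          (mixBits (A a.1).mask y w)
        have h3 := (A a.1).abs_mean_le (M (inst a.1))
        have h4 := (A a.1).one_le_twoPow_mask
        have h5 := abs_sub ((A a.1).sampleValue (M (inst a.1)) (x (inst a.1)) y
          (mixBits (A a.1).mask y w)) ((A a.1).mean (M (inst a.1)))
        have h6 : |l * ((A a.1).sampleValue (M (inst a.1)) (x (inst a.1)) y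
          (mixBits (A a.1).mask y w) - (A a.1).mean (M (inst a.1)))| ≤ 1 := by
          rw [abs_mul]
          exact (mul_le_mul_of_nonneg_left (by linarith) (abs_nonneg l)).trans hl
        refine (Real.exp_le_exp.2 ((le_abs_self _).trans h6)).trans ?_
        linarith [Real.exp_one_lt_d9]
      · simp
    refine (hμ.Ex_le (G a l) (c * 3) h0 hC).trans (ENNReal.ofReal_le_ofReal ?_)
    have h1 := (A a.1).sum_exp_sampleValue_le (M (inst a.1)) (hx (inst a.1)) l hl
    have h2 : ∑ y, uniformOn ((M (inst a.1)).orbit (x (inst a.1))) y * G a l y =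
        c * ∑ y, uniformOn ((M (inst a.1)).orbit (x (inst a.1))) y * ((2 ^ n (inst a.1))⁻¹ *
      ∑ w, Real.exp (l * ((A a.1).sampleValue (M (inst a.1)) (x (inst a.1)) y
        (mixBits (A a.1).mask y w) - (A a.1).mean (M (inst a.1))))) := by
      rw [Finset.mul_sum]
      exact Finset.sum_congr rfl fun y _ => by simp only [G, hc]; ring
    have hc0 : 0 < c := Real.exp_pos _
    have h3 := mul_le_mul_of_nonneg_left h1 hc0.le
    have h4 := mul_le_mul_of_nonneg_right (herr a.2.2) (show 0 ≤ c * 3 by positivity)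
    rw [h2, momentBound, ← hc]
    linarith
  -- registers 10 to 12: the sampled bit string, `0` and `1`
  let base (a : (κ × ℕ × ℕ) × ℤ) : List ℤ := sampleEnv n desc x adesc A a.1 ++
    [2, 2 ^ n (inst a.1.1), a.2, code (ofCode (n (inst a.1.1)) a.2), 0, 1]
  refine Solv.exp (env' := fun a => sampleEnv n desc x adesc A a.1 ++
    [2, 2 ^ n (inst a.1.1), a.2, code (ofCode (n (inst a.1.1)) a.2)]) ?_ 10
    (.var 9 - .var 8 * (.var 9 / .var 8)) (by simp) fun a => ⟨rfl, ?_⟩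
  swap
  · rw [code_ofCode, Int.emod_def]; rfl
  refine Solv.eval 11 (.const 0) trivial (fun _ => rfl) ?_
  refine Solv.exp (env' := base) ?_ 12 (.const 1) trivial fun a => ⟨rfl, rfl⟩
  -- registers 13 and 14: the second bit string and the number of its possible values
  refine Solv.call (γ := (a : (κ × ℕ × ℕ) × ℤ) × Bits (n (inst a.1.1)))
    (size' := fun a => n (inst a.1.1.1) + a.1.1.2.1 + a.1.1.2.2)
    (env' := fun a => base a.1 ++ [code a.2, (twoPow (A a.1.1.1).mask : ℤ)])
    (good' := fun a μ =>
      Surely (fun σ => |σ 0| ≤ 8 * 2 ^ n (inst a.1.1.1) * 2 ^ (3 * a.1.1.2.1)) μ ∧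
      ∀ l : ℝ, Ex μ (fun σ => expDev l ((A a.1.1.1).mean (M (inst a.1.1.1))) a.1.1.2.1 (σ 0)) ≤
        ENNReal.ofReal (Real.exp (|l| * (7 * twoPow (A a.1.1.1).mask / 2 ^ a.1.1.2.1)) *
          Real.exp (l * ((A a.1.1.1).sampleValue (M (inst a.1.1.1)) (x (inst a.1.1.1))
            (ofCode _ a.1.2) a.2 - (A a.1.1.1).mean (M (inst a.1.1.1))))))
    efficient_mix 13 2 [11, 12, 0, 4, 10, 12, 11] (by simp) Polynomial.X ?_ fun a =>
    ⟨rfl, ⟨n (inst a.1.1), (A a.1.1).mask, ofCode _ a.2⟩, rfl, ?_, fun μ hμ =>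
      ⟨fun σ hσ => ⟨a, ofCode _ (σ 0)⟩, fun σ hσ => ⟨?_, rfl⟩,
      fun ν hν => ⟨Surely.bind fun σ hσ => (hν σ hσ).1, fun l => ?_⟩⟩⟩
  rotate_left
  · simp only [Polynomial.eval_X]
    omega
  · have h1 : (σ 0, σ 1) ∈ (μ.map fun σ : Mem => (σ 0, σ 1)).support :=
      (PMF.mem_support_map_iff _ _ _).2 ⟨σ, hσ, rfl⟩
    rw [hμ] at h1
    obtain ⟨w, -, hw⟩ := (PMF.mem_support_map_iff _ _ _).1 h1
    have e0 : code (mixBits (A a.1.1).mask (ofCode _ a.2) w) = σ 0 := congrArg Prod.fst hw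
    have e1 : (twoPow (A a.1.1).mask : ℤ) = σ 1 := congrArg Prod.snd hw
    dsimp only
    rw [← e0, ofCode_code, e0, e1]
    rfl
  · rw [Ex_bind]
    refine (Ex_mono fun σ hσ => (hν σ hσ).2 l).trans ?_
    let H (z : Bits (n (inst a.1.1))) : ℝ :=
      Real.exp (|l| * (7 * twoPow (A a.1.1).mask / 2 ^ a.1.2.1)) *
          Real.exp (l * ((A a.1.1).sampleValue (M (inst a.1.1)) (x (inst a.1.1))
            (ofCode _ a.2) z - (A a.1.1).mean (M (inst a.1.1))))
    have e : Ex μ (fun σ => ENNReal.ofReal (H (ofCode _ (σ 0)))) =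
        Ex (μ.map fun σ : Mem => (σ 0, σ 1)) fun p => ENNReal.ofReal (H (ofCode _ p.1)) := by
      rw [Ex_map]; rfl
    refine (le_of_eq e).trans ?_
    rw [hμ, Ex_map]
    have e2 : ((fun p : ℤ × ℤ => ENNReal.ofReal (H (ofCode _ p.1))) ∘ fun w =>
        (code (mixBits (A a.1.1).mask (ofCode _ a.2) w), (twoPow (A a.1.1).mask : ℤ))) =
        fun w => ENNReal.ofReal (H (mixBits (A a.1.1).mask (ofCode _ a.2) w)) := by
      funext w
      simp only [Function.comp, ofCode_code]
    rw [e2, Ex_bits _ fun w => mul_nonneg (Real.exp_pos _).le (Real.exp_pos _).le]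
    refine ENNReal.ofReal_le_ofReal (le_of_eq ?_)
    simp only [G]
    rw [← Finset.mul_sum]
    ring
  -- register 15: the contribution of the two bit strings
  refine Solv.call (γ := (a : (a : (κ × ℕ × ℕ) × ℤ) × Bits (n (inst a.1.1))) ×
      {v : ℤ // PairInput.IsValue M x A ⟨a.1.1.1, a.1.1.2.1, ofCode _ a.1.2, a.2⟩ v})
    (size' := fun a => n (inst a.1.1.1.1) + a.1.1.1.2.1 + a.1.1.1.2.2)
    (env' := fun a => base a.1.1 ++ [code a.1.2, (twoPow (A a.1.1.1.1).mask : ℤ), a.2.1])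
    (good' := fun a => Surely fun σ => σ 0 = a.2.1)
    hpair 15 1 [0, 1, 2, 3, 5, 10, 13, 14] (by simp) Polynomial.X ?_ fun a =>
    ⟨rfl, ⟨a.1.1.1, a.1.1.2.1, ofCode _ a.1.2, a.2⟩, rfl, ?_, fun μ hμ =>
      ⟨fun σ hσ => ⟨a, σ 0, hμ σ hσ⟩, fun σ hσ => ⟨rfl, rfl⟩,
      fun ν hν => ⟨Surely.bind fun σ hσ σ' hσ' => ?_, fun l => ?_⟩⟩⟩
  rotate_left
  · simp only [Polynomial.eval_X]
    omega
  · have h1 := hν σ hσ σ' hσ'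
    simp only at h1
    rw [h1]
    exact (hμ σ hσ).abs_le
  · rw [Ex_bind]
    refine (Ex_mono (h := fun _ => _) fun σ hσ => (Ex_mono (h := fun _ => _) fun σ' hσ' => ?_).trans
      (le_of_eq (Ex_const _ _))).trans (le_of_eq (Ex_const _ _))
    have h1 := hν σ hσ σ' hσ'
    simp only at h1
    rw [h1]
    exact expDev_le_of_isValue (hμ σ hσ) l _
  exact Solv.ret 16 [15] (by simp) fun a => ⟨rfl, fun σ hσ => Surely.pure
    (congrArg (fun l : List ℤ => l.getD 0 0) hσ)⟩

end observables

/-! ### Sums of samples and the Chernoff bound -/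

section observables

variable {ι κ : Type*} {n desc : ι → ℕ} {M : ∀ j, MState (n j)} {x : ∀ j, Bits (n j)}
  {inst : κ → ι} {adesc : κ → ℕ} {A : ∀ k, LocalObservable (n (inst k))}

/-- States of the loop that adds up samples: `i` of `N` samples remain to be added. -/
structure SumState (n : ι → ℕ) (inst : κ → ι) where
  a : κ × ℕ × ℕ
  N : ℕ
  i : ℕ
  le : i ≤ N
  acc : ℤ
  acc_le : |acc| ≤ (N - i : ℕ) * (8 * 2 ^ n (inst a.1) * 2 ^ (3 * a.2.1))

/-- The registers that hold a `SumState`. -/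
def SumState.env (desc : ι → ℕ) (x : ∀ j, Bits (n j)) (adesc : κ → ℕ)
    (A : ∀ k, LocalObservable (n (inst k))) (a : SumState n inst) : List ℤ :=
  [a.acc, (a.i : ℤ)] ++ sampleEnv n desc x adesc A a.a

/-- Bounds for the exponential moments of the sum of samples. -/
def SumState.Good (M : ∀ j, MState (n j)) (A : ∀ k, LocalObservable (n (inst k)))
    (a : SumState n inst) (μ : PMF Mem) : Prop :=
  ∀ l : ℝ, |l| * (2 * twoPow (A a.a.1).mask) ≤ 1 →
    Ex μ (fun σ => expDev l (a.N * (A a.a.1).mean (M (inst a.a.1))) a.a.2.1 (σ 0)) ≤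
      ENNReal.ofReal (Real.exp (l * ((a.acc : ℝ) / 2 ^ (3 * a.a.2.1) -
        (a.N - a.i : ℕ) * (A a.a.1).mean (M (inst a.a.1)))) *
        momentBound l (twoPow (A a.a.1).mask) a.a.2.1 a.a.2.2 ^ a.i)

theorem momentBound_pos (l B : ℝ) (t s : ℕ) : 0 < momentBound l B t s := by
  unfold momentBound; positivity

theorem SumState.acc_bits (a : SumState n inst) :
    bitLength a.acc ≤ 3 * (n (inst a.a.1) + a.a.2.1 + a.a.2.2 + a.N) + 3 := by
  rw [bitLength_le_iff]
  have h1 : a.acc.natAbs ≤ a.N * (8 * 2 ^ n (inst a.a.1) * 2 ^ (3 * a.a.2.1)) := by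
    have h2 := a.acc_le
    rw [Int.abs_eq_natAbs] at h2
    have h3 : a.acc.natAbs ≤ (a.N - a.i) * (8 * 2 ^ n (inst a.a.1) * 2 ^ (3 * a.a.2.1)) := by
      exact_mod_cast h2
    exact h3.trans (Nat.mul_le_mul_right _ (by omega))
  have h4 : a.N < 2 ^ a.N := Nat.lt_two_pow_self
  calc a.acc.natAbs ≤ a.N * (8 * 2 ^ n (inst a.a.1) * 2 ^ (3 * a.a.2.1)) := h1
    _ < 2 ^ a.N * (8 * 2 ^ n (inst a.a.1) * 2 ^ (3 * a.a.2.1)) :=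
        Nat.mul_lt_mul_of_pos_right h4 (by positivity)
    _ = 2 ^ (a.N + (3 + n (inst a.a.1) + 3 * a.a.2.1)) := by
        rw [pow_add 2 a.N, pow_add 2 (3 + _), pow_add 2 3]; norm_num
    _ ≤ _ := Nat.pow_le_pow_right (by norm_num) (by omega)

/-- A supermartingale argument in place of independence: whatever the partial sum is, one more
sample multiplies the moment by at most `momentBound`. `SumState.Good` is formulated for an
arbitrary partial sum so that it can serve as loop invariant. -/
theorem efficient_sum
    (hdesc : PolyBounded (fun j => (desc j).size) n)
    (hadesc : PolyBounded (fun k => (adesc k).size) (fun k => n (inst k)))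
    (hsample : EfficientlySolvable (sampleEnv n desc x adesc A)
      (fun a => n (inst a.1) + a.2.1 + a.2.2) (IsSample M A)) :
    EfficientlySolvable (SumState.env desc x adesc A)
      (fun a => n (inst a.a.1) + a.a.2.1 + a.a.2.2 + a.N) (SumState.Good M A) := by
  obtain ⟨q, hq⟩ := sampleEnv_bits (x := x) (A := A) hdesc hadesc
  have hbits : ∀ a : SumState n inst, ∀ v ∈ a.env desc x adesc A,
      bitLength v ≤ (q + (3 * Polynomial.X + 3)).eval
        (n (inst a.a.1) + a.a.2.1 + a.a.2.2 + a.N) := by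
    intro a v hv
    have h1 := a.acc_bits
    have h2 := bitLength_natCast_le a.i
    have h3 := a.le
    rw [SumState.env, List.mem_append] at hv
    simp only [Polynomial.eval_add, Polynomial.eval_mul, Polynomial.eval_X, Polynomial.eval_ofNat]
    rcases hv with hv | hv
    · simp only [List.mem_cons, List.not_mem_nil, or_false] at hv
      rcases hv with rfl | rfl <;> omega
    · have := hq a.a v hv (n (inst a.a.1) + a.a.2.1 + a.a.2.2 + a.N) (by omega)
      omega
  let next (a : SumState n inst) (v : ℤ) : List ℤ :=
    [a.acc + v, (a.i : ℤ) - 1] ++ sampleEnv n desc x adesc A a.a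
  refine EfficientlySolvable.loop (i := 1) (goodb := fun a μ => ∃ (μ₁ : PMF Mem)
      (ν : Mem → PMF Mem), IsSample M A a.1.a μ₁ ∧ μ = μ₁.bind ν ∧
      ∀ σ ∈ μ₁.support, Surely (fun σ' => (List.range 9).map σ' = next a.1 (σ 0)) (ν σ))
    ?_ 9 (fun _ => rfl) _ Polynomial.X hbits SumState.i ?_ ?_ ?_
  · refine Solv.efficient ?_ _ fun a => hbits a.1
    refine Solv.call (γ := {a : SumState n inst // 0 < initMem (a.env desc x adesc A) 1} × ℤ)
      (size' := fun a => n (inst a.1.1.a.1) + a.1.1.a.2.1 + a.1.1.a.2.2 + a.1.1.N)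
      (env' := fun a => a.1.1.env desc x adesc A ++ [a.2])
      (good' := fun a => Surely fun σ' => (List.range 9).map σ' = next a.1.1 a.2)
      hsample 9 1 [2, 3, 4, 5, 6, 7, 8] (by simp) Polynomial.X ?_ fun a =>
      ⟨rfl, a.1.a, rfl, ?_, fun μ hμ => ⟨fun σ _ => (a, σ 0), fun σ hσ => ⟨rfl, rfl⟩,
        fun ν hν => ⟨μ, ν, hμ, rfl, hν⟩⟩⟩
    · exact Solv.eval 10 (.var 0 + .var 9) (by simp) (fun _ => rfl)
        (Solv.eval 11 (.var 1 - .const 1) (by simp) (fun _ => rfl)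
        (Solv.ret 12 [10, 11, 2, 3, 4, 5, 6, 7, 8] (by simp) fun a =>
          ⟨rfl, fun σ hσ => Surely.pure (hσ.trans (by rfl))⟩))
    · simp only [Polynomial.eval_X]
      omega
  · intro a
    rw [Polynomial.eval_X]
    have := a.le
    omega
  · intro a h l hl
    change (a.i : ℤ) ≤ 0 at h
    have h0 : a.i = 0 := by omega
    rw [Ex_pure, h0, pow_zero, mul_one, Nat.sub_zero]
    exact le_rfl
  · rintro ⟨⟨a, N, i, hi, acc, hacc⟩, h⟩ μ ⟨μ₁, ν₀, ⟨hs1, hs2⟩, rfl, hν₀⟩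
    change 0 < (i : ℤ) at h
    have hout : ∀ σ' ∈ (μ₁.bind ν₀).support, ∃ σ ∈ μ₁.support,
        (List.range 9).map σ' = [acc + σ 0, (i : ℤ) - 1] ++ sampleEnv n desc x adesc A a := by
      intro σ' hσ'
      obtain ⟨σ, hσ, h'⟩ := (PMF.mem_support_bind_iff _ _ _).1 hσ'
      exact ⟨σ, hσ, hν₀ σ hσ σ' h'⟩
    have hacc' : ∀ σ ∈ μ₁.support,
        |acc + σ 0| ≤ (N - (i - 1) : ℕ) * (8 * 2 ^ n (inst a.1) * 2 ^ (3 * a.2.1)) := by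
      intro σ hσ
      have e : N - (i - 1) = N - i + 1 := by omega
      rw [e]
      push_cast
      rw [add_mul, one_mul]
      exact (abs_add_le _ _).trans (add_le_add hacc (hs1 σ hσ))
    have h0 : ∀ {σ' : Mem} {v : ℤ}, (List.range 9).map σ' =
        [v, (i : ℤ) - 1] ++ sampleEnv n desc x adesc A a → σ' 0 = v := fun h' =>
      congrArg (fun l : List ℤ => l.getD 0 0) h'
    refine ⟨fun σ' hσ' => ⟨a, N, i - 1, by omega, σ' 0, ?_⟩, fun σ' hσ' => ⟨?_, rfl, ?_⟩,
      fun ν hν l hl => ?_⟩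
    · obtain ⟨σ, hσ, h'⟩ := hout σ' hσ'
      rw [h0 h']
      exact hacc' σ hσ
    · obtain ⟨σ, hσ, h'⟩ := hout σ' hσ'
      rw [h', SumState.env]
      dsimp only
      rw [h0 h']
      push_cast [show 1 ≤ i by omega]
      rfl
    · dsimp only
      omega
    · dsimp only at hl ⊢
      set m := (A a.1).mean (M (inst a.1)) with hm
      set c := momentBound l (twoPow (A a.1).mask) a.2.1 a.2.2 with hc
      have hc0 : 0 < c := momentBound_pos _ _ _ _
      set E := Real.exp (l * ((acc : ℝ) / 2 ^ (3 * a.2.1) - (N - i : ℕ) * m)) with hE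
      rw [PMF.bind_bind, Ex_bind]
      -- The exponential of the new partial sum splits into that of the old one and the factor
      -- `expDev` of the new sample.
      have step : ∀ σ ∈ μ₁.support,
          Ex ((ν₀ σ).bind ν) (fun σ => expDev l (N * m) a.2.1 (σ 0)) ≤
            ENNReal.ofReal (E * c ^ (i - 1)) * expDev l m a.2.1 (σ 0) := by
        intro σ hσ
        rw [Ex_bind]
        refine (Ex_mono (h := fun _ => _) fun σ' hσ' => ?_).trans (le_of_eq (Ex_const _ _))
        have hb : σ' ∈ (μ₁.bind ν₀).support := (PMF.mem_support_bind_iff _ _ _).2 ⟨σ, hσ, hσ'⟩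
        refine (hν σ' hb l hl).trans ?_
        dsimp only
        rw [h0 (hν₀ σ hσ σ' hσ'), expDev, ← ENNReal.ofReal_mul (by positivity)]
        refine ENNReal.ofReal_le_ofReal (le_of_eq ?_)
        rw [mul_right_comm, hE, ← Real.exp_add, show N - (i - 1) = N - i + 1 by omega]
        congr 2
        push_cast
        ring
      refine (Ex_mono step).trans ?_
      rw [Ex_const_mul]
      refine (mul_le_mul_right (hs2 l hl) _).trans ?_
      rw [← ENNReal.ofReal_mul (by positivity)]
      refine ENNReal.ofReal_le_ofReal (le_of_eq ?_)
      rw [mul_assoc, ← hc, ← pow_succ, Nat.sub_add_cancel (by omega)]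

/-- Rounding, variance and sampling error each get the share `|l| / (4 T)` of the exponent. For the
variance, `(2 |l| B)² = |l| / (4 T)` is what fixes `|l|`. The other two need `28 B T ≤ 2 ^ t` and
`192 B² T² ≤ 2 ^ s`, which follow from `k ≤ 2 ^ k`. -/
theorem momentBound_le {B T l b : ℝ} {t s : ℕ} (hB : 1 ≤ B) (hT : 1 ≤ T) (hb0 : 0 ≤ b)
    (hb : b ≤ B) (hl : |l| = 1 / (16 * B ^ 2 * T)) (ht : 28 * B * T ≤ t)
    (hs : 192 * B ^ 2 * T ^ 2 ≤ s) :
    momentBound l b t s ≤ Real.exp (|l| * (3 / (4 * T))) := by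
  have hl0 := abs_nonneg l
  have h2 : ∀ k : ℕ, (k : ℝ) ≤ 2 ^ k := fun k => by exact_mod_cast Nat.lt_two_pow_self.le
  have h3 : 7 * b / 2 ^ t ≤ 1 / (4 * T) := by
    rw [div_le_div_iff₀ (by positivity) (by positivity)]
    have := ht.trans (h2 t)
    nlinarith [mul_le_mul_of_nonneg_right hb (show (0 : ℝ) ≤ 28 * T by positivity)]
  have h4 : (|l| * (2 * b)) ^ 2 ≤ |l| * (1 / (4 * T)) := by
    have h5 : (|l| * (2 * b)) ^ 2 ≤ (|l| * (2 * B)) ^ 2 := by gcongr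
    refine h5.trans (le_of_eq ?_)
    rw [hl]
    field_simp
    ring
  have h6 : 3 * (1 / 2 : ℝ) ^ s ≤ |l| * (1 / (4 * T)) := by
    have h7 : (192 * B ^ 2 * T ^ 2) ≤ 2 ^ s := hs.trans (h2 s)
    rw [hl, one_div, inv_pow, div_mul_div_comm, ← div_eq_mul_inv,
      div_le_div_iff₀ (by positivity) (by positivity)]
    nlinarith
  unfold momentBound
  have h8 : 1 + (|l| * (2 * b)) ^ 2 + 3 * (1 / 2) ^ s ≤ Real.exp (|l| * (2 / (4 * T))) := by
    refine le_trans ?_ (Real.add_one_le_exp _)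
    have : |l| * (2 / (4 * T)) = |l| * (1 / (4 * T)) + |l| * (1 / (4 * T)) := by ring
    linarith
  calc Real.exp (|l| * (7 * b / 2 ^ t)) * (1 + (|l| * (2 * b)) ^ 2 + 3 * (1 / 2) ^ s)
      ≤ Real.exp (|l| * (1 / (4 * T))) * Real.exp (|l| * (2 / (4 * T))) := by gcongr
    _ = _ := by rw [← Real.exp_add]; congr 1; ring

/-- The sum of sufficiently many samples is close to its mean value with high probability. -/
theorem SumState.Good.prob_le {a : SumState n inst} {μ : PMF Mem} (h : a.Good M A μ)
    (hi : a.i = a.N) (hacc : a.acc = 0) {B T s : ℕ} (hB : twoPow (A a.a.1).mask ≤ B) (hT : 1 ≤ T)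
    (ht : a.a.2.1 = 28 * B * T) (hs : a.a.2.2 = 192 * B * B * T * T)
    (hN : a.N = 64 * B * B * T * T * (s + 1)) :
    probOf μ (fun σ => (a.N : ℝ) / T <
      |(σ 0 : ℝ) / 2 ^ (3 * a.a.2.1) - a.N * (A a.a.1).mean (M (inst a.a.1))|) ≤ (1 / 2) ^ s := by
  have hb1 := (A a.a.1).one_le_twoPow_mask
  have hbB : (twoPow (A a.a.1).mask : ℝ) ≤ B := by exact_mod_cast hB
  have hB1 : (1 : ℝ) ≤ B := hb1.trans hbB
  have hT1 : (1 : ℝ) ≤ T := by exact_mod_cast hT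
  set L : ℝ := 1 / (16 * B ^ 2 * T) with hL
  have hL0 : 0 < L := by positivity
  set m := (A a.a.1).mean (M (inst a.a.1)) with hm
  have hEx : ∀ l, |l| = L → Ex μ (fun σ => expDev l (a.N * m) a.a.2.1 (σ 0)) ≤
      ENNReal.ofReal (Real.exp (L * (3 / (4 * T)) * a.N)) := by
    intro l hl
    have h1 : |l| * (2 * twoPow (A a.a.1).mask) ≤ 1 := by
      rw [hl, hL, div_mul_eq_mul_div, one_mul, div_le_one (by positivity)]
      nlinarith [mul_le_mul_of_nonneg_left hT1 (show (0 : ℝ) ≤ 16 * B ^ 2 by positivity)]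
    refine (h l h1).trans (ENNReal.ofReal_le_ofReal ?_)
    rw [hi, hacc, Nat.sub_self]
    simp only [Int.cast_zero, zero_div, Nat.cast_zero, zero_mul, sub_zero, mul_zero, Real.exp_zero,
      one_mul]
    have h2 := momentBound_le (b := twoPow (A a.a.1).mask) (t := a.a.2.1) (s := a.a.2.2) hB1 hT1
      (by positivity) hbB hl (by rw [ht]; push_cast; rfl)
      (by rw [hs]; push_cast; exact le_of_eq (by ring))
    refine (pow_le_pow_left₀ (momentBound_pos _ _ _ _).le h2 _).trans (le_of_eq ?_)
    rw [← Real.exp_nat_mul, hl]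
    congr 1
    ring
  -- The sum of the exponentials for `l = L` and `l = -L` controls both tails.
  have hbound : Ex μ (fun σ => ENNReal.ofReal (Real.exp (-(L * (a.N / T)))) *
      (expDev L (a.N * m) a.a.2.1 (σ 0) + expDev (-L) (a.N * m) a.a.2.1 (σ 0))) ≤
      ENNReal.ofReal ((1 / 2) ^ s) := by
    rw [Ex_const_mul, Ex_add]
    refine (mul_le_mul_right (add_le_add (hEx L (abs_of_pos hL0))
      (hEx (-L) (by rw [abs_neg, abs_of_pos hL0]))) _).trans ?_
    rw [← ENNReal.ofReal_add (by positivity) (by positivity), ← ENNReal.ofReal_mul (by positivity)]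
    refine ENNReal.ofReal_le_ofReal ?_
    -- The exponents add up to `-L N / (4 T)`, and `N` is chosen to make this `-(s + 1)`. The extra
    -- `1`, with `e ≥ 2`, pays for the two tails.
    have e1 : Real.exp (-(L * (a.N / T))) * (Real.exp (L * (3 / (4 * T)) * a.N) +
        Real.exp (L * (3 / (4 * T)) * a.N)) = 2 * Real.exp (-1) ^ (s + 1) := by
      rw [← two_mul, mul_left_comm, ← Real.exp_add, ← Real.exp_nat_mul]
      congr 2
      rw [hL, hN]
      push_cast
      field_simp
      ring
    rw [e1]
    have e2 : Real.exp (-1) ≤ 1 / 2 := by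
      rw [Real.exp_neg, one_div]
      exact inv_anti₀ (by norm_num) (by linarith [Real.add_one_le_exp 1])
    have e3 := pow_le_pow_left₀ (Real.exp_pos _).le e2 (s + 1)
    rw [pow_succ (1 / 2 : ℝ)] at e3
    linarith
  refine probOf_le (by positivity) (fun σ _ hσ => ?_) hbound
  unfold expDev
  rw [← ENNReal.ofReal_add (by positivity) (by positivity), ← ENNReal.ofReal_mul (by positivity),
    ← ENNReal.ofReal_one]
  refine ENNReal.ofReal_le_ofReal ?_
  rw [mul_add, ← Real.exp_add, ← Real.exp_add]
  have p1 := Real.exp_pos (-(L * (a.N / T)) + L * ((σ 0 : ℝ) / 2 ^ (3 * a.a.2.1) - a.N * m))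
  have p2 := Real.exp_pos (-(L * (a.N / T)) + -L * ((σ 0 : ℝ) / 2 ^ (3 * a.a.2.1) - a.N * m))
  rcases lt_abs.1 hσ with h' | h'
  · have := mul_lt_mul_of_pos_left h' hL0
    have := Real.one_le_exp (x := -(L * (a.N / T)) +
      L * ((σ 0 : ℝ) / 2 ^ (3 * a.a.2.1) - a.N * m)) (by linarith)
    linarith
  · have := mul_lt_mul_of_pos_left h' hL0
    have := Real.one_le_exp (x := -(L * (a.N / T)) +
      -L * ((σ 0 : ℝ) / 2 ^ (3 * a.a.2.1) - a.N * m)) (by linarith)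
    linarith

/-- Gives a polynomial bound for `2^k` that the program computes as a power with constant exponent
`C`; the summand `2` covers `n = 0`. -/
theorem LocalObservable.twoPow_mask_le {n C : ℕ} (A : LocalObservable n)
    (h : A.sites.card ≤ C * (Nat.log 2 n + 1)) : twoPow A.mask ≤ (2 * n + 2) ^ C := by
  rw [A.twoPow_mask]
  calc 2 ^ A.sites.card ≤ 2 ^ (C * (Nat.log 2 n + 1)) := Nat.pow_le_pow_right (by norm_num) h
    _ = (2 ^ (Nat.log 2 n + 1)) ^ C := by rw [← pow_mul, mul_comm]
    _ ≤ _ := by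
      refine Nat.pow_le_pow_left ?_ C
      rw [pow_succ]
      rcases Nat.eq_zero_or_pos n with rfl | hn
      · simp
      · have := Nat.pow_log_le_self 2 hn.ne'
        omega

/-- Since the number of sites is logarithmic, the precision, the sampling parameter and the number
of samples demanded by `SumState.Good.prob_le` are polynomial in `n`, `T` and `s`. The estimate is
returned as the fraction of the integer sum and `N * 2 ^ (3 * t)`. -/
theorem efficient_estimate
    (hdesc : PolyBounded (fun j => (desc j).size) n)
    (ha : EfficientlySolvable (fun j => [(n j : ℤ), (desc j : ℤ)]) (fun j => n j)
      (fun j => Surely fun σ => σ 0 = code (x j)))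
    (hA : EfficientlyDescribedObservables n desc inst adesc A)
    (hsum : EfficientlySolvable (SumState.env desc x adesc A)
      (fun a => n (inst a.a.1) + a.a.2.1 + a.a.2.2 + a.N) (SumState.Good M A)) :
    EfficientlySolvable
      (fun a : κ × ℕ+ × ℕ => [(n (inst a.1) : ℤ), (desc (inst a.1) : ℤ), (adesc a.1 : ℤ),
        ((a.2.1 : ℕ) : ℤ), (a.2.2 : ℤ)])
      (fun a => n (inst a.1) + (a.2.1 : ℕ) + a.2.2)
      (fun a μ => probOf μ (fun σ => ¬ (0 < σ 1 ∧
          ‖(σ 0 : ℂ) / (σ 1 : ℂ) - inner ℂ (M (inst a.1)).ψ ((A a.1).op (M (inst a.1)).ψ)‖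
            ≤ 1 / ((a.2.1 : ℕ) : ℝ)))
        ≤ (1 / 2) ^ a.2.2) := by
  obtain ⟨C, hC⟩ := hA.locality
  obtain ⟨q₁, hq₁⟩ := hdesc
  obtain ⟨q₂, hq₂⟩ := hA.desc_size
  let B (a : κ × ℕ+ × ℕ) : ℕ := (2 * n (inst a.1) + 2) ^ C
  let t (a : κ × ℕ+ × ℕ) : ℕ := 28 * B a * a.2.1
  let s (a : κ × ℕ+ × ℕ) : ℕ := 192 * B a * B a * a.2.1 * a.2.1
  let N (a : κ × ℕ+ × ℕ) : ℕ := 64 * B a * B a * a.2.1 * a.2.1 * (a.2.2 + 1)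
  let env₇ (a : κ × ℕ+ × ℕ) : List ℤ := [(n (inst a.1) : ℤ), (desc (inst a.1) : ℤ),
    (adesc a.1 : ℤ), ((a.2.1 : ℕ) : ℤ), (a.2.2 : ℤ), code (x (inst a.1)), code (A a.1).mask]
  refine Solv.efficient ?_ (q₁ + q₂ + Polynomial.X) fun a => ?_
  swap
  · have h1 := bitLength_natCast_le (n (inst a.1))
    have h2 := (hq₁ (inst a.1)).trans (eval_nat_mono q₁
      (show n (inst a.1) ≤ n (inst a.1) + (a.2.1 : ℕ) + a.2.2 by omega))
    change bitLength (desc (inst a.1) : ℤ) ≤ _ at h2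
    have h3 := (hq₂ a.1).trans (eval_nat_mono q₂
      (show n (inst a.1) ≤ n (inst a.1) + (a.2.1 : ℕ) + a.2.2 by omega))
    change bitLength (adesc a.1 : ℤ) ≤ _ at h3
    have h4 := bitLength_natCast_le (a.2.1 : ℕ)
    have h5 := bitLength_natCast_le a.2.2
    simp only [List.mem_cons, List.not_mem_nil, or_false, Polynomial.eval_X, Polynomial.eval_add]
    rintro v (rfl | rfl | rfl | rfl | rfl) <;> omega
  refine Solv.callDet (env' := fun a => [(n (inst a.1) : ℤ), (desc (inst a.1) : ℤ),
    (adesc a.1 : ℤ), ((a.2.1 : ℕ) : ℤ), (a.2.2 : ℤ), code (x (inst a.1))]) ha 5 1 [0, 1] (by simp)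
    Polynomial.X ?_ fun a => ⟨rfl, inst a.1, rfl, by rw [Polynomial.eval_X]; omega,
      fun μ hμ σ hσ => by simp [hμ σ hσ]⟩
  refine Solv.callDet (env' := env₇) hA.sites 6 1 [0, 1, 2] (by simp)
    Polynomial.X ?_ fun a => ⟨rfl, a.1, rfl, by rw [Polynomial.eval_X]; omega,
      fun μ hμ σ hσ => by simp [hμ σ hσ, env₇]; rfl⟩
  -- register 9: the bound `B`
  refine Solv.eval 7 (.const C) trivial (fun _ => rfl) ?_
  refine Solv.exp (env' := fun a => env₇ a ++ [(C : ℤ), ((2 * n (inst a.1) + 2 : ℕ) : ℤ)]) ?_ 8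
    (.const 2 * .var 0 + .const 2) (by simp) fun a => ⟨rfl, by push_cast; rfl⟩
  refine Solv.callDet (env' := fun a => env₇ a ++ [(C : ℤ), ((2 * n (inst a.1) + 2 : ℕ) : ℤ),
    (B a : ℤ)]) efficient_pow 9 1 [8, 7] (by simp) (2 * Polynomial.X + (2 + .C C)) ?_ fun a =>
    ⟨rfl, ⟨2 * n (inst a.1) + 2, C⟩, rfl, ?_, fun μ hμ σ hσ => by simp [hμ σ hσ, B]⟩
  swap
  · simp only [Polynomial.eval_add, Polynomial.eval_mul, Polynomial.eval_X, Polynomial.eval_ofNat,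
      Polynomial.eval_C]
    omega
  -- registers 10 to 12: precision, sampling error parameter and number of samples
  let env₁₀ (a : κ × ℕ+ × ℕ) : List ℤ := env₇ a ++ [(C : ℤ), ((2 * n (inst a.1) + 2 : ℕ) : ℤ),
    (B a : ℤ)]
  have ht : ∀ a, (t a : ℤ) = 28 * B a * (a.2.1 : ℕ) := fun a => by simp only [t]; push_cast; rfl
  have hs : ∀ a, (s a : ℤ) = 192 * B a * B a * (a.2.1 : ℕ) * (a.2.1 : ℕ) := fun a => by
    simp only [s]; push_cast; rfl
  have hN : ∀ a, (N a : ℤ) = 64 * B a * B a * (a.2.1 : ℕ) * (a.2.1 : ℕ) * (a.2.2 + 1) := fun a => by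
    simp only [N]; push_cast; rfl
  refine Solv.exp (env' := fun a => env₁₀ a ++ [(t a : ℤ)]) ?_ 10 (.const 28 * .var 9 * .var 3)
    (by simp) fun a => ⟨rfl, by rw [ht]; rfl⟩
  refine Solv.exp (env' := fun a => env₁₀ a ++ [(t a : ℤ), (s a : ℤ)]) ?_ 11
    (.const 192 * .var 9 * .var 9 * .var 3 * .var 3) (by simp) fun a => ⟨rfl, by rw [hs]; rfl⟩
  refine Solv.exp (env' := fun a => env₁₀ a ++ [(t a : ℤ), (s a : ℤ), (N a : ℤ)]) ?_ 12
    (.const 64 * .var 9 * .var 9 * .var 3 * .var 3 * (.var 4 + .const 1)) (by simp)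
    fun a => ⟨rfl, by rw [hN]; rfl⟩
  -- registers 13 to 17: `0`, `2`, `3 * t`, `2 ^ (3 * t)` and the denominator
  refine Solv.eval 13 (.const 0) trivial (fun _ => rfl) ?_
  refine Solv.eval 14 (.const 2) trivial (fun _ => rfl) ?_
  let env₁₃ (a : κ × ℕ+ × ℕ) : List ℤ := env₁₀ a ++ [(t a : ℤ), (s a : ℤ), (N a : ℤ)]
  have h3t : ∀ a, ((3 * t a : ℕ) : ℤ) = 3 * t a := fun a => by push_cast; rfl
  refine Solv.exp (env' := fun a => env₁₃ a ++ [0, 2, ((3 * t a : ℕ) : ℤ)]) ?_ 15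
    (.const 3 * .var 10) (by simp) fun a => ⟨rfl, by rw [h3t]; rfl⟩
  -- The exponent `3 * t = 84 * B * T` has to be polynomially bounded itself, as `efficient_pow`
  -- takes time polynomial in its value.
  refine Solv.callDet (env' := fun a => env₁₃ a ++ [0, 2, ((3 * t a : ℕ) : ℤ),
    ((2 ^ (3 * t a) : ℕ) : ℤ)]) efficient_pow 16 1 [14, 15] (by simp)
    (2 + 84 * (2 * Polynomial.X + 2) ^ C * Polynomial.X) ?_ fun a =>
    ⟨rfl, ⟨2, 3 * t a⟩, rfl, ?_, fun μ hμ σ hσ => by simp [hμ σ hσ]⟩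
  swap
  · simp only [Polynomial.eval_add, Polynomial.eval_mul, Polynomial.eval_X, Polynomial.eval_ofNat,
      Polynomial.eval_pow, t, B]
    rw [show 84 = 3 * 28 by norm_num, mul_assoc 3 28, mul_assoc 3]
    gcongr <;> omega
  have hden : ∀ a, ((N a * 2 ^ (3 * t a) : ℕ) : ℤ) = N a * (2 ^ (3 * t a) : ℕ) := fun a => by
    push_cast; rfl
  let env₁₈ (a : κ × ℕ+ × ℕ) : List ℤ := env₁₃ a ++ [0, 2, ((3 * t a : ℕ) : ℤ),
    ((2 ^ (3 * t a) : ℕ) : ℤ), ((N a * 2 ^ (3 * t a) : ℕ) : ℤ)]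
  refine Solv.exp (env' := env₁₈) ?_ 17 (.var 12 * .var 16) (by simp)
    fun a => ⟨rfl, by simp only [env₁₈]; rw [hden]; rfl⟩
  -- register 18: the sum of the samples
  let BP : Polynomial ℕ := (2 * Polynomial.X + 2) ^ C
  refine Solv.call (γ := (κ × ℕ+ × ℕ) × ℤ)
    (size' := fun a => n (inst a.1.1) + (a.1.2.1 : ℕ) + a.1.2.2)
    (env' := fun a => env₁₈ a.1 ++ [a.2])
    (good' := fun a => Surely fun σ => σ 0 = a.2 ∧ σ 1 = ((N a.1 * 2 ^ (3 * t a.1) : ℕ) : ℤ))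
    hsum 18 1 [13, 12, 0, 1, 2, 5, 6, 10, 11] (by simp)
    (Polynomial.X + 28 * BP * Polynomial.X + 192 * BP * BP * Polynomial.X * Polynomial.X +
      64 * BP * BP * Polynomial.X * Polynomial.X * (Polynomial.X + 1)) ?_ fun a =>
    ⟨rfl, ⟨(a.1, t a, s a), N a, N a, le_rfl, 0, by simp⟩, rfl, ?_, fun μ hμ =>
      ⟨fun σ hσ => (a, σ 0), fun σ hσ => ⟨rfl, rfl⟩, fun ν hν => ?_⟩⟩
  · refine Solv.ret 19 [18, 17] (by simp) fun a => ⟨rfl, fun σ hσ => Surely.pure ⟨?_, ?_⟩⟩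
    · exact congrArg (fun l : List ℤ => l.getD 0 0) hσ
    · exact congrArg (fun l : List ℤ => l.getD 1 0) hσ
  · have hBP : B a ≤ BP.eval (n (inst a.1) + (a.2.1 : ℕ) + a.2.2) := by
      simp only [BP, B, Polynomial.eval_add, Polynomial.eval_mul, Polynomial.eval_X,
        Polynomial.eval_ofNat, Polynomial.eval_pow]
      gcongr
      omega
    have hT : (a.2.1 : ℕ) ≤ n (inst a.1) + (a.2.1 : ℕ) + a.2.2 := by omega
    have hs' : a.2.2 ≤ n (inst a.1) + (a.2.1 : ℕ) + a.2.2 := by omega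
    have hn : n (inst a.1) ≤ n (inst a.1) + (a.2.1 : ℕ) + a.2.2 := by omega
    simp only [Polynomial.eval_add, Polynomial.eval_mul, Polynomial.eval_X, Polynomial.eval_ofNat,
      Polynomial.eval_one, t, s, N]
    generalize BP.eval (n (inst a.1) + (a.2.1 : ℕ) + a.2.2) = b at hBP ⊢
    generalize n (inst a.1) + (a.2.1 : ℕ) + a.2.2 = z at hT hs' hn ⊢
    gcongr
  · have hT : 1 ≤ (a.2.1 : ℕ) := a.2.1.pos
    have hp := hμ.prob_le rfl rfl ((A a.1).twoPow_mask_le (hC a.1)) hT rfl rfl rfl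
    -- The quotient misses the mean by more than `1 / T` exactly when the rescaled sum misses `N`
    -- times the mean by more than `N / T`.
    refine le_of_eq_of_le (probOf_bind fun σ hσ σ' hσ' => ?_) hp
    obtain ⟨e0, e1⟩ := hν σ hσ σ' hσ'
    have hB0 : 0 < B a := by simp only [B]; positivity
    have hN0 : 0 < N a := by
      simp only [N]
      have := a.2.1.pos
      positivity
    have hT0 : (0 : ℝ) < ((a.2.1 : ℕ) : ℝ) := by exact_mod_cast a.2.1.pos
    have hN0' : (0 : ℝ) < N a := by exact_mod_cast hN0
    have hpos : 0 < σ' 1 := by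
      rw [e1]
      exact_mod_cast (by positivity : 0 < N a * 2 ^ (3 * t a))
    have e2 : ((σ' 0 : ℂ) / (σ' 1 : ℂ) - inner ℂ (M (inst a.1)).ψ ((A a.1).op (M (inst a.1)).ψ)) =
        (((σ 0 : ℝ) / (N a * 2 ^ (3 * t a)) - (A a.1).mean (M (inst a.1)) : ℝ) : ℂ) := by
      rw [(A a.1).inner_eq_mean, e0, e1]
      push_cast
      rfl
    have e3 : (σ 0 : ℝ) / (N a * 2 ^ (3 * t a)) - (A a.1).mean (M (inst a.1)) =
        ((σ 0 : ℝ) / 2 ^ (3 * t a) - N a * (A a.1).mean (M (inst a.1))) / N a := by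
      field_simp
    rw [and_iff_right hpos, e2, Complex.norm_real, Real.norm_eq_abs, not_le, e3, abs_div,
      abs_of_pos hN0', div_lt_div_iff₀ hT0 hN0', div_lt_iff₀ hT0, one_mul]

end observables

/-! ### The simulation theorem -/

open Classical in
theorem theorem4 {ι : Type*}
    -- a family of efficiently described M-states: instance `j` has `n j` qubits
    (n desc : ι → ℕ) (M : ∀ j, MState (n j)) (hM : EfficientlyDescribed n desc M)
    -- (a) a basis state `x j` with `ψ ∝ ψ_x` can be determined efficiently
    (x : ∀ j, Bits (n j)) (hx : ∀ j, (M j).IsOrbitStateOf (x j))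
    (ha : EfficientlySolvable
      (fun j => [(n j : ℤ), (desc j : ℤ)])
      (fun j => n j)
      (fun j => Surely fun σ => σ 0 = code (x j)))
    -- (b) the uniform distribution on `𝒪_x` can be sampled efficiently, exactly (`err = 0`) or
    -- up to an exponentially small error in total variation distance
    (err : ℕ → ℝ) (herr : ∀ s, err s ≤ (1 / 2) ^ s)
    (hb : EfficientlySolvable
      (fun a : ι × ℕ => [(n a.1 : ℤ), (desc a.1 : ℤ), code (x a.1), (a.2 : ℤ)])
      (fun a => n a.1 + a.2)
      (fun a => SamplesWithin (uniformOn ((M a.1).orbit (x a.1))) (err a.2)))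
    -- (c) membership in `𝒪_x` can be decided efficiently
    (hc : EfficientlySolvable
      (fun a : (j : ι) × Bits (n j) => [(n a.1 : ℤ), (desc a.1 : ℤ), code (x a.1), code a.2])
      (fun a => n a.1)
      (fun a => Surely fun σ => σ 0 = if a.2 ∈ (M a.1).orbit (x a.1) then 1 else 0))
    -- (d) for `y ∈ 𝒪_x`, the phase `ξ_x(y)` can be computed efficiently, to `t` bits
    (hd : EfficientlySolvable
      (fun a : (j : ι) × ((M j).orbit (x j) × ℕ) =>
        [(n a.1 : ℤ), (desc a.1 : ℤ), code (x a.1), code (a.2.1 : Bits (n a.1)), (a.2.2 : ℤ)])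
      (fun a => n a.1 + a.2.2)
      (fun a => Surely (HoldsApprox a.2.2 ((M a.1).xi (x a.1) a.2.1)))) :
    -- the distribution `|⟨y|ψ⟩|²` can be sampled efficiently, with the same error
    EfficientlySolvable
      (fun a : ι × ℕ => [(n a.1 : ℤ), (desc a.1 : ℤ), (a.2 : ℤ)])
      (fun a => n a.1 + a.2)
      (fun a => SamplesWithin (M a.1).basisDistribution (err a.2)) ∧
    -- for all efficiently described `O(log n)`-local observables `A` with `‖A‖ ≤ 1`, a rational
    -- estimate of `⟨ψ|A|ψ⟩` to accuracy `1 / T`, with failure probability at most `2 ^ (-s)`, can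
    -- be computed in time polynomial in `n`, `T` and `s`
    ∀ {κ : Type*} (inst : κ → ι) (adesc : κ → ℕ) (A : ∀ k, LocalObservable (n (inst k))),
      EfficientlyDescribedObservables n desc inst adesc A →
      EfficientlySolvable
        (fun a : κ × ℕ+ × ℕ => [(n (inst a.1) : ℤ), (desc (inst a.1) : ℤ), (adesc a.1 : ℤ),
          ((a.2.1 : ℕ) : ℤ), (a.2.2 : ℤ)])
        (fun a => n (inst a.1) + (a.2.1 : ℕ) + a.2.2)
        (fun a μ => probOf μ (fun σ => ¬ (0 < σ 1 ∧
            ‖(σ 0 : ℂ) / (σ 1 : ℂ) - inner ℂ (M (inst a.1)).ψ ((A a.1).op (M (inst a.1)).ψ)‖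
              ≤ 1 / ((a.2.1 : ℕ) : ℝ)))
          ≤ (1 / 2) ^ a.2.2) := by
  have hsupp : ∀ j, x j ∈ (M j).support := fun j => (hx j).1
  have hb' : EfficientlySolvable
      (fun a : ι × ℕ => [(n a.1 : ℤ), (desc a.1 : ℤ), code (x a.1), (a.2 : ℤ)])
      (fun a => n a.1 + a.2)
      (fun a => SamplesWithin (M a.1).basisDistribution (err a.2)) := by
    refine hb.reindex Polynomial.X fun a => ⟨a, rfl, by simp, fun μ hμ => ?_⟩
    rwa [(M a.1).basisDistribution_eq (hsupp a.1)]
  refine ⟨efficient_sampling n desc hM.desc_size x ha err (fun j => (M j).basisDistribution) hb',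
    fun {κ} inst adesc A hA => ?_⟩
  have h₁ := efficient_pair (M := M) (A := A) hM.desc_size hA.desc_size hc hd hA.entry
  have h₂ := efficient_sample (M := M) (A := A) hM.desc_size hA.desc_size hsupp err herr hb h₁
  have h₃ := efficient_sum (M := M) (A := A) hM.desc_size hA.desc_size h₂
  exact efficient_estimate (M := M) (A := A) hM.desc_size ha hA h₃
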